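/- Work over $\mathbb{C}$. Let $C \subset \mathbb{P}^3$ be a smooth irreducible curve of degree $6$ and genus $3$ (i.e. its Hilbert polynomial is $6n+1-3$) which is an intersection of cubic surfaces: $C$ is, as a set, the common zero locus of a set of cubic forms. Then the blowup $Y$ of $\mathbb{P}^3$ with center $C$ exists, and $Y$ is isomorphic, as a scheme over $\mathbb{C}$, to the scheme-theoretic intersection $(\mathbb{P}^3\times\mathbb{P}^3)\cap \Lambda$ of the Segre variety $\mathbb{P}^3\times\mathbb{P}^3 \subset \mathbb{P}^{15}$ (the image of $([x],[y])\mapsto [x_iy_j]$) with a linear subspace $\Lambda\subset\mathbb{P}^{15}$ of codimension $3$ (depending on $C$). -/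

import Mathlib

open AlgebraicGeometry CategoryTheory Filter

namespace SexticBlowup

noncomputable section

/-! ### Projective schemes over a field, given by homogeneous ideals -/

section Graded

variable {k A : Type} [CommRing k] [CommRing A] [Algebra k A]
variable (𝒜 : ℕ → Submodule k A) [GradedAlgebra 𝒜]

/-- The degree-`n` piece `(A ⧸ I)ₙ` of the quotient of a graded algebra by a homogeneous ideal:
the image of `Aₙ`. -/
def quotientGrading (I : HomogeneousIdeal 𝒜) (n : ℕ) : Submodule k (A ⧸ I.toIdeal) :=
  (𝒜 n).map (Ideal.Quotient.mkₐ k I.toIdeal).toLinearMap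

variable {𝒜} in
lemma mk_mem_quotientGrading (I : HomogeneousIdeal 𝒜) {n : ℕ} {a : A} (ha : a ∈ 𝒜 n) :
    Ideal.Quotient.mk I.toIdeal a ∈ quotientGrading 𝒜 I n :=
  Submodule.mem_map.2 ⟨a, ha, rfl⟩

instance (I : HomogeneousIdeal 𝒜) : SetLike.GradedMonoid (quotientGrading 𝒜 I) where
  one_mem := mk_mem_quotientGrading I SetLike.GradedOne.one_mem
  mul_mem := by
    rintro i j _ _ ⟨a, ha, rfl⟩ ⟨b, hb, rfl⟩
    exact mk_mem_quotientGrading I (SetLike.GradedMul.mul_mem ha hb)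

/-- The map `Aₙ → (A ⧸ I)ₙ`. -/
def quotientComponent (I : HomogeneousIdeal 𝒜) (n : ℕ) : 𝒜 n →+ quotientGrading 𝒜 I n where
  toFun a := ⟨Ideal.Quotient.mk I.toIdeal a, mk_mem_quotientGrading I a.2⟩
  map_zero' := by ext; simp
  map_add' a b := by ext; simp

/-- The decomposition of a class in `A ⧸ I` into homogeneous components. -/
def quotientDecompose (I : HomogeneousIdeal 𝒜) :
    A ⧸ I.toIdeal →+ DirectSum ℕ (fun n => quotientGrading 𝒜 I n) :=
  QuotientAddGroup.lift I.toIdeal.toAddSubgroup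
    ((DirectSum.map (quotientComponent 𝒜 I)).comp
      (DirectSum.decomposeAddEquiv 𝒜).toAddMonoidHom) <| by
    intro a ha
    refine DFinsupp.ext fun n => Subtype.ext ?_
    exact Ideal.Quotient.eq_zero_iff_mem.2 (I.isHomogeneous n ha)

lemma quotientDecompose_mk (I : HomogeneousIdeal 𝒜) {n : ℕ} (a : 𝒜 n) :
    quotientDecompose 𝒜 I (Ideal.Quotient.mk I.toIdeal a) =
      DirectSum.of (fun n => quotientGrading 𝒜 I n) n (quotientComponent 𝒜 I n a) := by
  change DirectSum.map (quotientComponent 𝒜 I) (DirectSum.decompose 𝒜 (a : A)) = _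
  rw [DirectSum.decompose_coe, DirectSum.map_of]

instance (I : HomogeneousIdeal 𝒜) : DirectSum.Decomposition (quotientGrading 𝒜 I) where
  decompose' := quotientDecompose 𝒜 I
  left_inv x := by
    obtain ⟨a, rfl⟩ := Ideal.Quotient.mk_surjective x
    induction a using DirectSum.Decomposition.inductionOn 𝒜 with
    | zero => simp
    | homogeneous a => rw [quotientDecompose_mk, DirectSum.coeAddMonoidHom_of]; rfl
    | add a b ha hb => rw [map_add, map_add, map_add, ha, hb]
  right_inv x := by
    induction x using DirectSum.induction_on with
    | zero => simp
    | of n x =>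
      obtain ⟨_, a, ha, rfl⟩ := x
      rw [DirectSum.coeAddMonoidHom_of]
      exact quotientDecompose_mk 𝒜 I ⟨a, ha⟩
    | add x y hx hy => rw [map_add, map_add, hx, hy]

instance (I : HomogeneousIdeal 𝒜) : GradedAlgebra (quotientGrading 𝒜 I) where

/-- The structure morphism `Proj 𝒜 ⟶ Spec k` of a graded `k`-algebra. -/
def structureMap : Proj 𝒜 ⟶ Spec (.of k) :=
  Proj.toSpecZero 𝒜 ≫ Spec.map (CommRingCat.ofHom (algebraMap k (𝒜 0)))

end Graded

/-! ### Projective space -/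

/-- The standard grading of the polynomial ring `ℂ[X_s : s ∈ σ]`. -/
abbrev polyGrading (σ : Type) : ℕ → Submodule ℂ (MvPolynomial σ ℂ) :=
  MvPolynomial.homogeneousSubmodule σ ℂ

instance polyGradedAlgebra (σ : Type) : GradedAlgebra (polyGrading σ) := MvPolynomial.gradedAlgebra

/-- Complex projective space with homogeneous coordinates indexed by `σ`. -/
abbrev projSpace (σ : Type) : Scheme.{0} := Proj (polyGrading σ)

/-- The closed subscheme of projective space defined by a homogeneous ideal `I`: the scheme
`Proj (ℂ[X] ⧸ I)`. -/
abbrev projSubscheme {σ : Type} (I : HomogeneousIdeal (polyGrading σ)) : Scheme.{0} :=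
  Proj (quotientGrading (polyGrading σ) I)

/-! ### Curves in projective space -/

/-- The homogeneous ideal of a reduced closed subscheme `i : C ⟶ ℙ` of projective space: all
polynomials that vanish at all points of `C`. -/
def idealOf {σ : Type} {C : Scheme.{0}} (i : C ⟶ projSpace σ) : HomogeneousIdeal (polyGrading σ) :=
  ProjectiveSpectrum.vanishingIdeal (Set.range i : Set (ProjectiveSpectrum (polyGrading σ)))

/-- The Hilbert function `n ↦ dim_ℂ (ℂ[X] ⧸ I)ₙ` of a homogeneous ideal. -/
def hilbertFunction {σ : Type} (I : HomogeneousIdeal (polyGrading σ)) (n : ℕ) : ℕ :=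
  Module.finrank ℂ (quotientGrading (polyGrading σ) I n)

/-- The projective curve with homogeneous ideal `I` has degree `d` and (arithmetic) genus `g`:
its Hilbert polynomial is `d n + 1 - g`. -/
def HasDegreeGenus {σ : Type} (I : HomogeneousIdeal (polyGrading σ)) (d g : ℤ) : Prop :=
  ∀ᶠ n : ℕ in atTop, (hilbertFunction I n : ℤ) = d * n + 1 - g

/-- A subset of projective space is (set-theoretically) an intersection of hypersurfaces of
degree `d`. -/
def IsIntersectionOfDegree {σ : Type} (d : ℕ) (Z : Set (projSpace σ)) : Prop :=
  ∃ T : Set (MvPolynomial σ ℂ), T ⊆ polyGrading σ d ∧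
    Z = ProjectiveSpectrum.zeroLocus (polyGrading σ) T

/-! ### Blowups -/

/-- An ideal sheaf is invertible (the ideal of an effective Cartier divisor) if locally it is
generated by one nonzerodivisor. -/
def IsInvertibleIdeal {X : Scheme.{0}} (I : X.IdealSheafData) : Prop :=
  ∀ x : X, ∃ U : X.affineOpens, x ∈ U.1 ∧
    ∃ a ∈ nonZeroDivisors Γ(X, U.1), I.ideal U = Ideal.span {a}

/-- `π : Y ⟶ X` is the blowup of `X` along the closed subscheme with ideal sheaf `I`: the inverse
image ideal sheaf on `Y` is invertible, and `π` is universal with this property. -/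
structure IsBlowup {X Y : Scheme.{0}} (π : Y ⟶ X) (I : X.IdealSheafData) : Prop where
  isInvertible_comap : IsInvertibleIdeal (I.comap π)
  existsUnique_lift : ∀ {T : Scheme.{0}} (g : T ⟶ X), IsInvertibleIdeal (I.comap g) →
    ∃! h : T ⟶ Y, h ≫ π = g

/-! ### The Segre variety and its linear sections -/

/-- Substitution of the Segre parametrization `z_{(i,j)} = x_i y_j` into polynomials in the
coordinates `z_{(i,j)}`. -/
def segreHom (α β : Type) : MvPolynomial (α × β) ℂ →ₐ[ℂ] MvPolynomial (α ⊕ β) ℂ :=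
  MvPolynomial.aeval fun p => MvPolynomial.X (Sum.inl p.1) * MvPolynomial.X (Sum.inr p.2)

lemma homogeneousComponent_segreHom {α β : Type} (f : MvPolynomial (α × β) ℂ) (n : ℕ) :
    MvPolynomial.homogeneousComponent (2 * n) (segreHom α β f) =
      segreHom α β (MvPolynomial.homogeneousComponent n f) := by
  have hom (m : ℕ) (g : MvPolynomial (α × β) ℂ) (hg : g.IsHomogeneous m) :
      (segreHom α β g).IsHomogeneous (2 * m) :=
    hg.aeval _ fun p => (MvPolynomial.isHomogeneous_X ℂ _).mul (MvPolynomial.isHomogeneous_X ℂ _)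
  induction f using DirectSum.Decomposition.inductionOn (polyGrading (α × β)) with
  | zero => simp
  | @homogeneous m f =>
    have hf : f.1.IsHomogeneous m := (MvPolynomial.mem_homogeneousSubmodule _ _).1 f.2
    rw [MvPolynomial.homogeneousComponent_of_mem (hom m f.1 hf),
      MvPolynomial.homogeneousComponent_of_mem hf]
    by_cases h : n = m <;> simp [h]
  | add f g hf hg => simp only [map_add, hf, hg]

/-- The homogeneous ideal of the Segre variety, the image of the Segre embedding
`([x], [y]) ↦ [x_i y_j]`: all polynomials that vanish identically on it. -/
def segreIdeal (α β : Type) : HomogeneousIdeal (polyGrading (α × β)) where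
  toSubmodule := RingHom.ker (segreHom α β)
  is_homogeneous' := by
    intro n f hf
    have hn : ((DirectSum.decompose (polyGrading (α × β)) f n : polyGrading (α × β) n) :
        MvPolynomial (α × β) ℂ) = MvPolynomial.homogeneousComponent n f :=
      MvPolynomial.decomposition.decompose'_apply f n
    rw [hn]
    change segreHom α β (MvPolynomial.homogeneousComponent n f) = 0
    rw [← homogeneousComponent_segreHom, show segreHom α β f = 0 from hf, map_zero]

/-- A polynomial lies in the ideal of the Segre variety iff it vanishes at all points `x_i y_j`. -/
lemma mem_segreIdeal_iff {α β : Type} (f : MvPolynomial (α × β) ℂ) :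
    f ∈ segreIdeal α β ↔
      ∀ (x : α → ℂ) (y : β → ℂ), MvPolynomial.eval (fun p => x p.1 * y p.2) f = 0 := by
  have key (w : α ⊕ β → ℂ) : MvPolynomial.eval w (segreHom α β f) =
      MvPolynomial.eval (fun p => w (.inl p.1) * w (.inr p.2)) f := by
    have : (MvPolynomial.aeval w).comp (segreHom α β) =
        MvPolynomial.aeval (R := ℂ) (fun p : α × β => w (.inl p.1) * w (.inr p.2)) :=
      MvPolynomial.algHom_ext fun p => by simp [segreHom]
    simpa [MvPolynomial.aeval_eq_eval] using DFunLike.congr_fun this f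
  change segreHom α β f = 0 ↔ _
  refine ⟨fun h x y => ?_, fun h => MvPolynomial.funext fun w => ?_⟩
  · simpa [h] using (key (Sum.elim x y)).symm
  · rw [key, map_zero]
    exact h (fun a => w (.inl a)) (fun b => w (.inr b))

/-- The linear form `∑ a_s X_s`. -/
def linearForm {σ : Type} [Fintype σ] (a : σ → ℂ) : MvPolynomial σ ℂ :=
  ∑ s, MvPolynomial.C (a s) * MvPolynomial.X s

/-- The homogeneous ideal of the linear subspace `ℙ(V)` of projective space, for a linear subspace
`V ⊆ ℂ^σ`: it is generated by the linear forms that vanish on `V`. -/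
def linearIdeal {σ : Type} [Fintype σ] (V : Submodule ℂ (σ → ℂ)) :
    HomogeneousIdeal (polyGrading σ) where
  toSubmodule := Ideal.span {f | ∃ a : σ → ℂ, (∀ v ∈ V, ∑ s, a s * v s = 0) ∧ f = linearForm a}
  is_homogeneous' := by
    refine Ideal.homogeneous_span _ _ ?_
    rintro _ ⟨a, -, rfl⟩
    exact ⟨1, Submodule.sum_mem _ fun s _ =>
      (MvPolynomial.mem_homogeneousSubmodule _ _).2 (MvPolynomial.isHomogeneous_C_mul_X _ _)⟩

/-- The homogeneous ideal of the scheme-theoretic intersection of the Segre variety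
`ℙ³ × ℙ³ ⊆ ℙ¹⁵` with the linear subspace `ℙ(V)`. -/
def segreSectionIdeal (V : Submodule ℂ (Fin 4 × Fin 4 → ℂ)) :
    HomogeneousIdeal (polyGrading (Fin 4 × Fin 4)) :=
  segreIdeal (Fin 4) (Fin 4) ⊔ linearIdeal V

end

end SexticBlowup

open SexticBlowup

/-! By the Hilbert–Burch theorem, the four cubics through `C` are the maximal minors `Δⱼ` of a
`3 × 4` matrix `M` of linear forms. One sees this by restricting to two general planes in turn: the
curve becomes six points in a plane, and then the empty set in a line, where the restrictions of
the cubics are all the binary cubic forms, whose syzygies are linear; dimension counts with the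
Hilbert polynomial show that these syzygies lift back to `C`.

The blowup of `C` is then the locus `{(x, y) : M(x) y = 0}` in `ℙ³ × ℙ³`, which is cut out of the
Segre variety by three linear forms. Over a scheme where the ideal of the minors becomes
invertible, the minors divided by a local generator form a unimodular vector in the kernel of `M`,
and every other such vector is proportional to it; this is the universal property of the blowup.
That the minors generate an invertible ideal on the locus itself uses that `C` is smooth: by the
Jacobian criterion, the `2 × 2` minors of `M` have no common zero in `ℙ³`. -/

namespace SexticBlowup

open HomogeneousLocalization MvPolynomial

noncomputable section

attribute [local instance] MvPolynomial.gradedAlgebra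

section Forms

variable {R K σ : Type*} [CommRing R] [Field K]

lemma homogeneousComponent_mul_of_isHomogeneous {p : MvPolynomial σ R} {a : ℕ}
    (hp : p.IsHomogeneous a) (q : MvPolynomial σ R) (n : ℕ) :
    homogeneousComponent (a + n) (p * q) = p * homogeneousComponent n q := by
  rw [← decomposition.decompose'_apply, ← decomposition.decompose'_apply]
  exact DirectSum.coe_decompose_mul_add_of_left_mem (homogeneousSubmodule σ R) hp

lemma isHomogeneous_of_homogeneousComponent_mem {I : Ideal (MvPolynomial σ R)}
    (h : ∀ f ∈ I, ∀ n, homogeneousComponent n f ∈ I) :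
    I.IsHomogeneous (homogeneousSubmodule σ R) := fun n f hf => by
  have := h f hf n
  rwa [← decomposition.decompose'_apply] at this

lemma exists_isHomogeneous_eq_mul_of_dvd {p f : MvPolynomial σ R} {a n : ℕ}
    (hp : p.IsHomogeneous a) (hf : f.IsHomogeneous (a + n)) (h : p ∣ f) :
    ∃ q : MvPolynomial σ R, q.IsHomogeneous n ∧ f = p * q := by
  obtain ⟨q, rfl⟩ := h
  exact ⟨homogeneousComponent n q, homogeneousComponent_isHomogeneous _ _, by
    rw [← homogeneousComponent_mul_of_isHomogeneous hp, homogeneousComponent_eq_self hf]⟩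

lemma exists_eq_C_of_isHomogeneous_zero {f : MvPolynomial σ R} (hf : f.IsHomogeneous 0) :
    ∃ c, f = C c :=
  ⟨_, totalDegree_eq_zero_iff_eq_C.1 ((totalDegree_zero_iff_isHomogeneous σ).2 hf)⟩

lemma isUnit_of_isHomogeneous_zero {p : MvPolynomial σ K} (hp : p.IsHomogeneous 0) (h : p ≠ 0) :
    IsUnit p := by
  obtain ⟨c, rfl⟩ := exists_eq_C_of_isHomogeneous_zero hp
  exact (IsUnit.mk0 c fun hc => h (by rw [hc, map_zero])).map C

lemma not_isUnit_of_isHomogeneous [IsDomain R] {p : MvPolynomial σ R} {n : ℕ}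
    (hp : p.IsHomogeneous n) (hn : n ≠ 0) : ¬ IsUnit p := fun hu => by
  have h := hp.totalDegree hu.ne_zero
  exact hn (h ▸ (isUnit_iff_totalDegree_of_isReduced.1 hu).2)

/-- The homomorphism `X i ↦ X i * t` to polynomials in a new variable `t`. It turns homogeneous
components into coefficients, so that a form is a polynomial whose image is a monomial in `t`. -/
def scaleHom (R σ : Type*) [CommRing R] : MvPolynomial σ R →ₐ[R] Polynomial (MvPolynomial σ R) :=
  aeval fun i => Polynomial.C (X i) * Polynomial.X

lemma scaleHom_of_isHomogeneous {p : MvPolynomial σ R} {n : ℕ} (hp : p.IsHomogeneous n) :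
    scaleHom R σ p = Polynomial.C p * Polynomial.X ^ n := by
  have scaleHom_monomial (d : σ →₀ ℕ) (r : R) : scaleHom R σ (monomial d r) =
      Polynomial.C (monomial d r) * Polynomial.X ^ d.degree := by
    rw [scaleHom, aeval_monomial, Finsupp.prod]
    simp_rw [mul_pow, Finset.prod_mul_distrib, Finset.prod_pow_eq_pow_sum, ← map_pow, ← map_prod]
    rw [← mul_assoc, monomial_eq, Finsupp.prod, map_mul]
    rfl
  conv_lhs => rw [p.as_sum]
  conv_rhs => rw [p.as_sum]
  rw [map_sum, map_sum, Finset.sum_mul]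
  refine Finset.sum_congr rfl fun d hd => ?_
  rw [scaleHom_monomial, hp.degree_eq_sum_deg_support hd]
  rfl

lemma coeff_scaleHom (p : MvPolynomial σ R) (n : ℕ) :
    (scaleHom R σ p).coeff n = homogeneousComponent n p := by
  conv_lhs => rw [← sum_homogeneousComponent p]
  rw [map_sum, Polynomial.finsetSum_coeff]
  simp_rw [scaleHom_of_isHomogeneous (homogeneousComponent_isHomogeneous _ p),
    Polynomial.coeff_C_mul, Polynomial.coeff_X_pow]
  simp only [mul_ite, mul_one, mul_zero, Finset.sum_ite_eq, Finset.mem_range]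
  split_ifs with h
  · rfl
  · exact (homogeneousComponent_eq_zero _ _ (by lia)).symm

lemma scaleHom_injective : Function.Injective (scaleHom R σ) := by
  refine (injective_iff_map_eq_zero _).2 fun p hp => ?_
  rw [← sum_homogeneousComponent p]
  exact Finset.sum_eq_zero fun n _ => by rw [← coeff_scaleHom, hp, Polynomial.coeff_zero]

lemma isHomogeneous_natDegree_scaleHom {p : MvPolynomial σ R}
    (hp : (scaleHom R σ p).natDegree ≤ (scaleHom R σ p).natTrailingDegree) :
    p.IsHomogeneous (scaleHom R σ p).natDegree := by
  suffices h : homogeneousComponent (scaleHom R σ p).natDegree p = p by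
    have := homogeneousComponent_isHomogeneous (scaleHom R σ p).natDegree p
    rwa [h] at this
  refine scaleHom_injective (Polynomial.ext fun k => ?_)
  rw [scaleHom_of_isHomogeneous (homogeneousComponent_isHomogeneous _ _),
    Polynomial.coeff_C_mul_X_pow]
  split_ifs with h
  · rw [h, coeff_scaleHom]
  · rcases lt_or_gt_of_ne h with h | h
    · exact (Polynomial.coeff_eq_zero_of_lt_natTrailingDegree (h.trans_le hp)).symm
    · exact (Polynomial.coeff_eq_zero_of_natDegree_lt h).symm

lemma exists_isHomogeneous_of_mul_isHomogeneous [IsDomain R] {p q : MvPolynomial σ R} {n : ℕ}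
    (h : (p * q).IsHomogeneous n) (hpq : p * q ≠ 0) :
    ∃ a b, a + b = n ∧ p.IsHomogeneous a ∧ q.IsHomogeneous b := by
  have hp : scaleHom R σ p ≠ 0 := (map_ne_zero_iff _ scaleHom_injective).2 (left_ne_zero_of_mul hpq)
  have hq : scaleHom R σ q ≠ 0 :=
    (map_ne_zero_iff _ scaleHom_injective).2 (right_ne_zero_of_mul hpq)
  have scaleHom_mul :
      scaleHom R σ p * scaleHom R σ q = Polynomial.C (p * q) * Polynomial.X ^ n := by
    rw [← map_mul, scaleHom_of_isHomogeneous h]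
  have natDegree_add : (scaleHom R σ p).natDegree + (scaleHom R σ q).natDegree = n := by
    rw [← Polynomial.natDegree_mul hp hq, scaleHom_mul, Polynomial.natDegree_C_mul_X_pow _ _ hpq]
  have natTrailingDegree_add :
      (scaleHom R σ p).natTrailingDegree + (scaleHom R σ q).natTrailingDegree = n := by
    rw [← Polynomial.natTrailingDegree_mul hp hq, scaleHom_mul, Polynomial.C_mul_X_pow_eq_monomial,
      Polynomial.natTrailingDegree_monomial hpq]
  have := Polynomial.natTrailingDegree_le_natDegree (scaleHom R σ p)
  have := Polynomial.natTrailingDegree_le_natDegree (scaleHom R σ q)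
  exact ⟨_, _, natDegree_add, isHomogeneous_natDegree_scaleHom (by lia),
    isHomogeneous_natDegree_scaleHom (by lia)⟩

lemma exists_isHomogeneous_of_dvd [IsDomain R] {p f : MvPolynomial σ R} {n : ℕ}
    (hf : f.IsHomogeneous n) (h0 : f ≠ 0) (h : p ∣ f) : ∃ a ≤ n, p.IsHomogeneous a := by
  obtain ⟨q, rfl⟩ := h
  obtain ⟨a, b, rfl, ha, -⟩ := exists_isHomogeneous_of_mul_isHomogeneous hf h0
  exact ⟨a, Nat.le_add_right a b, ha⟩

lemma eq_zero_of_mul_isHomogeneous {p q : MvPolynomial σ R} [IsDomain R] {a b : ℕ}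
    (hp : p.IsHomogeneous a) (hpq : (p * q).IsHomogeneous b) (hab : b < a) : p * q = 0 := by
  by_contra h0
  obtain ⟨a', b', rfl, ha', -⟩ := exists_isHomogeneous_of_mul_isHomogeneous hpq h0
  have := hp.inj_right ha' (left_ne_zero_of_mul h0)
  lia

lemma irreducible_of_isHomogeneous_one {p : MvPolynomial σ K} (hp : p.IsHomogeneous 1)
    (h : p ≠ 0) : Irreducible p := by
  refine ⟨not_isUnit_of_isHomogeneous hp one_ne_zero, fun a b hab => ?_⟩
  have h' : a * b ≠ 0 := hab ▸ h
  obtain ⟨m, n, hmn, ha, hb⟩ := exists_isHomogeneous_of_mul_isHomogeneous (hab ▸ hp) h'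
  rcases Nat.eq_zero_or_pos m with rfl | hm
  · exact .inl (isUnit_of_isHomogeneous_zero ha (left_ne_zero_of_mul h'))
  · obtain rfl : n = 0 := by lia
    exact .inr (isUnit_of_isHomogeneous_zero hb (right_ne_zero_of_mul h'))

lemma exists_X_notMem_span_singleton [Nontrivial σ] {h : MvPolynomial σ K} (hh : Irreducible h) :
    ∃ i, X i ∉ Ideal.span {h} := by
  by_contra! H
  simp only [Ideal.mem_span_singleton] at H
  obtain ⟨i, j, hij⟩ := exists_pair_ne σ
  have hX : Irreducible (X i : MvPolynomial σ K) :=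
    irreducible_of_isHomogeneous_one (isHomogeneous_X K i) (X_ne_zero _)
  have hdvd : (X i : MvPolynomial σ K) ∣ X j :=
    (hh.associated_of_dvd hX (H i)).symm.dvd.trans (H j)
  exact hij (X_dvd_X.1 hdvd)

lemma isHomogeneous_span_of_isHomogeneous {f : MvPolynomial σ R} {d : ℕ} (hf : f.IsHomogeneous d) :
    (Ideal.span {f}).IsHomogeneous (homogeneousSubmodule σ R) :=
  Ideal.homogeneous_span _ _ fun _ hg => ⟨d, Set.mem_singleton_iff.1 hg ▸ hf⟩

lemma exists_irreducible_mem_of_isHomogeneous {I : Ideal (MvPolynomial σ K)} (hI : I.IsPrime)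
    {f : MvPolynomial σ K} {d : ℕ} (hf : f.IsHomogeneous d) (h0 : f ≠ 0) (hfI : f ∈ I) :
    ∃ p ∈ I, Irreducible p ∧ ∃ a ≤ d, p.IsHomogeneous a := by
  obtain ⟨s, hs, hsf⟩ := UniqueFactorizationMonoid.exists_prime_factors f h0
  obtain ⟨p, hp, hpI⟩ := (hI.multiset_prod_mem_iff_exists_mem s).1 (I.mem_of_dvd hsf.symm.dvd hfI)
  exact ⟨p, hpI, (hs p hp).irreducible,
    exists_isHomogeneous_of_dvd hf h0 ((Multiset.dvd_prod hp).trans hsf.dvd)⟩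

lemma finrank_homogeneousSubmodule [Fintype σ] (m : ℕ) :
    Module.finrank K (homogeneousSubmodule σ K m) = (Fintype.card σ).multichoose m := by
  classical
  have degree_eq : {d : σ →₀ ℕ | d.degree = m} =
      (Finset.univ.finsuppAntidiag m : Finset (σ →₀ ℕ)) := by
    ext d
    simp [Finsupp.degree_eq_sum]
  rw [homogeneousSubmodule_eq_finsupp_supported, degree_eq,
    (AddMonoidAlgebra.supportedEquivFinsupp _).finrank_eq, Module.finrank_finsupp_self,
    Fintype.card_of_finset' _ fun _ => Iff.rfl, Finset.card_finsuppAntidiag_nat_eq_multichoose,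
    Finset.card_univ]

instance finiteDimensional_homogeneousSubmodule [Finite σ] (n : ℕ) :
    FiniteDimensional K (homogeneousSubmodule σ K n) :=
  Module.Finite.iff_fg.2 (homogeneousSubmodule_fg σ K n)

/-- The degree `n` part `Iₙ` of an ideal `I` of a polynomial ring, as a space of polynomials. -/
def degreePart (I : Ideal (MvPolynomial σ R)) (n : ℕ) : Submodule R (MvPolynomial σ R) :=
  I.restrictScalars R ⊓ homogeneousSubmodule σ R n

lemma mem_degreePart {I : Ideal (MvPolynomial σ R)} {n : ℕ} {f : MvPolynomial σ R} :
    f ∈ degreePart I n ↔ f ∈ I ∧ f.IsHomogeneous n := Iff.rfl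

instance [Finite σ] (I : Ideal (MvPolynomial σ K)) (n : ℕ) : FiniteDimensional K (degreePart I n) :=
  Submodule.finiteDimensional_of_le (inf_le_right : _ ≤ homogeneousSubmodule σ K n)

lemma degreePart_mono {I J : Ideal (MvPolynomial σ R)} (h : I ≤ J) (n : ℕ) :
    degreePart I n ≤ degreePart J n :=
  inf_le_inf_right _ h

lemma finrank_degreePart_mono [Finite σ] {I J : Ideal (MvPolynomial σ K)} (h : I ≤ J) (m : ℕ) :
    Module.finrank K (degreePart I m) ≤ Module.finrank K (degreePart J m) :=
  Submodule.finrank_mono (degreePart_mono h m)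

lemma finrank_degreePart_le [Fintype σ] (I : Ideal (MvPolynomial σ K)) (m : ℕ) :
    Module.finrank K (degreePart I m) ≤ (Fintype.card σ).multichoose m :=
  finrank_homogeneousSubmodule (K := K) (σ := σ) m ▸ Submodule.finrank_mono inf_le_right

lemma le_of_degreePart_le {I J : Ideal (MvPolynomial σ R)}
    (hI : I.IsHomogeneous (homogeneousSubmodule σ R))
    (h : ∀ n, degreePart I n ≤ degreePart J n) : I ≤ J := by
  intro f hf
  rw [← sum_homogeneousComponent f]
  exact sum_mem fun n _ =>
    (h n ⟨homogeneousComponent_mem_of_mem hI hf n, homogeneousComponent_isHomogeneous n f⟩).1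

lemma degreePart_span_singleton {f : MvPolynomial σ R} {d : ℕ} (hf : f.IsHomogeneous d) (m : ℕ) :
    degreePart (Ideal.span {f}) (d + m) =
      (homogeneousSubmodule σ R m).map (LinearMap.mulLeft R f) := by
  ext g
  constructor
  · rintro ⟨hg, hg'⟩
    obtain ⟨q, hq, e⟩ := exists_isHomogeneous_eq_mul_of_dvd hf hg' (Ideal.mem_span_singleton.1 hg)
    exact ⟨q, hq, e.symm⟩
  · rintro ⟨q, hq, rfl⟩
    exact ⟨Ideal.mul_mem_right _ _ (Ideal.mem_span_singleton_self f), hf.mul hq⟩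

lemma finrank_degreePart_span_singleton [Fintype σ] {f : MvPolynomial σ K} {d : ℕ}
    (hf : f.IsHomogeneous d) (h0 : f ≠ 0) (m : ℕ) :
    Module.finrank K (degreePart (Ideal.span {f}) (d + m)) = (Fintype.card σ).multichoose m := by
  rw [degreePart_span_singleton hf, ← finrank_homogeneousSubmodule (K := K)]
  exact (Submodule.equivMapOfInjective (LinearMap.mulLeft K f)
    (fun _ _ => mul_left_cancel₀ h0) _).finrank_eq.symm

lemma span_singleton_inf_span_singleton_of_isRelPrime {R : Type*} [CommRing R]
    [DecompositionMonoid R] {f g : R} (h : IsRelPrime f g) :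
    Ideal.span {f} ⊓ Ideal.span {g} = Ideal.span {f * g} := by
  refine le_antisymm (fun x hx => ?_) (le_inf ?_ ?_)
  · simp only [Submodule.mem_inf, Ideal.mem_span_singleton] at hx ⊢
    exact h.mul_dvd hx.1 hx.2
  · exact Ideal.span_singleton_le_span_singleton.2 (Dvd.intro _ rfl)
  · exact Ideal.span_singleton_le_span_singleton.2 (Dvd.intro_left _ rfl)

lemma multichoose_add_le_finrank_degreePart [Fintype σ] {J : Ideal (MvPolynomial σ K)}
    {f g : MvPolynomial σ K} {a b : ℕ} (hf : f.IsHomogeneous a) (hg : g.IsHomogeneous b)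
    (hfJ : f ∈ J) (hgJ : g ∈ J) (hf0 : f ≠ 0) (hg0 : g ≠ 0) (hfg : IsRelPrime f g) (m : ℕ) :
    (Fintype.card σ).multichoose (b + m) + (Fintype.card σ).multichoose (a + m) ≤
      Module.finrank K (degreePart J (a + b + m)) + (Fintype.card σ).multichoose m := by
  rw [← finrank_degreePart_span_singleton hf hf0 (b + m),
    ← finrank_degreePart_span_singleton hg hg0 (a + m),
    ← finrank_degreePart_span_singleton (hf.mul hg) (mul_ne_zero hf0 hg0) m, ← add_assoc a b m,
    ← add_assoc b a m, add_comm b a, ← Submodule.finrank_sup_add_finrank_inf_eq,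
    ← span_singleton_inf_span_singleton_of_isRelPrime hfg]
  have inf_le : degreePart (Ideal.span {f}) (a + b + m) ⊓ degreePart (Ideal.span {g}) (a + b + m) ≤
      degreePart (Ideal.span {f} ⊓ Ideal.span {g}) (a + b + m) := fun _ h => ⟨⟨h.1.1, h.2.1⟩, h.1.2⟩
  have sup_le : degreePart (Ideal.span {f}) (a + b + m) ⊔ degreePart (Ideal.span {g}) (a + b + m) ≤
      degreePart J (a + b + m) :=
    sup_le (degreePart_mono (J.span_singleton_le_iff_mem.2 hfJ) _)
      (degreePart_mono (J.span_singleton_le_iff_mem.2 hgJ) _)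
  exact add_le_add (Submodule.finrank_mono sup_le) (Submodule.finrank_mono inf_le)

lemma two_mul_multichoose_three (m : ℕ) : 2 * Nat.multichoose 3 m = (m + 1) * (m + 2) := by
  induction m with
  | zero => rw [Nat.multichoose_zero_right]
  | succ m ih => rw [Nat.multichoose_succ_succ, Nat.multichoose_two]; linarith

lemma six_mul_multichoose_four (m : ℕ) :
    6 * Nat.multichoose 4 m = (m + 1) * (m + 2) * (m + 3) := by
  induction m with
  | zero => rw [Nat.multichoose_zero_right]
  | succ m ih =>
    have := two_mul_multichoose_three (m + 1)
    rw [Nat.multichoose_succ_succ]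
    linarith

lemma multichoose_add_finrank_degreePart_le [Fintype σ] {n : ℕ} (hn : Fintype.card σ = n + 1)
    {I : Ideal (MvPolynomial σ K)} {f : MvPolynomial σ K} {a : ℕ} (hf : f.IsHomogeneous (a + 1))
    (h0 : f ≠ 0) (hI : I ≤ Ideal.span {f}) (m : ℕ) :
    n.multichoose (a + 1 + m) + Module.finrank K (degreePart I (a + 1 + m)) ≤
      (n + 1).multichoose (a + 1 + m) := by
  have multichoose_mono : Monotone (n + 1).multichoose :=
    monotone_nat_of_le_succ fun k => Nat.multichoose_succ_succ n k ▸ Nat.le_add_left _ _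
  have hle := finrank_degreePart_mono hI (a + 1 + m)
  rw [finrank_degreePart_span_singleton hf h0, hn] at hle
  rw [show a + 1 + m = a + m + 1 by ring, Nat.multichoose_succ_succ] at *
  exact Nat.add_le_add_left (hle.trans (multichoose_mono (Nat.le_add_left m a))) _

end Forms

section Hyperplane

variable {R K : Type*} [CommRing R] [Field K] {n : ℕ} (l : Fin n → R)

/-- The restriction of polynomials to the hyperplane `X 0 = ∑ i, l i * X (i + 1)`, in the
coordinates `X 1, …, X n` of the hyperplane, renumbered from `0`. -/
def restrictHyperplane : MvPolynomial (Fin (n + 1)) R →ₐ[R] MvPolynomial (Fin n) R :=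
  aeval (Fin.cons (∑ i, C (l i) * X i) X)

/-- The equation `X 0 - ∑ i, l i * X (i + 1)` of the hyperplane of `restrictHyperplane l`. -/
def hyperplaneForm : MvPolynomial (Fin (n + 1)) R := X 0 - ∑ i, C (l i) * X i.succ

lemma restrictHyperplane_X_zero : restrictHyperplane l (X 0) = ∑ i, C (l i) * X i := by
  rw [restrictHyperplane, aeval_X, Fin.cons_zero]

lemma restrictHyperplane_X_succ (i : Fin n) : restrictHyperplane l (X i.succ) = X i := by
  rw [restrictHyperplane, aeval_X, Fin.cons_succ]

lemma restrictHyperplane_C (a : R) : restrictHyperplane l (C a) = C a :=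
  (restrictHyperplane l).commutes a

lemma restrictHyperplane_rename_succ (f : MvPolynomial (Fin n) R) :
    restrictHyperplane l (rename Fin.succ f) = f := by
  rw [restrictHyperplane, aeval_rename]
  exact aeval_X_left_apply f

lemma restrictHyperplane_surjective : Function.Surjective (restrictHyperplane l) :=
  fun f => ⟨rename Fin.succ f, restrictHyperplane_rename_succ l f⟩

lemma restrictHyperplane_hyperplaneForm : restrictHyperplane l (hyperplaneForm l) = 0 := by
  simp only [hyperplaneForm, map_sub, map_sum, map_mul, restrictHyperplane_X_zero,
    restrictHyperplane_X_succ, restrictHyperplane_C, sub_self]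

lemma isHomogeneous_hyperplaneForm : (hyperplaneForm l).IsHomogeneous 1 :=
  (isHomogeneous_X _ _).sub (IsHomogeneous.sum _ _ _ fun _ _ => isHomogeneous_C_mul_X _ _)

lemma hyperplaneForm_ne_zero [Nontrivial R] : hyperplaneForm l ≠ 0 := by
  intro h
  simpa [hyperplaneForm] using congrArg (eval (Fin.cons 1 0 : Fin (n + 1) → R)) h

lemma isHomogeneous_restrictHyperplane {f : MvPolynomial (Fin (n + 1)) R} {m : ℕ}
    (hf : f.IsHomogeneous m) : (restrictHyperplane l f).IsHomogeneous m := by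
  refine one_mul m ▸ hf.aeval (n := 1)
    (Fin.cons (∑ i, C (l i) * X i) X : Fin (n + 1) → MvPolynomial (Fin n) R)
    fun i => Fin.cases ?_ (fun i => ?_) i
  · exact IsHomogeneous.sum Finset.univ (fun i => C (l i) * X i) 1
      fun i _ => isHomogeneous_C_mul_X _ _
  · exact isHomogeneous_X R _

lemma homogeneousComponent_restrictHyperplane (f : MvPolynomial (Fin (n + 1)) R) (m : ℕ) :
    homogeneousComponent m (restrictHyperplane l f) =
      restrictHyperplane l (homogeneousComponent m f) := by
  conv_lhs => rw [← sum_homogeneousComponent f]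
  rw [map_sum, map_sum]
  simp_rw [homogeneousComponent_of_mem (isHomogeneous_restrictHyperplane l
    (homogeneousComponent_isHomogeneous _ f))]
  simp only [Finset.sum_ite_eq, Finset.mem_range]
  split_ifs with h
  · rfl
  · rw [homogeneousComponent_eq_zero _ _ (by lia), map_zero]

lemma sub_rename_restrictHyperplane_mem (f : MvPolynomial (Fin (n + 1)) R) :
    f - rename Fin.succ (restrictHyperplane l f) ∈ Ideal.span {hyperplaneForm l} := by
  rw [← Ideal.Quotient.mk_eq_mk_iff_sub_mem]
  suffices Ideal.Quotient.mkₐ R (Ideal.span {hyperplaneForm l}) =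
      ((Ideal.Quotient.mkₐ R (Ideal.span {hyperplaneForm l})).comp (rename Fin.succ)).comp
        (restrictHyperplane l) from DFunLike.congr_fun this f
  refine algHom_ext fun i => Fin.cases ?_ (fun i => ?_) i
  · refine (Ideal.Quotient.mk_eq_mk_iff_sub_mem _ _).2 ?_
    simp only [RingHom.coe_coe, restrictHyperplane_X_zero, map_sum, map_mul, rename_X, rename_C]
    exact Ideal.mem_span_singleton_self _
  · simp only [AlgHom.comp_apply, restrictHyperplane_X_succ, rename_X]

lemma restrictHyperplane_eq_zero_iff {f : MvPolynomial (Fin (n + 1)) R} :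
    restrictHyperplane l f = 0 ↔ hyperplaneForm l ∣ f := by
  refine ⟨fun h => ?_, ?_⟩
  · have := sub_rename_restrictHyperplane_mem l f
    rwa [h, map_zero, sub_zero, Ideal.mem_span_singleton] at this
  · rintro ⟨g, rfl⟩
    rw [map_mul, restrictHyperplane_hyperplaneForm, zero_mul]

lemma exists_eq_hyperplaneForm_mul {f : MvPolynomial (Fin (n + 1)) R} {m : ℕ}
    (hf : f.IsHomogeneous (m + 1)) (h : restrictHyperplane l f = 0) :
    ∃ g : MvPolynomial (Fin (n + 1)) R, g.IsHomogeneous m ∧ f = hyperplaneForm l * g :=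
  exists_isHomogeneous_eq_mul_of_dvd (isHomogeneous_hyperplaneForm l) (add_comm m 1 ▸ hf)
    ((restrictHyperplane_eq_zero_iff l).1 h)

section

variable {l} {I : Ideal (MvPolynomial (Fin (n + 1)) R)}

lemma mem_map_restrictHyperplane {f : MvPolynomial (Fin n) R} :
    f ∈ I.map (restrictHyperplane l) ↔ ∃ g ∈ I, restrictHyperplane l g = f :=
  Ideal.mem_map_iff_of_surjective (restrictHyperplane l) (restrictHyperplane_surjective l)

lemma isHomogeneous_map_restrictHyperplane (hI : I.IsHomogeneous (homogeneousSubmodule _ R)) :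
    (I.map (restrictHyperplane l)).IsHomogeneous (homogeneousSubmodule _ R) := by
  refine isHomogeneous_of_homogeneousComponent_mem fun f hf m => ?_
  obtain ⟨g, hg, rfl⟩ := mem_map_restrictHyperplane.1 hf
  rw [homogeneousComponent_restrictHyperplane]
  exact Ideal.mem_map_of_mem _ (homogeneousComponent_mem_of_mem hI hg m)

lemma map_degreePart_restrictHyperplane (hI : I.IsHomogeneous (homogeneousSubmodule _ R)) (m : ℕ) :
    (degreePart I m).map (restrictHyperplane l).toLinearMap =
      degreePart (I.map (restrictHyperplane l)) m := by
  ext f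
  constructor
  · rintro ⟨g, hg, rfl⟩
    exact ⟨Ideal.mem_map_of_mem _ hg.1, isHomogeneous_restrictHyperplane l hg.2⟩
  · intro hf
    obtain ⟨g, hg, rfl⟩ := mem_map_restrictHyperplane.1 hf.1
    exact ⟨homogeneousComponent m g,
      ⟨homogeneousComponent_mem_of_mem hI hg m, homogeneousComponent_isHomogeneous m g⟩,
      (homogeneousComponent_restrictHyperplane l g m).symm.trans
        (homogeneousComponent_eq_self hf.2)⟩

lemma map_mulLeft_degreePart_hyperplaneForm (hl : ∀ f, hyperplaneForm l * f ∈ I → f ∈ I) (m : ℕ) :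
    (degreePart I m).map (LinearMap.mulLeft R (hyperplaneForm l)) =
      degreePart I (m + 1) ⊓ (restrictHyperplane l).toLinearMap.ker := by
  ext f
  constructor
  · rintro ⟨g, hg, rfl⟩
    exact ⟨⟨I.mul_mem_left _ hg.1, add_comm 1 m ▸ (isHomogeneous_hyperplaneForm l).mul hg.2⟩,
      (restrictHyperplane_eq_zero_iff l).2 ⟨g, rfl⟩⟩
  · rintro ⟨hf, hf0⟩
    obtain ⟨g, hg, rfl⟩ := exists_eq_hyperplaneForm_mul l hf.2 hf0
    exact ⟨g, ⟨hl g hf.1, hg⟩, rfl⟩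

end

lemma finrank_degreePart_map_restrictHyperplane {l : Fin n → K}
    {I : Ideal (MvPolynomial (Fin (n + 1)) K)} (hI : I.IsHomogeneous (homogeneousSubmodule _ K))
    (hl : ∀ f, hyperplaneForm l * f ∈ I → f ∈ I) (m : ℕ) :
    Module.finrank K (degreePart (I.map (restrictHyperplane l)) (m + 1)) +
      Module.finrank K (degreePart I m) = Module.finrank K (degreePart I (m + 1)) := by
  have hinj : Function.Injective (LinearMap.mulLeft K (hyperplaneForm l)) :=
    fun _ _ => mul_left_cancel₀ (hyperplaneForm_ne_zero l)
  rw [(Submodule.equivMapOfInjective _ hinj (degreePart I m)).finrank_eq,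
    map_mulLeft_degreePart_hyperplaneForm hl, ← map_degreePart_restrictHyperplane hI]
  have rank_nullity :=
    ((restrictHyperplane l).toLinearMap.domRestrict (degreePart I (m + 1)))
      |>.finrank_range_add_finrank_ker
  rw [LinearMap.range_domRestrict, LinearMap.ker_domRestrict,
    ← Submodule.finrank_map_subtype_eq, Submodule.map_comap_subtype] at rank_nullity
  exact rank_nullity

end Hyperplane

section Saturation

section

variable {A : Type*} [CommRing A] {𝔪 B : Ideal A} {f : A}

/-- The saturation `⋃ k, (B : 𝔪 ^ k)` of the ideal `B` with respect to `𝔪`. -/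
def saturation (𝔪 B : Ideal A) : Ideal A := ⨆ k : ℕ, B.colon (𝔪 ^ k : Ideal A)

lemma monotone_colon_pow (𝔪 B : Ideal A) : Monotone fun k : ℕ => B.colon (𝔪 ^ k : Ideal A) :=
  fun _ _ h => Submodule.colon_mono le_rfl (Ideal.pow_le_pow_right h)

lemma mem_saturation : f ∈ saturation 𝔪 B ↔ ∃ k : ℕ, ∀ g ∈ 𝔪 ^ k, f * g ∈ B := by
  simp only [saturation, Submodule.mem_iSup_of_directed _ (monotone_colon_pow 𝔪 B).directed_le,
    Submodule.mem_colon, SetLike.mem_coe, smul_eq_mul]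

lemma le_saturation : B ≤ saturation 𝔪 B :=
  fun _ hf => mem_saturation.2 ⟨0, fun g _ => B.mul_mem_right g hf⟩

variable [IsNoetherianRing A]

variable (𝔪 B) in
lemma exists_saturation_mul_pow_le : ∃ k : ℕ, saturation 𝔪 B * 𝔪 ^ k ≤ B := by
  refine ⟨monotonicSequenceLimitIndex ⟨_, monotone_colon_pow 𝔪 B⟩, Ideal.mul_le.2 fun f hf => ?_⟩
  exact Submodule.mem_colon.1
    ((WellFoundedGT.iSup_eq_monotonicSequenceLimit ⟨_, monotone_colon_pow 𝔪 B⟩).le hf)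

lemma mem_saturation_of_forall_mul_mem (h : ∀ g ∈ 𝔪, g * f ∈ saturation 𝔪 B) :
    f ∈ saturation 𝔪 B := by
  obtain ⟨k, hk⟩ := exists_saturation_mul_pow_le 𝔪 B
  refine mem_saturation.2 ⟨k + 1, fun g hg => ?_⟩
  have span_mul_le : Ideal.span {f} * 𝔪 ≤ saturation 𝔪 B :=
    Ideal.span_singleton_mul_le_iff.2 fun g hg => mul_comm f g ▸ h g hg
  refine (Ideal.mul_mono_left span_mul_le |>.trans hk) ?_
  rw [mul_assoc, ← pow_succ']
  exact Ideal.mul_mem_mul (Ideal.mem_span_singleton_self f) hg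

end

lemma exists_notMem_forall_smul_eq_zero {K A V M : Type*} [Field K] [Infinite K] [CommRing A]
    [IsNoetherianRing A] [Algebra K A] [AddCommGroup V] [Module K V] [AddCommGroup M] [Module A M]
    [Module.Finite A M] (φ : V →ₗ[K] A) (hφ : ∀ x : M, (∀ v, φ v • x = 0) → x = 0)
    {W : Subspace K V} (hW : W ≠ ⊤) : ∃ v ∉ W, ∀ x : M, φ v • x = 0 → x = 0 := by
  classical
  let avoided (P : Ideal A) : Subspace K V := (P.restrictScalars K).comap φ
  have avoided_ne_top {P : Ideal A} (hP : P ∈ associatedPrimes A M) : avoided P ≠ ⊤ := fun h => by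
    obtain ⟨hprime, x, rfl⟩ := isAssociatedPrime_iff.1 hP
    refine hprime.ne_top ((Ideal.eq_top_iff_one _).2 ?_)
    rw [Submodule.mem_colon_singleton, one_smul]
    refine hφ x fun v => ?_
    have hv : v ∈ avoided _ := h ▸ Submodule.mem_top
    exact Submodule.mem_colon_singleton.1 hv
  have hfin := associatedPrimes.finite A M
  obtain ⟨v, hv⟩ := (Set.ne_univ_iff_exists_notMem _).1
    (Subspace.biUnion_ne_univ_of_top_notMem (s := insert W (hfin.toFinset.image avoided)) (by
      simp only [Finset.mem_insert, Finset.mem_image, hfin.mem_toFinset, not_or, not_exists,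
        not_and]
      exact ⟨hW.symm, fun _ => avoided_ne_top⟩))
  simp only [Finset.mem_insert, Finset.mem_image, hfin.mem_toFinset, Set.mem_iUnion, not_exists,
    SetLike.mem_coe] at hv
  refine ⟨v, hv W (.inl rfl), fun x hx => ?_⟩
  by_contra hx0
  obtain ⟨P, hP, hvP⟩ := Set.mem_iUnion₂.1
    ((biUnion_associatedPrimes_eq_zero_divisors A M).ge ⟨x, hx0, hx⟩)
  exact hv (avoided P) (.inr ⟨P, hP, rfl⟩) hvP

variable {R K σ : Type*} [CommRing R] [Field K] {n : ℕ}

lemma isHomogeneous_idealOfVars_pow (k : ℕ) :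
    (idealOfVars σ R ^ k).IsHomogeneous (homogeneousSubmodule σ R) := by
  rw [pow_idealOfVars_eq_span]
  refine Ideal.homogeneous_span _ _ ?_
  rintro _ ⟨d, -, rfl⟩
  exact ⟨d.degree, isHomogeneous_monomial _ rfl⟩

lemma mem_idealOfVars_pow {f : MvPolynomial σ R} {m k : ℕ} (hf : f.IsHomogeneous m) (h : k ≤ m) :
    f ∈ idealOfVars σ R ^ k :=
  (mem_pow_idealOfVars_iff k f).2 fun _ hx =>
    h.trans_eq (hf.degree_eq_sum_deg_support hx)

lemma isHomogeneous_saturation {B : Ideal (MvPolynomial σ R)}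
    (hB : B.IsHomogeneous (homogeneousSubmodule σ R)) :
    (saturation (idealOfVars σ R) B).IsHomogeneous (homogeneousSubmodule σ R) := by
  refine isHomogeneous_of_homogeneousComponent_mem fun f hf m => ?_
  obtain ⟨k, hk⟩ := mem_saturation.1 hf
  refine mem_saturation.2 ⟨k, fun g hg => ?_⟩
  rw [← sum_homogeneousComponent g, Finset.mul_sum]
  refine sum_mem fun j _ => ?_
  rw [mul_comm,
    ← homogeneousComponent_mul_of_isHomogeneous (homogeneousComponent_isHomogeneous j g), mul_comm]
  exact homogeneousComponent_mem_of_mem hB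
    (hk _ (homogeneousComponent_mem_of_mem (isHomogeneous_idealOfVars_pow k) hg j)) _

lemma exists_degreePart_le_mul_idealOfVars_pow [Finite σ] [IsNoetherianRing R]
    {J : Ideal (MvPolynomial σ R)} (hJ : J.IsHomogeneous (homogeneousSubmodule σ R)) (k : ℕ) :
    ∃ N, ∀ m ≥ N, degreePart J m ≤ degreePart (J * idealOfVars σ R ^ k) m := by
  obtain ⟨s, rfl⟩ := (isNoetherianRing_iff_ideal_fg _).1 inferInstance J
  refine ⟨s.sup totalDegree + k, fun m hm f hf => mem_degreePart.2 ⟨?_, hf.2⟩⟩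
  obtain ⟨c, -, hc⟩ := Submodule.mem_span_finset.1 hf.1
  rw [← homogeneousComponent_eq_self hf.2, ← hc, map_sum]
  refine sum_mem fun a ha => ?_
  rw [smul_eq_mul, mul_comm (c a)]
  generalize c a = b
  rw [← sum_homogeneousComponent a, Finset.sum_mul, map_sum]
  refine sum_mem fun d hd => ?_
  have hsup : a.totalDegree ≤ s.sup totalDegree := Finset.le_sup ha
  have hd : d < a.totalDegree + 1 := Finset.mem_range.1 hd
  obtain ⟨e, rfl⟩ : ∃ e, m = d + e := ⟨m - d, by lia⟩
  rw [homogeneousComponent_mul_of_isHomogeneous (homogeneousComponent_isHomogeneous d a)]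
  exact Ideal.mul_mem_mul (homogeneousComponent_mem_of_mem hJ (Ideal.subset_span ha) d)
    (mem_idealOfVars_pow (homogeneousComponent_isHomogeneous e _) (by lia))

lemma exists_degreePart_saturation_le [Finite σ] [IsNoetherianRing R] {B : Ideal (MvPolynomial σ R)}
    (hB : B.IsHomogeneous (homogeneousSubmodule σ R)) :
    ∃ N, ∀ m ≥ N, degreePart (saturation (idealOfVars σ R) B) m ≤ degreePart B m := by
  obtain ⟨k, hk⟩ := exists_saturation_mul_pow_le (idealOfVars σ R) B
  obtain ⟨N, hN⟩ := exists_degreePart_le_mul_idealOfVars_pow (isHomogeneous_saturation hB) k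
  exact ⟨N, fun m hm => (hN m hm).trans (degreePart_mono hk m)⟩

lemma exists_smul_hyperplaneForm {a : Fin (n + 1) → K} (ha : a 0 ≠ 0) :
    ∃ l : Fin n → K, Fintype.linearCombination K X a = a 0 • hyperplaneForm l := by
  refine ⟨fun i => -(a i.succ / a 0), ?_⟩
  rw [Fintype.linearCombination_apply, Fin.sum_univ_succ, hyperplaneForm, smul_sub, Finset.smul_sum,
    sub_eq_add_neg, ← Finset.sum_neg_distrib]
  refine congrArg _ (Finset.sum_congr rfl fun i _ => ?_)
  rw [← smul_eq_C_mul, smul_smul, ← neg_smul, mul_neg, neg_neg, mul_div_cancel₀ _ ha]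

lemma exists_hyperplaneForm_mul_mem [Infinite K] (B : Ideal (MvPolynomial (Fin (n + 1)) K)) :
    ∃ l : Fin n → K, ∀ f, hyperplaneForm l * f ∈ saturation (idealOfVars _ K) B →
      f ∈ saturation (idealOfVars _ K) B := by
  let J := saturation (idealOfVars (Fin (n + 1)) K) B
  let toLinearForm : (Fin (n + 1) → K) →ₗ[K] MvPolynomial (Fin (n + 1)) K :=
    Fintype.linearCombination K X
  have eq_zero_of_linearForms (x : MvPolynomial (Fin (n + 1)) K ⧸ J)
      (hx : ∀ a, toLinearForm a • x = 0) : x = 0 := by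
    obtain ⟨x, rfl⟩ := Ideal.Quotient.mk_surjective x
    refine Ideal.Quotient.eq_zero_iff_mem.2 (mem_saturation_of_forall_mul_mem fun g hg => ?_)
    suffices idealOfVars _ K ≤ J.colon {x} from Submodule.mem_colon_singleton.1 (this hg)
    refine Ideal.span_le.2 ?_
    rintro _ ⟨i, rfl⟩
    have toLinearForm_single : toLinearForm (Pi.single i 1) = X i := by
      rw [Fintype.linearCombination_apply_single, one_smul]
    have := toLinearForm_single ▸ hx (Pi.single i 1)
    exact Submodule.mem_colon_singleton.2 (Ideal.Quotient.eq_zero_iff_mem.1 this)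
  have proj_ker_ne_top : LinearMap.ker (LinearMap.proj 0 : (Fin (n + 1) → K) →ₗ[K] K) ≠ ⊤ :=
    fun h => one_ne_zero (α := K) (DFunLike.congr_fun (LinearMap.ker_eq_top.1 h) fun _ => 1)
  obtain ⟨a, ha0, ha⟩ :=
    exists_notMem_forall_smul_eq_zero toLinearForm eq_zero_of_linearForms proj_ker_ne_top
  obtain ⟨l, hl⟩ := exists_smul_hyperplaneForm ha0
  refine ⟨l, fun f hf => Ideal.Quotient.eq_zero_iff_mem.1 (ha _ ?_)⟩
  rw [hl]
  refine Ideal.Quotient.eq_zero_iff_mem.2 ((?_ : (a 0 • hyperplaneForm l) * f ∈ J))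
  rw [smul_mul_assoc, smul_eq_C_mul]
  exact J.mul_mem_left _ hf

end Saturation

section CurveIdeal

variable {K σ : Type*} [Field K]

/-- The properties of the homogeneous ideal of a sextic curve of genus 3 in `ℙ³`, cut out by cubics,
on which the proof rests. The condition `le_of_cubics` says that a closed integral subscheme of `ℙ³`
on which the cubics of `I` vanish is contained in the curve. -/
structure IsCubicSexticIdeal (I : Ideal (MvPolynomial (Fin 4) K)) : Prop where
  isPrime : I.IsPrime
  isHomogeneous : I.IsHomogeneous (homogeneousSubmodule _ K)
  finrank_degreePart :
    ∀ᶠ m in atTop, Module.finrank K (degreePart I m) + 6 * m = Nat.multichoose 4 m + 2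
  le_of_cubics : ∀ P : Ideal (MvPolynomial (Fin 4) K), P.IsPrime →
    P.IsHomogeneous (homogeneousSubmodule _ K) → (∃ i, X i ∉ P) →
    (∀ f ∈ degreePart I 3, f ∈ P) → I ≤ P

/-- The properties of the ideal of a hyperplane section of such a curve: six points in the plane,
such that the cubics of the ideal have no common component. -/
structure IsSixPointIdeal (B : Ideal (MvPolynomial (Fin 3) K)) : Prop where
  isHomogeneous : B.IsHomogeneous (homogeneousSubmodule _ K)
  finrank_degreePart :
    ∀ᶠ m in atTop, Module.finrank K (degreePart B m) + 6 = Nat.multichoose 3 m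
  exists_cubic : ∀ {h : MvPolynomial (Fin 3) K} {d : ℕ}, Irreducible h → h.IsHomogeneous d →
    ∃ F ∈ degreePart B 3, ¬ h ∣ F

lemma ne_zero_of_irreducible_isHomogeneous {p : MvPolynomial σ K} {d : ℕ} (hp : Irreducible p)
    (hd : p.IsHomogeneous d) : d ≠ 0 := by
  rintro rfl
  exact hp.not_isUnit (isUnit_of_isHomogeneous_zero hd hp.ne_zero)

namespace IsCubicSexticIdeal

variable {I : Ideal (MvPolynomial (Fin 4) K)} (hI : IsCubicSexticIdeal I)

include hI

lemma exists_cubic {h : MvPolynomial (Fin 4) K} {d : ℕ} (hh : Irreducible h)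
    (hd : h.IsHomogeneous d) : ∃ F ∈ degreePart I 3, ¬ h ∣ F := by
  by_contra! dvd_cubics
  have I_le : I ≤ Ideal.span {h} := hI.le_of_cubics _
    ((Ideal.span_singleton_prime hh.ne_zero).2 hh.prime) (isHomogeneous_span_of_isHomogeneous hd)
    (exists_X_notMem_span_singleton hh) fun F hF => Ideal.mem_span_singleton.2 (dvd_cubics F hF)
  obtain ⟨a, rfl⟩ := Nat.exists_eq_succ_of_ne_zero (ne_zero_of_irreducible_isHomogeneous hh hd)
  obtain ⟨N, hN⟩ := eventually_atTop.1 hI.finrank_degreePart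
  have growth := multichoose_add_finrank_degreePart_le (n := 3) (Fintype.card_fin 4) hd hh.ne_zero
    I_le (N + 20)
  have hilbert := hN (a + 1 + (N + 20)) (by lia)
  have := two_mul_multichoose_three (a + 1 + (N + 20))
  nlinarith

lemma eq_zero {d : ℕ} (hd : d ≤ 2) {f : MvPolynomial (Fin 4) K} (hf : f.IsHomogeneous d)
    (hfI : f ∈ I) : f = 0 := by
  by_contra h0
  obtain ⟨p, hpI, hp, a, ha, hpa⟩ := exists_irreducible_mem_of_isHomogeneous hI.isPrime hf h0 hfI
  obtain ⟨F, hF, hpF⟩ := hI.exists_cubic hp hpa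
  obtain ⟨N, hN⟩ := eventually_atTop.1 hI.finrank_degreePart
  have complete_intersection := multichoose_add_le_finrank_degreePart hpa hF.2 hpI hF.1 hp.ne_zero
    (fun h => hpF (h ▸ dvd_zero p)) (hp.isRelPrime_iff_not_dvd.2 hpF) N
  rw [Fintype.card_fin] at complete_intersection
  have hilbert := hN (a + 3 + N) (by lia)
  have := six_mul_multichoose_four N
  have := six_mul_multichoose_four (3 + N)
  have := six_mul_multichoose_four (a + N)
  have := six_mul_multichoose_four (a + 3 + N)
  obtain rfl | rfl | rfl : a = 0 ∨ a = 1 ∨ a = 2 := by lia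
  all_goals linarith

lemma degreePart_two_eq_bot : degreePart I 2 = ⊥ :=
  (Submodule.eq_bot_iff _).2 fun _ hf => hI.eq_zero le_rfl hf.2 hf.1

variable (l₀ : Fin 3 → K)

lemma hyperplaneForm_mul_mem (f : MvPolynomial (Fin 4) K) (hf : hyperplaneForm l₀ * f ∈ I) :
    f ∈ I :=
  (hI.isPrime.mem_or_mem hf).resolve_left fun h => hyperplaneForm_ne_zero l₀
    (hI.eq_zero one_le_two (isHomogeneous_hyperplaneForm l₀) h)

lemma finrank_degreePart_succ (m : ℕ) :
    Module.finrank K (degreePart (I.map (restrictHyperplane l₀)) (m + 1)) +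
      Module.finrank K (degreePart I m) = Module.finrank K (degreePart I (m + 1)) :=
  finrank_degreePart_map_restrictHyperplane hI.isHomogeneous (hI.hyperplaneForm_mul_mem l₀) m

lemma finrank_degreePart_map : ∀ᶠ m in atTop,
    Module.finrank K (degreePart (I.map (restrictHyperplane l₀)) m) + 6 = Nat.multichoose 3 m := by
  obtain ⟨N, hN⟩ := eventually_atTop.1 hI.finrank_degreePart
  refine eventually_atTop.2 ⟨N + 1, fun m hm => ?_⟩
  obtain ⟨m, rfl⟩ := Nat.exists_eq_add_of_le' (Nat.le_of_add_left_le hm)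
  have := hN m (by lia)
  have := hN (m + 1) (by lia)
  have := hI.finrank_degreePart_succ l₀ m
  have := Nat.multichoose_succ_succ 3 m
  lia

lemma isSixPointIdeal : IsSixPointIdeal (I.map (restrictHyperplane l₀)) := by
  refine ⟨isHomogeneous_map_restrictHyperplane hI.isHomogeneous, hI.finrank_degreePart_map l₀,
    fun {h d} hh hd => ?_⟩
  by_contra! dvd_cubics
  let P : Ideal (MvPolynomial (Fin 4) K) := (Ideal.span {h}).comap (restrictHyperplane l₀)
  have span_isPrime : (Ideal.span {h}).IsPrime :=
    (Ideal.span_singleton_prime hh.ne_zero).2 hh.prime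
  have P_isHomogeneous : P.IsHomogeneous (homogeneousSubmodule _ K) := by
    refine isHomogeneous_of_homogeneousComponent_mem fun f hf m => ?_
    have := homogeneousComponent_mem_of_mem (isHomogeneous_span_of_isHomogeneous hd) hf m
    rwa [homogeneousComponent_restrictHyperplane] at this
  have exists_X_notMem : ∃ i, X i ∉ P := by
    obtain ⟨i, hi⟩ := exists_X_notMem_span_singleton hh
    exact ⟨i.succ, fun h => hi (restrictHyperplane_X_succ l₀ i ▸ h)⟩
  have I_le : I ≤ P := hI.le_of_cubics P (Ideal.comap_isPrime _ _) P_isHomogeneous exists_X_notMem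
    fun f hf => Ideal.mem_span_singleton.2
      (dvd_cubics _ ⟨Ideal.mem_map_of_mem _ hf.1, isHomogeneous_restrictHyperplane l₀ hf.2⟩)
  obtain ⟨a, rfl⟩ := Nat.exists_eq_succ_of_ne_zero (ne_zero_of_irreducible_isHomogeneous hh hd)
  obtain ⟨N, hN⟩ := eventually_atTop.1 (hI.finrank_degreePart_map l₀)
  have growth := multichoose_add_finrank_degreePart_le (n := 2) (Fintype.card_fin 3) hd hh.ne_zero
    (Ideal.map_le_iff_le_comap.2 I_le) (N + 20)
  have hilbert := hN (a + 1 + (N + 20)) (by lia)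
  rw [Nat.multichoose_two] at growth
  lia

end IsCubicSexticIdeal

end CurveIdeal

section HyperplaneSection

variable {K σ : Type*} [Field K]

lemma exists_isRelPrime_of_forall_not_dvd [Infinite K] {V : Submodule K (MvPolynomial σ K)}
    {q : MvPolynomial σ K} (hq : q ≠ 0)
    (h : ∀ p, Irreducible p → p ∣ q → ∃ F ∈ V, ¬ p ∣ F) : ∃ F ∈ V, IsRelPrime q F := by
  classical
  let multiples (p : MvPolynomial σ K) : Subspace K V :=
    ((Ideal.span {p}).restrictScalars K).comap V.subtype
  have mem_multiples {p : MvPolynomial σ K} {F : V} : F ∈ multiples p ↔ p ∣ F :=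
    Ideal.mem_span_singleton
  have multiples_ne_top {p : MvPolynomial σ K} (hp : p ∈ UniqueFactorizationMonoid.factors q) :
      multiples p ≠ ⊤ := fun htop => by
    obtain ⟨F, hF, hpF⟩ := h p (UniqueFactorizationMonoid.irreducible_of_factor p hp)
      (UniqueFactorizationMonoid.dvd_of_mem_factors hp)
    exact hpF (mem_multiples.1 (htop ▸ Submodule.mem_top : (⟨F, hF⟩ : V) ∈ multiples p))
  obtain ⟨F, hF⟩ := (Set.ne_univ_iff_exists_notMem _).1
    (Subspace.biUnion_ne_univ_of_top_notMem
      (s := (UniqueFactorizationMonoid.factors q).toFinset.image multiples) (by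
        simp only [Finset.mem_image, Multiset.mem_toFinset, not_exists, not_and]
        exact fun _ => multiples_ne_top))
  refine ⟨F, F.2, WfDvdMonoid.isRelPrime_of_no_irreducible_factors (fun h0 => hq h0.1)
    fun p hp hpq hpF => hF ?_⟩
  obtain ⟨p', hp', hpp'⟩ := UniqueFactorizationMonoid.exists_mem_factors_of_dvd hq hp hpq
  exact Set.mem_biUnion (Finset.mem_image_of_mem _ (Multiset.mem_toFinset.2 hp'))
    (mem_multiples.2 (hpp'.symm.dvd.trans hpF))

lemma IsSixPointIdeal.exists_cubic_isRelPrime [Infinite K] {B : Ideal (MvPolynomial (Fin 3) K)}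
    (hB : IsSixPointIdeal B) {q : MvPolynomial (Fin 3) K} {d : ℕ} (hq : q.IsHomogeneous d)
    (hq0 : q ≠ 0) : ∃ F ∈ degreePart B 3, IsRelPrime q F :=
  exists_isRelPrime_of_forall_not_dvd hq0 fun _ hp hpq =>
    have ⟨_, _, ha⟩ := exists_isHomogeneous_of_dvd hq hq0 hpq
    hB.exists_cubic hp ha

lemma exists_isHomogeneous_of_mem_span_pair {R : Type*} [CommRing R] {p q f : MvPolynomial σ R}
    {a b c d : ℕ} (hp : p.IsHomogeneous a) (hq : q.IsHomogeneous b) (hf : f.IsHomogeneous (a + c))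
    (hd : a + c = b + d) (h : f ∈ Ideal.span {p, q}) :
    ∃ u v : MvPolynomial σ R, u.IsHomogeneous c ∧ v.IsHomogeneous d ∧ f = p * u + q * v := by
  obtain ⟨u, v, huv⟩ := Ideal.mem_span_pair.1 h
  refine ⟨homogeneousComponent c u, homogeneousComponent d v,
    homogeneousComponent_isHomogeneous _ _, homogeneousComponent_isHomogeneous _ _, ?_⟩
  rw [← homogeneousComponent_mul_of_isHomogeneous hp,
    ← homogeneousComponent_mul_of_isHomogeneous hq, ← hd, ← map_add, mul_comm p, mul_comm q, huv,
    homogeneousComponent_eq_self hf]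

lemma mem_span_pair_of_hyperplaneForm_mul_mem {n : ℕ} {l : Fin n → K}
    {q F f : MvPolynomial (Fin (n + 1)) K}
    (hcop : IsRelPrime (restrictHyperplane l q) (restrictHyperplane l F))
    (hq : restrictHyperplane l q ≠ 0) (hf : hyperplaneForm l * f ∈ Ideal.span {q, F}) :
    f ∈ Ideal.span {q, F} := by
  obtain ⟨a, b, hab⟩ := Ideal.mem_span_pair.1 hf
  have relation : restrictHyperplane l a * restrictHyperplane l q +
      restrictHyperplane l b * restrictHyperplane l F = 0 := by
    rw [← map_mul, ← map_mul, ← map_add, hab, map_mul, restrictHyperplane_hyperplaneForm, zero_mul]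
  obtain ⟨c, hb⟩ : restrictHyperplane l q ∣ restrictHyperplane l b :=
    hcop.dvd_of_dvd_mul_right ⟨-restrictHyperplane l a, by linear_combination relation⟩
  obtain ⟨c, rfl⟩ := restrictHyperplane_surjective l c
  have ha : restrictHyperplane l a = -(restrictHyperplane l F * restrictHyperplane l c) :=
    mul_left_cancel₀ hq (by rw [hb] at relation; linear_combination relation)
  obtain ⟨a', ha'⟩ : hyperplaneForm l ∣ a + F * c := (restrictHyperplane_eq_zero_iff l).1 (by
    rw [map_add, map_mul, ha, neg_add_cancel])
  obtain ⟨b', hb'⟩ : hyperplaneForm l ∣ b - q * c := (restrictHyperplane_eq_zero_iff l).1 (by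
    rw [map_sub, map_mul, hb, sub_self])
  refine Ideal.mem_span_pair.2 ⟨a', b', mul_left_cancel₀ (hyperplaneForm_ne_zero l) ?_⟩
  linear_combination hab - q * ha' - F * hb'

lemma mem_span_pair_of_hyperplaneForm_pow_mul_mem {n : ℕ} {l : Fin n → K}
    {q F f : MvPolynomial (Fin (n + 1)) K}
    (hcop : IsRelPrime (restrictHyperplane l q) (restrictHyperplane l F))
    (hq : restrictHyperplane l q ≠ 0) {k : ℕ} (hf : hyperplaneForm l ^ k * f ∈ Ideal.span {q, F}) :
    f ∈ Ideal.span {q, F} := by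
  induction k with
  | zero => rwa [pow_zero, one_mul] at hf
  | succ k ih =>
    rw [pow_succ', mul_assoc] at hf
    exact ih (mem_span_pair_of_hyperplaneForm_mul_mem hcop hq hf)

/-- `J` is a saturation of the homogeneous ideal `B`: the two agree in large degrees, and the
irrelevant ideal is not associated to `J`, which is expressed by a linear form that is a
nonzerodivisor modulo `J`. -/
structure IsSaturationOf {n : ℕ} (B J : Ideal (MvPolynomial (Fin (n + 1)) K)) (l : Fin n → K) :
    Prop where
  isHomogeneous : J.IsHomogeneous (homogeneousSubmodule _ K)
  le : B ≤ J
  hyperplaneForm_mul_mem : ∀ f, hyperplaneForm l * f ∈ J → f ∈ J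
  degreePart_le : ∀ᶠ m in atTop, degreePart J m ≤ degreePart B m

lemma exists_isSaturationOf [Infinite K] {n : ℕ} {B : Ideal (MvPolynomial (Fin (n + 1)) K)}
    (hB : B.IsHomogeneous (homogeneousSubmodule _ K)) : ∃ J l, IsSaturationOf B J l := by
  obtain ⟨l, hl⟩ := exists_hyperplaneForm_mul_mem B
  exact ⟨_, l, isHomogeneous_saturation hB, le_saturation, hl,
    eventually_atTop.2 (exists_degreePart_saturation_le hB)⟩

namespace IsSaturationOf

lemma finrank_degreePart_add_le {n : ℕ} {B J : Ideal (MvPolynomial (Fin (n + 1)) K)}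
    {l : Fin n → K} (hJ : IsSaturationOf B J l) (m k : ℕ) :
    Module.finrank K (degreePart J (m + k)) + (n + 1).multichoose m ≤
      Module.finrank K (degreePart J m) + (n + 1).multichoose (m + k) := by
  induction k with
  | zero => rfl
  | succ k ih =>
    have hsection := finrank_degreePart_map_restrictHyperplane hJ.isHomogeneous
      hJ.hyperplaneForm_mul_mem (m + k)
    have hle := finrank_degreePart_le (J.map (restrictHyperplane l)) (m + k + 1)
    rw [Fintype.card_fin] at hle
    rw [← add_assoc, Nat.multichoose_succ_succ]
    lia

variable {B J : Ideal (MvPolynomial (Fin 3) K)} {l : Fin 2 → K} {q F f : MvPolynomial (Fin 3) K}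
  (hJ : IsSaturationOf B J l) (hB : IsSixPointIdeal B)

include hJ hB

lemma finrank_degreePart :
    ∀ᶠ m in atTop, Module.finrank K (degreePart J m) + 6 = Nat.multichoose 3 m := by
  filter_upwards [hJ.degreePart_le, hB.finrank_degreePart] with m hle hfinrank
  rwa [(degreePart_mono hJ.le m).antisymm hle] at hfinrank

lemma finrank_degreePart_map : ∀ᶠ m in atTop,
    Module.finrank K (degreePart (J.map (restrictHyperplane l)) m) = Nat.multichoose 2 m := by
  obtain ⟨N, hN⟩ := eventually_atTop.1 (hJ.finrank_degreePart hB)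
  refine eventually_atTop.2 ⟨N + 1, fun m hm => ?_⟩
  obtain ⟨m, rfl⟩ := Nat.exists_eq_add_of_le' (Nat.le_of_add_left_le hm)
  have := hN m (by lia)
  have := hN (m + 1) (by lia)
  have := finrank_degreePart_map_restrictHyperplane hJ.isHomogeneous hJ.hyperplaneForm_mul_mem m
  have := Nat.multichoose_succ_succ 2 m
  lia

lemma eq_zero_of_isHomogeneous_one {h : MvPolynomial (Fin 3) K} (hh : h.IsHomogeneous 1)
    (hhJ : h ∈ J) : h = 0 := by
  by_contra h0
  have hirr := irreducible_of_isHomogeneous_one hh h0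
  obtain ⟨F, hF, hFh⟩ := hB.exists_cubic hirr hh
  obtain ⟨N, hN⟩ := eventually_atTop.1 (hJ.finrank_degreePart hB)
  have complete_intersection := multichoose_add_le_finrank_degreePart hh hF.2 hhJ (hJ.le hF.1) h0
    (fun h => hFh (h ▸ dvd_zero _)) (hirr.isRelPrime_iff_not_dvd.2 hFh) N
  rw [Fintype.card_fin] at complete_intersection
  have hilbert := hN (1 + 3 + N) (by lia)
  have := two_mul_multichoose_three N
  have := two_mul_multichoose_three (3 + N)
  have := two_mul_multichoose_three (1 + N)
  have := two_mul_multichoose_three (1 + 3 + N)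
  linarith

lemma restrictHyperplane_ne_zero (hq : q ∈ degreePart J 2) (hq0 : q ≠ 0) :
    restrictHyperplane l q ≠ 0 := fun h => by
  obtain ⟨g, hg, rfl⟩ := exists_eq_hyperplaneForm_mul l hq.2 h
  have g_eq_zero := hJ.eq_zero_of_isHomogeneous_one hB hg (hJ.hyperplaneForm_mul_mem _ hq.1)
  exact hq0 (by rw [g_eq_zero, mul_zero])

lemma degreePart_le_span_pair (hq : q ∈ degreePart J 2) (hF : F ∈ degreePart B 3) (hq0 : q ≠ 0)
    (hF0 : F ≠ 0) (hcop : IsRelPrime q F) :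
    ∀ᶠ m in atTop, degreePart J m ≤ degreePart (Ideal.span {q, F}) m := by
  have span_le : Ideal.span {q, F} ≤ J :=
    Ideal.span_le.2 (Set.pair_subset hq.1 (hJ.le hF.1))
  obtain ⟨N, hN⟩ := eventually_atTop.1 (hJ.finrank_degreePart hB)
  refine eventually_atTop.2 ⟨N + 5, fun m hm => ?_⟩
  obtain ⟨m, rfl⟩ : ∃ k, m = 2 + 3 + k := ⟨m - 5, by lia⟩
  refine (Submodule.eq_of_le_of_finrank_le (degreePart_mono span_le _) ?_).ge
  have complete_intersection := multichoose_add_le_finrank_degreePart hq.2 hF.2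
    (Ideal.mem_span_pair.2 ⟨1, 0, by ring⟩ : q ∈ Ideal.span {q, F})
    (Ideal.mem_span_pair.2 ⟨0, 1, by ring⟩) hq0 hF0 hcop m
  rw [Fintype.card_fin] at complete_intersection
  have hilbert := hN (2 + 3 + m) (by lia)
  have := two_mul_multichoose_three m
  have := two_mul_multichoose_three (2 + m)
  have := two_mul_multichoose_three (3 + m)
  have := two_mul_multichoose_three (2 + 3 + m)
  linarith

lemma isRelPrime_restrictHyperplane (hq : q ∈ degreePart J 2) (hq0 : q ≠ 0)
    (hle : ∀ᶠ m in atTop, degreePart J m ≤ degreePart (Ideal.span {q, F}) m) :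
    IsRelPrime (restrictHyperplane l q) (restrictHyperplane l F) := by
  intro d hdq hdF
  have hlq := hJ.restrictHyperplane_ne_zero hB hq hq0
  have hd0 : d ≠ 0 := ne_zero_of_dvd_ne_zero hlq hdq
  obtain ⟨e, -, hd⟩ := exists_isHomogeneous_of_dvd (isHomogeneous_restrictHyperplane l hq.2) hlq hdq
  cases e with
  | zero => exact isUnit_of_isHomogeneous_zero hd hd0
  | succ e =>
    exfalso
    have map_le : (Ideal.span {q, F}).map (restrictHyperplane l) ≤ Ideal.span {d} :=
      Ideal.map_le_iff_le_comap.2 (Ideal.span_le.2 (Set.pair_subset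
        (Ideal.mem_span_singleton.2 hdq) (Ideal.mem_span_singleton.2 hdF)))
    obtain ⟨N, hN⟩ := eventually_atTop.1 (hle.and (hJ.finrank_degreePart_map hB))
    obtain ⟨hleN, hfinrank⟩ := hN (e + 1 + N) (by lia)
    have degreePart_le : degreePart (J.map (restrictHyperplane l)) (e + 1 + N) ≤
        degreePart ((Ideal.span {q, F}).map (restrictHyperplane l)) (e + 1 + N) := by
      rw [← map_degreePart_restrictHyperplane hJ.isHomogeneous]
      rintro _ ⟨f, hf, rfl⟩
      exact ⟨Ideal.mem_map_of_mem _ (hleN hf).1, isHomogeneous_restrictHyperplane l hf.2⟩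
    have growth := multichoose_add_finrank_degreePart_le (n := 1) (Fintype.card_fin 2) hd hd0
      map_le N
    have := Submodule.finrank_mono degreePart_le
    rw [Nat.multichoose_one] at growth
    lia

lemma exists_cubic_of_conic [Infinite K] (hq : q ∈ degreePart J 2) (hq0 : q ≠ 0) :
    ∃ F ∈ degreePart B 3, IsRelPrime q F ∧ ∀ f ∈ degreePart J 3,
      ∃ (a : MvPolynomial (Fin 3) K) (c : K), a.IsHomogeneous 1 ∧ f = q * a + C c * F := by
  obtain ⟨F, hF, hcop⟩ := hB.exists_cubic_isRelPrime hq.2 hq0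
  refine ⟨F, hF, hcop, fun f hf => ?_⟩
  have hF0 : F ≠ 0 := by
    rintro rfl
    exact not_isUnit_of_isHomogeneous hq.2 two_ne_zero (isRelPrime_zero_right.1 hcop)
  have degreePart_le := hJ.degreePart_le_span_pair hB hq hF hq0 hF0 hcop
  obtain ⟨N, hN⟩ := eventually_atTop.1 degreePart_le
  have f_mem : f ∈ Ideal.span {q, F} := mem_span_pair_of_hyperplaneForm_pow_mul_mem
    (hJ.isRelPrime_restrictHyperplane hB hq hq0 degreePart_le)
    (hJ.restrictHyperplane_ne_zero hB hq hq0)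
    (hN (1 * N + 3) (by lia)
      ⟨J.mul_mem_left _ hf.1, ((isHomogeneous_hyperplaneForm l).pow N).mul hf.2⟩).1
  obtain ⟨a, c, ha, hc, rfl⟩ := exists_isHomogeneous_of_mem_span_pair (c := 1) (d := 0)
    hq.2 hF.2 hf.2 rfl f_mem
  obtain ⟨c, rfl⟩ := exists_eq_C_of_isHomogeneous_zero hc
  exact ⟨a, c, ha, by rw [mul_comm F]⟩

lemma finrank_degreePart_three_le_of_conic [Infinite K] (hq : q ∈ degreePart J 2) (hq0 : q ≠ 0) :
    Module.finrank K (degreePart J 3) ≤ 4 := by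
  obtain ⟨F, -, -, eq_add⟩ := hJ.exists_cubic_of_conic hB hq hq0
  let φ : homogeneousSubmodule (Fin 3) K 1 × K →ₗ[K] MvPolynomial (Fin 3) K :=
    ((LinearMap.mulLeft K q).comp (Submodule.subtype _)).coprod (LinearMap.toSpanSingleton K _ F)
  have degreePart_le : degreePart J 3 ≤ φ.range := by
    intro f hf
    obtain ⟨a, c, ha, rfl⟩ := eq_add f hf
    refine ⟨⟨⟨a, ha⟩, c⟩, ?_⟩
    rw [← smul_eq_C_mul]
    rfl
  calc Module.finrank K (degreePart J 3)
      ≤ Module.finrank K φ.range := Submodule.finrank_mono degreePart_le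
    _ ≤ Module.finrank K (homogeneousSubmodule (Fin 3) K 1 × K) := LinearMap.finrank_range_le φ
    _ = 4 := by
      rw [Module.finrank_prod, Module.finrank_self, finrank_homogeneousSubmodule,
        Nat.multichoose_one_right, Fintype.card_fin]

lemma finrank_degreePart_le [Infinite K] {m : ℕ} (hm : 3 ≤ m) :
    Module.finrank K (degreePart J m) + 6 ≤ Nat.multichoose 3 m := by
  have := two_mul_multichoose_three 2
  have := two_mul_multichoose_three 3
  by_cases conic : ∃ q ∈ degreePart J 2, q ≠ 0
  · obtain ⟨q, hq, hq0⟩ := conic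
    have := hJ.finrank_degreePart_three_le_of_conic hB hq hq0
    have := hJ.finrank_degreePart_add_le 3 (m - 3)
    rw [Nat.add_sub_cancel' hm] at this
    lia
  · push Not at conic
    have finrank_eq_zero : Module.finrank K (degreePart J 2) = 0 := by
      rw [(Submodule.eq_bot_iff _).2 conic, finrank_bot]
    have := hJ.finrank_degreePart_add_le 2 (m - 2)
    rw [Nat.add_sub_cancel' (Nat.le_of_succ_le hm)] at this
    lia

end IsSaturationOf

end HyperplaneSection

section CurveIdeal

variable {K σ : Type*} [Field K]

lemma exists_eq_sum_C_mul_X {R : Type*} [CommRing R] [Fintype σ] {f : MvPolynomial σ R}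
    (hf : f.IsHomogeneous 1) : ∃ a : σ → R, f = ∑ i, C (a i) * X i := by
  obtain ⟨a, rfl⟩ : ∃ a : σ → R, ∑ i, a i • X i = f := by
    rw [← Submodule.mem_span_range_iff_exists_fun, ← homogeneousSubmodule_one_eq_span_X]
    exact hf
  exact ⟨a, by simp_rw [smul_eq_C_mul]⟩

lemma eq_zero_of_sum_C_mul_X_eq_zero {R : Type*} [CommRing R] [Fintype σ] {c : σ → R}
    (h : ∑ i, C (c i) * X i = (0 : MvPolynomial σ R)) : c = 0 := by
  classical
  ext i
  simpa [Pi.single_apply] using congrArg (eval (Pi.single i 1)) h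

lemma diag_eq_zero_of_sum_X_mul_eq_zero {R : Type*} [CommRing R] [Fintype σ] {a : σ → σ → R}
    (h : ∑ i, X i * ∑ j, C (a i j) * X j = (0 : MvPolynomial σ R)) (i : σ) : a i i = 0 := by
  classical
  simpa [Pi.single_apply] using congrArg (eval (Pi.single i 1)) h

lemma eq_zero_of_sum_X_mul_add_eq_zero [Fintype σ] {q F : MvPolynomial σ K}
    {L : σ → MvPolynomial σ K} {c : σ → K} {d : ℕ} (hq : q.IsHomogeneous d) (hd : 1 < d)
    (hq0 : q ≠ 0) (hcop : IsRelPrime q F) (h : ∑ i, X i * (q * L i + C (c i) * F) = 0) :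
    c = 0 ∧ ∑ i, X i * L i = 0 := by
  have split : q * ∑ i, X i * L i + (∑ i, C (c i) * X i) * F = 0 := by
    rw [← h, Finset.mul_sum, Finset.sum_mul, ← Finset.sum_add_distrib]
    exact Finset.sum_congr rfl fun i _ => by ring
  obtain ⟨w, hw⟩ : q ∣ ∑ i, C (c i) * X i :=
    hcop.dvd_of_dvd_mul_right ⟨-∑ i, X i * L i, by linear_combination split⟩
  have linear : (∑ i, C (c i) * X i : MvPolynomial σ K).IsHomogeneous 1 :=
    IsHomogeneous.sum _ _ _ fun i _ => isHomogeneous_C_mul_X _ _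
  have sum_eq_zero : ∑ i, C (c i) * X i = (0 : MvPolynomial σ K) :=
    hw.trans (eq_zero_of_mul_isHomogeneous hq (hw ▸ linear) hd)
  rw [sum_eq_zero, zero_mul, add_zero] at split
  exact ⟨eq_zero_of_sum_C_mul_X_eq_zero sum_eq_zero, (mul_eq_zero.1 split).resolve_left hq0⟩

namespace IsCubicSexticIdeal

variable {I : Ideal (MvPolynomial (Fin 4) K)} (hI : IsCubicSexticIdeal I)

include hI

lemma exists_mem_degreePart_eq_hyperplaneForm_mul {l₀ : Fin 3 → K} {m : ℕ}
    {f : MvPolynomial (Fin 4) K} (hf : f ∈ degreePart I (m + 1))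
    (h : restrictHyperplane l₀ f = 0) : ∃ g ∈ degreePart I m, f = hyperplaneForm l₀ * g := by
  obtain ⟨g, hg, rfl⟩ := exists_eq_hyperplaneForm_mul l₀ hf.2 h
  exact ⟨g, ⟨hI.hyperplaneForm_mul_mem l₀ g hf.1, hg⟩, rfl⟩

lemma restrictHyperplane_injOn (l₀ : Fin 3 → K) :
    Set.InjOn (restrictHyperplane l₀) (degreePart I 3) := by
  intro F hF G hG h
  obtain ⟨g, hg, eq_mul⟩ := hI.exists_mem_degreePart_eq_hyperplaneForm_mul (l₀ := l₀)
    (sub_mem hF hG) (by rw [map_sub, h, sub_self])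
  rwa [hI.eq_zero le_rfl hg.2 hg.1, mul_zero, sub_eq_zero] at eq_mul

lemma exists_syzygy {l₀ : Fin 3 → K} {F G : MvPolynomial (Fin 4) K} {i j : Fin 3}
    {q : MvPolynomial (Fin 3) K} (hF : F ∈ degreePart I 3) (hG : G ∈ degreePart I 3)
    (hFq : restrictHyperplane l₀ F = X i * q) (hGq : restrictHyperplane l₀ G = X j * q) :
    ∃ A ∈ degreePart I 3, X i.succ * G - X j.succ * F = hyperplaneForm l₀ * A := by
  refine hI.exists_mem_degreePart_eq_hyperplaneForm_mul
    (sub_mem ⟨I.mul_mem_left _ hG.1, (isHomogeneous_X K _).mul hG.2⟩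
      ⟨I.mul_mem_left _ hF.1, (isHomogeneous_X K _).mul hF.2⟩) ?_
  rw [map_sub, map_mul, map_mul, hFq, hGq, restrictHyperplane_X_succ, restrictHyperplane_X_succ]
  ring

lemma eq_zero_of_mul_eq_mul {p r F G : MvPolynomial (Fin 4) K} (hp : p.IsHomogeneous 1)
    (hp0 : p ≠ 0) (hpr : ¬ p ∣ r) (hF : F ∈ degreePart I 3) (h : p * G = r * F) : F = 0 := by
  have hpF : p ∣ F := ((irreducible_of_isHomogeneous_one hp hp0).prime.dvd_or_dvd
    ⟨G, h.symm⟩).resolve_left hpr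
  obtain ⟨Q, hQ, rfl⟩ := exists_isHomogeneous_eq_mul_of_dvd (n := 2) hp hF.2 hpF
  rcases hI.isPrime.mem_or_mem hF.1 with hpI | hQI
  · exact absurd (hI.eq_zero one_le_two hp hpI) hp0
  · rw [hI.eq_zero le_rfl hQ hQI, mul_zero]

variable {l₀ : Fin 3 → K} {J : Ideal (MvPolynomial (Fin 3) K)} {l : Fin 2 → K} [Infinite K]
  (hJ : IsSaturationOf (I.map (restrictHyperplane l₀)) J l)

include hJ

/-- The defect `finrank I_m + 6 * m - multichoose 4 m` equals `2` both for `m = 2` and for large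
`m`, and the bound on the saturation of the hyperplane section makes it antitone in between. -/
lemma finrank_degreePart_eq {m : ℕ} (hm : 2 ≤ m) :
    Module.finrank K (degreePart I m) + 6 * m = Nat.multichoose 4 m + 2 := by
  let defect (m : ℕ) : ℤ := Module.finrank K (degreePart I m) + 6 * m - Nat.multichoose 4 m
  have antitone : AntitoneOn defect (Set.Ici 2) := antitoneOn_nat_Ici_of_succ_le fun m hm => by
    have := hI.finrank_degreePart_succ l₀ m
    have := finrank_degreePart_mono hJ.le (m + 1)
    have := hJ.finrank_degreePart_le (hI.isSixPointIdeal l₀) (Nat.succ_le_succ hm)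
    have := Nat.multichoose_succ_succ 3 m
    simp only [defect]
    lia
  have defect_two : defect 2 = 2 := by
    have := six_mul_multichoose_four 2
    have : Module.finrank K (degreePart I 2) = 0 := by rw [hI.degreePart_two_eq_bot, finrank_bot]
    simp only [defect]
    lia
  obtain ⟨N, hN⟩ := eventually_atTop.1 hI.finrank_degreePart
  have defect_large : defect (m + N) = 2 := by
    have := hN (m + N) (Nat.le_add_left N m)
    simp only [defect]
    lia
  have le_two := antitone Set.self_mem_Ici hm hm
  have two_le := antitone hm (hm.trans (Nat.le_add_right m N)) (Nat.le_add_right m N)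
  simp only [defect_two, defect_large, defect] at le_two two_le
  lia

lemma degreePart_saturation_le {m : ℕ} (hm : 3 ≤ m) :
    degreePart J m ≤ degreePart (I.map (restrictHyperplane l₀)) m := by
  refine (Submodule.eq_of_le_of_finrank_le (degreePart_mono hJ.le m) ?_).ge
  obtain ⟨m, rfl⟩ := Nat.exists_eq_add_of_le' (Nat.le_of_add_left_le hm : 1 ≤ m)
  have := hI.finrank_degreePart_succ l₀ m
  have := hI.finrank_degreePart_eq hJ (m := m) (by lia)
  have := hI.finrank_degreePart_eq hJ (m := m + 1) (by lia)
  have := hJ.finrank_degreePart_le (hI.isSixPointIdeal l₀) hm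
  have := Nat.multichoose_succ_succ 3 m
  lia

lemma exists_restrictHyperplane_eq_X_mul {q : MvPolynomial (Fin 3) K} (hq : q ∈ degreePart J 2)
    (i : Fin 3) : ∃ G ∈ degreePart I 3, restrictHyperplane l₀ G = X i * q := by
  have X_mul_mem : X i * q ∈ degreePart J 3 :=
    ⟨J.mul_mem_left _ hq.1, (isHomogeneous_X K i).mul hq.2⟩
  exact (map_degreePart_restrictHyperplane hI.isHomogeneous 3).ge
    (hI.degreePart_saturation_le hJ le_rfl X_mul_mem)

/-- The cubics `X i * q` on the plane lift to cubics `G i` of `I`, and their Koszul syzygies to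
relations `X i * G j - X j * G i = ℓ * A` with `A` a cubic of `I`. The relation between the three
`A`s leaves no room for a second generator `F` in their restrictions, so that the `A`s are
combinations of the `G`s, and the relations become linear syzygies of the `G`s alone. -/
lemma exists_linear_syzygy {q : MvPolynomial (Fin 3) K} (hq : q ∈ degreePart J 2) (hq0 : q ≠ 0) :
    ∃ (G₁ G₂ : MvPolynomial (Fin 4) K) (a b : K), G₁ ∈ degreePart I 3 ∧ G₁ ≠ 0 ∧
      (X 2 - C b * hyperplaneForm l₀) * G₂ = (X 3 + C a * hyperplaneForm l₀) * G₁ := by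
  obtain ⟨F, -, hcop, exists_eq_add⟩ := hJ.exists_cubic_of_conic (hI.isSixPointIdeal l₀) hq hq0
  choose G G_mem hG using hI.exists_restrictHyperplane_eq_X_mul hJ hq
  choose A A_mem hA using fun i : Fin 3 =>
    hI.exists_syzygy (G_mem (i + 1)) (G_mem (i + 2)) (hG (i + 1)) (hG (i + 2))
  have restrict_A (i : Fin 3) : ∃ (a : Fin 3 → K) (c : K),
      restrictHyperplane l₀ (A i) = q * ∑ j, C (a j) * X j + C c * F := by
    obtain ⟨L, c, hL, h⟩ := exists_eq_add _ ⟨hJ.le (Ideal.mem_map_of_mem _ (A_mem i).1),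
      isHomogeneous_restrictHyperplane l₀ (A_mem i).2⟩
    obtain ⟨a, rfl⟩ := exists_eq_sum_C_mul_X hL
    exact ⟨a, c, h⟩
  choose a c restrict_A using restrict_A
  have sum_A : ∑ i : Fin 3, X i.succ * A i = 0 := by
    have hA₀ : X (Fin.succ 1) * G 2 - X (Fin.succ 2) * G 1 = hyperplaneForm l₀ * A 0 := hA 0
    have hA₁ : X (Fin.succ 2) * G 0 - X (Fin.succ 0) * G 2 = hyperplaneForm l₀ * A 1 := hA 1
    have hA₂ : X (Fin.succ 0) * G 1 - X (Fin.succ 1) * G 0 = hyperplaneForm l₀ * A 2 := hA 2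
    refine mul_left_cancel₀ (hyperplaneForm_ne_zero l₀) ?_
    rw [Fin.sum_univ_three]
    linear_combination -X (Fin.succ 0) * hA₀ - X (Fin.succ 1) * hA₁ - X (Fin.succ 2) * hA₂
  obtain ⟨rfl, sum_eq_zero⟩ := eq_zero_of_sum_X_mul_add_eq_zero hq.2 one_lt_two hq0 hcop (by
    simpa only [map_sum, map_mul, restrictHyperplane_X_succ, restrict_A, map_zero] using
      congrArg (restrictHyperplane l₀) sum_A)
  have A_eq : A 0 = C (a 0 1) * G 1 + C (a 0 2) * G 2 := by
    refine hI.restrictHyperplane_injOn l₀ (A_mem 0) (add_mem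
      ⟨I.mul_mem_left _ (G_mem 1).1, (G_mem 1).2.C_mul _⟩
      ⟨I.mul_mem_left _ (G_mem 2).1, (G_mem 2).2.C_mul _⟩) ?_
    rw [restrict_A, Fin.sum_univ_three, diag_eq_zero_of_sum_X_mul_eq_zero sum_eq_zero 0, map_add,
      map_mul, map_mul, hG, hG, restrictHyperplane_C, restrictHyperplane_C, Pi.zero_apply, map_zero]
    ring
  have G_ne_zero : G 1 ≠ 0 := fun h => mul_ne_zero (X_ne_zero 1) hq0 (by rw [← hG, h, map_zero])
  refine ⟨G 1, G 2, a 0 1, a 0 2, G_mem 1, G_ne_zero, ?_⟩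
  have syzygy : X 2 * G 2 - X 3 * G 1 = hyperplaneForm l₀ * A 0 := hA 0
  linear_combination syzygy + hyperplaneForm l₀ * A_eq

lemma eq_zero_of_mem_degreePart_saturation {q : MvPolynomial (Fin 3) K}
    (hq : q ∈ degreePart J 2) : q = 0 := by
  by_contra hq0
  obtain ⟨G₁, G₂, a, b, hG₁, hG₁0, syzygy⟩ := hI.exists_linear_syzygy hJ hq hq0
  let p : MvPolynomial (Fin 4) K := X 2 - C b * hyperplaneForm l₀
  let r : MvPolynomial (Fin 4) K := X 3 + C a * hyperplaneForm l₀
  have restrict_p : restrictHyperplane l₀ p = X 1 := by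
    rw [map_sub, map_mul, restrictHyperplane_hyperplaneForm, mul_zero, sub_zero]
    exact restrictHyperplane_X_succ l₀ 1
  have restrict_r : restrictHyperplane l₀ r = X 2 := by
    rw [map_add, map_mul, restrictHyperplane_hyperplaneForm, mul_zero, add_zero]
    exact restrictHyperplane_X_succ l₀ 2
  have hp : p.IsHomogeneous 1 :=
    (isHomogeneous_X _ _).sub ((isHomogeneous_hyperplaneForm l₀).C_mul _)
  have hp0 : p ≠ 0 := fun h => X_ne_zero (R := K) (1 : Fin 3) (by rw [← restrict_p, h, map_zero])
  have not_dvd : ¬ p ∣ r := fun h => by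
    have := map_dvd (restrictHyperplane l₀) h
    rw [restrict_p, restrict_r, X_dvd_X] at this
    exact absurd this (by decide)
  exact hG₁0 (hI.eq_zero_of_mul_eq_mul hp hp0 not_dvd hG₁ syzygy)

lemma degreePart_le (m : ℕ) : degreePart J m ≤ degreePart (I.map (restrictHyperplane l₀)) m := by
  rcases le_or_gt 3 m with hm | hm
  · exact hI.degreePart_saturation_le hJ hm
  intro f hf
  obtain ⟨k, hk⟩ : ∃ k, k + m = 2 := ⟨2 - m, by lia⟩
  have pow_mul_mem : hyperplaneForm l ^ k * f ∈ degreePart J 2 := by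
    have := ((isHomogeneous_hyperplaneForm l).pow k).mul hf.2
    rw [one_mul, hk] at this
    exact ⟨J.mul_mem_left _ hf.1, this⟩
  rw [(mul_eq_zero.1 (hI.eq_zero_of_mem_degreePart_saturation hJ pow_mul_mem)).resolve_left
    (pow_ne_zero _ (hyperplaneForm_ne_zero l))]
  exact zero_mem _

end IsCubicSexticIdeal

end CurveIdeal

section Minors

variable {R : Type*} [CommRing R] {n : ℕ}

/-- The maximal minors of an `n × (n + 1)` matrix, with the signs that make the vector of minors
orthogonal to the rows. -/
def maxMinor (M : Matrix (Fin n) (Fin (n + 1)) R) (j : Fin (n + 1)) : R :=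
  (-1) ^ (j : ℕ) * (M.submatrix id j.succAbove).det

lemma det_vecCons (M : Matrix (Fin n) (Fin (n + 1)) R) (w : Fin (n + 1) → R) :
    Matrix.det (Matrix.of (Matrix.vecCons w M)) = ∑ j, w j * maxMinor M j := by
  rw [Matrix.det_succ_row_zero]
  refine Finset.sum_congr rfl fun j _ => ?_
  rw [maxMinor, ← mul_assoc, mul_comm (w j)]
  rfl

lemma sum_mul_maxMinor (M : Matrix (Fin n) (Fin (n + 1)) R) (i : Fin n) :
    ∑ j, M i j * maxMinor M j = 0 := by
  rw [← det_vecCons]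
  exact Matrix.det_zero_of_row_eq (Fin.succ_ne_zero i).symm rfl

lemma maxMinor_mul_eq {M : Matrix (Fin n) (Fin (n + 1)) R} {d : Fin (n + 1) → R}
    (hd : ∀ i, ∑ j, M i j * d j = 0) (j k : Fin (n + 1)) :
    maxMinor M j * d k = maxMinor M k * d j := by
  let A : Matrix (Fin (n + 1)) (Fin (n + 1)) R := Matrix.of (Matrix.vecCons (Pi.single j 1) M)
  have det_A : A.det = maxMinor M j := by
    simp only [A, det_vecCons, Pi.single_apply, ite_mul, one_mul, zero_mul, Finset.sum_ite_eq',
      Finset.mem_univ, if_true]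
  have adjugate_A : A.adjugate k 0 = maxMinor M k := by
    simp only [Matrix.adjugate_fin_succ_eq_det_submatrix, maxMinor, Fin.val_zero, zero_add]
    rfl
  have mulVec_A : A.mulVec d = Pi.single 0 (d j) := by
    ext i
    refine Fin.cases ?_ (fun i => ?_) i
    · rw [Pi.single_eq_same]
      exact single_one_dotProduct j d
    · rw [Pi.single_eq_of_ne (Fin.succ_ne_zero i)]
      exact hd i
  have cramer := congrFun (congrArg A.adjugate.mulVec mulVec_A) k
  rwa [Matrix.mulVec_mulVec, Matrix.adjugate_mul, Matrix.smul_mulVec, Matrix.one_mulVec,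
    Pi.smul_apply, smul_eq_mul, det_A, Matrix.mulVec_single, Pi.smul_apply, Matrix.col_apply,
    MulOpposite.smul_eq_mul_unop, MulOpposite.unop_op, adjugate_A] at cramer

lemma map_maxMinor {S : Type*} [CommRing S] (f : R →+* S) (M : Matrix (Fin n) (Fin (n + 1)) R)
    (j : Fin (n + 1)) : f (maxMinor M j) = maxMinor (M.map f) j := by
  rw [maxMinor, maxMinor, map_mul, map_pow, map_neg, map_one, RingHom.map_det]
  rfl

lemma exists_maxMinor_eq_mul [IsDomain R] [DecompositionMonoid R]
    {M : Matrix (Fin n) (Fin (n + 1)) R} {d : Fin (n + 1) → R}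
    (hd : ∀ i, ∑ j, M i j * d j = 0) {j k : Fin (n + 1)} (hj : d j ≠ 0)
    (hjk : IsRelPrime (d j) (d k)) : ∃ c, ∀ i, maxMinor M i = c * d i := by
  obtain ⟨c, hc⟩ : d j ∣ maxMinor M j := hjk.dvd_of_dvd_mul_right
    ⟨maxMinor M k, by rw [maxMinor_mul_eq hd, mul_comm]⟩
  refine ⟨c, fun i => mul_right_cancel₀ hj ?_⟩
  rw [← maxMinor_mul_eq hd j i, hc]
  ring

lemma isHomogeneous_det {σ ι : Type*} [Fintype ι] [DecidableEq ι]
    {M : Matrix ι ι (MvPolynomial σ R)} (hM : ∀ i j, (M i j).IsHomogeneous 1) :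
    M.det.IsHomogeneous (Fintype.card ι) := by
  rw [Matrix.det_apply]
  refine IsHomogeneous.sum _ _ _ fun τ _ => ?_
  have prod_isHomogeneous := IsHomogeneous.prod Finset.univ (fun i => M (τ i) i) (fun _ => 1)
    fun i _ => hM (τ i) i
  rw [Finset.sum_const, smul_eq_mul, mul_one, Finset.card_univ] at prod_isHomogeneous
  rcases Int.units_eq_one_or (Equiv.Perm.sign τ) with hτ | hτ
  · rwa [hτ, one_smul]
  · rw [hτ, Units.neg_smul, one_smul]
    exact prod_isHomogeneous.neg

lemma isHomogeneous_maxMinor {σ : Type*} {M : Matrix (Fin n) (Fin (n + 1)) (MvPolynomial σ R)}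
    (hM : ∀ i j, (M i j).IsHomogeneous 1) (j : Fin (n + 1)) : (maxMinor M j).IsHomogeneous n := by
  have det_isHomogeneous := isHomogeneous_det (M := M.submatrix id j.succAbove) fun _ _ => hM _ _
  rw [Fintype.card_fin] at det_isHomogeneous
  rw [maxMinor]
  rcases neg_one_pow_eq_or (MvPolynomial σ R) (j : ℕ) with h | h <;> rw [h]
  · rwa [one_mul]
  · rw [neg_one_mul]
    exact det_isHomogeneous.neg

/-- The matrix of the relations `x * m_i = y * m_(i + 1)` between the monomials
`m_j = x ^ (n - j) * y ^ j` of degree `n`. -/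
def monomialSyzygies (n : ℕ) (x y : R) : Matrix (Fin n) (Fin (n + 1)) R := fun i k =>
  (if k = i.castSucc then y else 0) - if k = i.succ then x else 0

lemma sum_monomialSyzygies_mul (x y : R) (v : Fin (n + 1) → R) (i : Fin n) :
    ∑ k, monomialSyzygies n x y i k * v k = y * v i.castSucc - x * v i.succ := by
  simp only [monomialSyzygies, sub_mul, ite_mul, zero_mul, Finset.sum_sub_distrib,
    Finset.sum_ite_eq', Finset.mem_univ, if_true]

lemma map_monomialSyzygies {S : Type*} [CommRing S] (f : R →+* S) (x y : R) :
    (monomialSyzygies n x y).map f = monomialSyzygies n (f x) (f y) := by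
  ext i k
  simp only [Matrix.map_apply, monomialSyzygies, map_sub, apply_ite f, map_zero]

lemma isHomogeneous_monomialSyzygies {σ : Type*} {x y : MvPolynomial σ R} {d : ℕ}
    (hx : x.IsHomogeneous d) (hy : y.IsHomogeneous d) (i : Fin n) (k : Fin (n + 1)) :
    (monomialSyzygies n x y i k).IsHomogeneous d := by
  refine IsHomogeneous.sub ?_ ?_ <;> split_ifs
  exacts [hy, isHomogeneous_zero _ _ _, hx, isHomogeneous_zero _ _ _]

lemma maxMinor_monomialSyzygies_last (x y : R) :
    maxMinor (monomialSyzygies n x y) (Fin.last n) = (-1) ^ n * y ^ n := by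
  let A := (monomialSyzygies n x y).submatrix id (Fin.last n).succAbove
  have upperTriangular : A.IsUpperTriangular := fun i k (hki : k < i) => by
    simp only [A, Matrix.submatrix_apply, id_eq, monomialSyzygies, Fin.succAbove_last, Fin.ext_iff,
      Fin.val_castSucc, Fin.val_succ]
    rw [if_neg (by lia), if_neg (by lia), sub_zero]
  have diagonal (i : Fin n) : A i i = y := by
    simp only [A, Matrix.submatrix_apply, id_eq, monomialSyzygies, Fin.succAbove_last, if_true,
      if_neg i.castSucc_lt_succ.ne, sub_zero]
  have det_A : A.det = y ^ n := by
    simp only [Matrix.det_of_isUpperTriangular upperTriangular, diagonal, Finset.prod_const,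
      Finset.card_univ, Fintype.card_fin]
  rw [maxMinor, det_A, Fin.val_last]

end Minors

section BinaryForms

variable {R : Type*} [CommRing R]

lemma exists_eq_sum_of_isHomogeneous {f : MvPolynomial (Fin 2) R} {m : ℕ}
    (hf : f.IsHomogeneous m) : ∃ c : Fin (m + 1) → R,
      f = ∑ j : Fin (m + 1), C (c j) * (X 0 ^ (m - (j : ℕ)) * X 1 ^ (j : ℕ)) := by
  suffices f ∈ Submodule.span R (Set.range fun j : Fin (m + 1) =>
      (X 0 ^ (m - (j : ℕ)) * X 1 ^ (j : ℕ) : MvPolynomial (Fin 2) R)) by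
    obtain ⟨c, rfl⟩ := (Submodule.mem_span_range_iff_exists_fun R).1 this
    exact ⟨c, by simp_rw [smul_eq_C_mul]⟩
  rw [f.as_sum]
  refine sum_mem fun d hd => ?_
  have degree_d : d.degree = m := (hf.degree_eq_sum_deg_support hd).symm
  rw [Finsupp.degree_eq_sum, Fin.sum_univ_two] at degree_d
  rw [monomial_eq, Finsupp.prod_fintype _ _ fun i => pow_zero _, Fin.prod_univ_two, ← smul_eq_C_mul,
    ← Nat.sub_eq_of_eq_add degree_d.symm]
  exact Submodule.smul_mem _ _ (Submodule.subset_span ⟨⟨d 1, by lia⟩, rfl⟩)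

lemma isHomogeneous_X_pow_mul_X_pow {m j : ℕ} (hj : j ≤ m) :
    (X 0 ^ (m - j) * X 1 ^ j : MvPolynomial (Fin 2) R).IsHomogeneous m := by
  have := (isHomogeneous_X_pow (R := R) (0 : Fin 2) (m - j)).mul (isHomogeneous_X_pow 1 j)
  rwa [Nat.sub_add_cancel hj] at this

lemma eq_of_X_pow_mul_X_pow_eq [Nontrivial R] {a b a' b' : ℕ} {c : R}
    (h : (X 0 ^ a * X 1 ^ b : MvPolynomial (Fin 2) R) = C c * (X 0 ^ a' * X 1 ^ b')) : b = b' := by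
  have monomial_eq : monomial (Finsupp.single (0 : Fin 2) a + Finsupp.single 1 b) (1 : R) =
      monomial (Finsupp.single 0 a' + Finsupp.single 1 b') c := by
    simpa [X_pow_eq_monomial, monomial_mul, C_mul_monomial] using h
  rcases (monomial_eq_monomial_iff _ _ _ _).1 monomial_eq with ⟨h, -⟩ | ⟨h, -⟩
  · simpa using DFunLike.congr_fun h 1
  · exact absurd h one_ne_zero

end BinaryForms

section HilbertBurch

lemma span_range_mul_eq_of_isUnit {R ι : Type*} [CommRing R] {c : R} (hc : IsUnit c) (G : ι → R) :
    Ideal.span (Set.range fun j => c * G j) = Ideal.span (Set.range G) :=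
  (congrArg Ideal.span (Set.smul_set_range c G).symm).trans
    (Submodule.span_smul_eq_of_isUnit _ c hc)

section CodimTwo

variable {R : Type*} [CommRing R] {n : ℕ} (l₀ : Fin (n + 1) → R) (l : Fin n → R)

/-- Restriction of polynomials to the linear subspace of codimension two cut out by
`hyperplaneForm l₀` and the pullback `rename Fin.succ (hyperplaneForm l)`. -/
def restrictCodimTwo : MvPolynomial (Fin (n + 2)) R →ₐ[R] MvPolynomial (Fin n) R :=
  (restrictHyperplane l).comp (restrictHyperplane l₀)

lemma restrictCodimTwo_apply (f : MvPolynomial (Fin (n + 2)) R) :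
    restrictCodimTwo l₀ l f = restrictHyperplane l (restrictHyperplane l₀ f) := rfl

lemma restrictCodimTwo_X_succ_succ (i : Fin n) : restrictCodimTwo l₀ l (X i.succ.succ) = X i := by
  rw [restrictCodimTwo_apply, restrictHyperplane_X_succ, restrictHyperplane_X_succ]

lemma restrictCodimTwo_C (a : R) : restrictCodimTwo l₀ l (C a) = C a :=
  (restrictCodimTwo l₀ l).commutes a

lemma restrictCodimTwo_hyperplaneForm : restrictCodimTwo l₀ l (hyperplaneForm l₀) = 0 := by
  rw [restrictCodimTwo_apply, restrictHyperplane_hyperplaneForm, map_zero]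

lemma restrictCodimTwo_rename_hyperplaneForm :
    restrictCodimTwo l₀ l (rename Fin.succ (hyperplaneForm l)) = 0 := by
  rw [restrictCodimTwo_apply, restrictHyperplane_rename_succ, restrictHyperplane_hyperplaneForm]

lemma isHomogeneous_restrictCodimTwo {f : MvPolynomial (Fin (n + 2)) R} {m : ℕ}
    (hf : f.IsHomogeneous m) : (restrictCodimTwo l₀ l f).IsHomogeneous m :=
  isHomogeneous_restrictHyperplane l (isHomogeneous_restrictHyperplane l₀ hf)

lemma map_degreePart_restrictCodimTwo {I : Ideal (MvPolynomial (Fin (n + 2)) R)}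
    (hI : I.IsHomogeneous (homogeneousSubmodule _ R)) (m : ℕ) :
    (degreePart I m).map (restrictCodimTwo l₀ l).toLinearMap =
      degreePart (I.map (restrictCodimTwo l₀ l)) m := by
  rw [restrictCodimTwo, AlgHom.comp_toLinearMap, Submodule.map_comp,
    map_degreePart_restrictHyperplane hI,
    map_degreePart_restrictHyperplane (isHomogeneous_map_restrictHyperplane hI)]
  exact congrArg (degreePart · m) (Ideal.map_mapₐ (restrictHyperplane l₀) (restrictHyperplane l))

end CodimTwo

/-- The ideal `I` is generated by the maximal minors of the matrix `M` of linear forms, which are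
nonzero and pairwise coprime. -/
structure IsDeterminantal {R σ : Type*} [CommRing R] {n : ℕ} (I : Ideal (MvPolynomial σ R))
    (M : Matrix (Fin n) (Fin (n + 1)) (MvPolynomial σ R)) : Prop where
  isHomogeneous : ∀ i j, (M i j).IsHomogeneous 1
  span_eq : Ideal.span (Set.range (maxMinor M)) = I
  ne_zero : ∀ j, maxMinor M j ≠ 0
  isRelPrime : ∀ j k, j ≠ k → IsRelPrime (maxMinor M j) (maxMinor M k)

variable {K : Type*} [Field K] {I : Ideal (MvPolynomial (Fin 4) K)} {l₀ : Fin 3 → K}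
  {J : Ideal (MvPolynomial (Fin 3) K)} {l : Fin 2 → K}

/-- Cubics of `I` restricting to the four monomials of degree three in two variables. -/
structure IsMonomialLift (I : Ideal (MvPolynomial (Fin 4) K)) (l₀ : Fin 3 → K) (l : Fin 2 → K)
    (G : Fin 4 → MvPolynomial (Fin 4) K) : Prop where
  mem : ∀ j, G j ∈ degreePart I 3
  restrict_eq : ∀ j, restrictCodimTwo l₀ l (G j) = X 0 ^ (3 - (j : ℕ)) * X 1 ^ (j : ℕ)

namespace IsCubicSexticIdeal

variable (hI : IsCubicSexticIdeal I)

include hI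

lemma isRelPrime {F G : MvPolynomial (Fin 4) K} (hF : F ∈ degreePart I 3) (hF0 : F ≠ 0)
    (hG : G ∈ degreePart I 3) (not_proportional : ∀ c : K, G ≠ C c * F) : IsRelPrime F G := by
  rintro d ⟨a, rfl⟩ hdG
  obtain ⟨hd0, ha0⟩ := mul_ne_zero_iff.1 hF0
  obtain ⟨m, k, hmk, hd, ha⟩ := exists_isHomogeneous_of_mul_isHomogeneous hF.2 hF0
  rcases Nat.eq_zero_or_pos m with rfl | hm
  · exact isUnit_of_isHomogeneous_zero hd hd0
  exfalso
  rcases Nat.eq_zero_or_pos k with rfl | hk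
  · have unit_a : IsUnit a := isUnit_of_isHomogeneous_zero ha ha0
    obtain ⟨b, hb, rfl⟩ := exists_isHomogeneous_eq_mul_of_dvd (n := 0) (hF.2)
      (by exact hG.2) ((unit_a.mul_right_dvd).2 hdG)
    obtain ⟨c, rfl⟩ := exists_eq_C_of_isHomogeneous_zero hb
    exact not_proportional c (mul_comm _ _)
  · rcases hI.isPrime.mem_or_mem hF.1 with hdI | haI
    · exact hd0 (hI.eq_zero (by lia) hd hdI)
    · exact ha0 (hI.eq_zero (by lia) ha haI)

variable [Infinite K] (hJ : IsSaturationOf (I.map (restrictHyperplane l₀)) J l)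

include hJ

lemma exists_of_restrictCodimTwo_eq_zero {m : ℕ} {f : MvPolynomial (Fin 4) K}
    (hf : f ∈ degreePart I (m + 1)) (h : restrictCodimTwo l₀ l f = 0) :
    ∃ g ∈ degreePart I m, ∃ g' ∈ degreePart I m,
      f = rename Fin.succ (hyperplaneForm l) * g + hyperplaneForm l₀ * g' := by
  obtain ⟨q, hq, hfq⟩ :=
    exists_eq_hyperplaneForm_mul l (isHomogeneous_restrictHyperplane l₀ hf.2) h
  have q_mem : q ∈ degreePart J m :=
    ⟨hJ.hyperplaneForm_mul_mem q (hfq ▸ hJ.le (Ideal.mem_map_of_mem _ hf.1)), hq⟩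
  obtain ⟨g, hg, rfl : restrictHyperplane l₀ g = q⟩ :=
    (map_degreePart_restrictHyperplane hI.isHomogeneous m).ge (hI.degreePart_le hJ m q_mem)
  have mul_mem : rename Fin.succ (hyperplaneForm l) * g ∈ degreePart I (m + 1) :=
    ⟨I.mul_mem_left _ hg.1,
      add_comm 1 m ▸ (isHomogeneous_hyperplaneForm l).rename_isHomogeneous.mul hg.2⟩
  obtain ⟨g', hg', hfg'⟩ := hI.exists_mem_degreePart_eq_hyperplaneForm_mul (sub_mem hf mul_mem)
    (by rw [map_sub, map_mul, restrictHyperplane_rename_succ, hfq, sub_self])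
  exact ⟨g, hg, g', hg', eq_add_of_sub_eq' hfg'⟩

lemma eq_zero_of_restrictCodimTwo_eq_zero {f : MvPolynomial (Fin 4) K} (hf : f ∈ degreePart I 3)
    (h : restrictCodimTwo l₀ l f = 0) : f = 0 := by
  obtain ⟨g, hg, g', hg', rfl⟩ := hI.exists_of_restrictCodimTwo_eq_zero hJ hf h
  rw [hI.eq_zero le_rfl hg.2 hg.1, hI.eq_zero le_rfl hg'.2 hg'.1, mul_zero, mul_zero, add_zero]

/-- Both spaces have dimension four. -/
lemma map_degreePart_three_restrictCodimTwo :
    (degreePart I 3).map (restrictCodimTwo l₀ l).toLinearMap =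
      homogeneousSubmodule (Fin 2) K 3 := by
  refine Submodule.eq_of_le_of_finrank_le ?_ ?_
  · rintro _ ⟨f, hf, rfl⟩
    exact isHomogeneous_restrictCodimTwo l₀ l hf.2
  · have injective : Function.Injective
        ((restrictCodimTwo l₀ l).toLinearMap.domRestrict (degreePart I 3)) :=
      (injective_iff_map_eq_zero _).2 fun f hf =>
        Subtype.ext (hI.eq_zero_of_restrictCodimTwo_eq_zero hJ f.2 hf)
    have := hI.finrank_degreePart_eq hJ (m := 3) (by lia)
    have := six_mul_multichoose_four 3
    rw [finrank_homogeneousSubmodule, Fintype.card_fin, Nat.multichoose_two,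
      ← LinearMap.range_domRestrict, LinearMap.finrank_range_of_inj injective]
    lia

lemma exists_isMonomialLift : ∃ G, IsMonomialLift I l₀ l G := by
  choose G hG restrict_eq using fun j : Fin 4 => (hI.map_degreePart_three_restrictCodimTwo hJ).ge
    (isHomogeneous_X_pow_mul_X_pow (Nat.le_of_lt_succ j.isLt))
  exact ⟨G, hG, restrict_eq⟩

end IsCubicSexticIdeal

lemma restrictCodimTwo_X_two : restrictCodimTwo l₀ l (X 2) = X 0 :=
  restrictCodimTwo_X_succ_succ l₀ l 0

lemma restrictCodimTwo_X_three : restrictCodimTwo l₀ l (X 3) = X 1 :=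
  restrictCodimTwo_X_succ_succ l₀ l 1

namespace IsMonomialLift

variable {G : Fin 4 → MvPolynomial (Fin 4) K} (hG : IsMonomialLift I l₀ l G)

include hG

lemma ne_zero (j : Fin 4) : G j ≠ 0 := fun h => by
  have restrict_eq := hG.restrict_eq j
  rw [h, map_zero] at restrict_eq
  exact mul_ne_zero (pow_ne_zero _ (X_ne_zero _)) (pow_ne_zero _ (X_ne_zero _)) restrict_eq.symm

lemma isRelPrime (hI : IsCubicSexticIdeal I) {j k : Fin 4} (hjk : j ≠ k) :
    IsRelPrime (G j) (G k) := by
  refine hI.isRelPrime (hG.mem j) (hG.ne_zero j) (hG.mem k) fun c h => hjk (Fin.ext ?_)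
  have restrict_eq := congrArg (restrictCodimTwo l₀ l) h
  rw [map_mul, restrictCodimTwo_C, hG.restrict_eq, hG.restrict_eq] at restrict_eq
  exact (eq_of_X_pow_mul_X_pow_eq restrict_eq).symm

lemma X_pow_mul_X_pow_mem_map_span (a b : ℕ) (hab : 3 ≤ a + b) :
    X 0 ^ a * X 1 ^ b ∈ (Ideal.span (Set.range G)).map (restrictCodimTwo l₀ l) := by
  obtain ⟨j, hja, hjb⟩ : ∃ j : Fin 4, 3 - (j : ℕ) ≤ a ∧ (j : ℕ) ≤ b :=
    ⟨⟨min b 3, by lia⟩, by simp only; lia, min_le_left b 3⟩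
  have dvd : restrictCodimTwo l₀ l (G j) ∣ X 0 ^ a * X 1 ^ b := by
    rw [hG.restrict_eq]
    exact mul_dvd_mul (pow_dvd_pow _ hja) (pow_dvd_pow _ hjb)
  exact Ideal.mem_of_dvd _ dvd
    (Ideal.mem_map_of_mem _ (Ideal.subset_span (Set.mem_range_self j)))

lemma mem_map_span {f : MvPolynomial (Fin 2) K} {m : ℕ} (hm : 3 ≤ m) (hf : f.IsHomogeneous m) :
    f ∈ (Ideal.span (Set.range G)).map (restrictCodimTwo l₀ l) := by
  obtain ⟨c, rfl⟩ := exists_eq_sum_of_isHomogeneous hf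
  exact sum_mem fun j _ =>
    Ideal.mul_mem_left _ _ (hG.X_pow_mul_X_pow_mem_map_span _ _ (by lia))

variable (hI : IsCubicSexticIdeal I)

include hI

lemma exists_maxMinor_eq_C_mul {M : Matrix (Fin 3) (Fin 4) (MvPolynomial (Fin 4) K)}
    (hM : ∀ i j, (M i j).IsHomogeneous 1) (hMG : ∀ i, ∑ k, M i k * G k = 0)
    (restrict_M : M.map (restrictCodimTwo l₀ l) = monomialSyzygies 3 (X 0) (X 1)) :
    ∃ c : K, c ≠ 0 ∧ ∀ j, maxMinor M j = C c * G j := by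
  obtain ⟨w, hw⟩ := exists_maxMinor_eq_mul hMG (hG.ne_zero 0)
    (hG.isRelPrime hI (j := 0) (k := 1) (by decide))
  obtain ⟨c, rfl⟩ : ∃ c, w = C c := by
    obtain ⟨q, hq, hwq⟩ := exists_isHomogeneous_eq_mul_of_dvd (n := 0) (hG.mem 0).2
      (isHomogeneous_maxMinor hM 0) (Dvd.intro_left w (hw 0).symm)
    obtain ⟨c, rfl⟩ := exists_eq_C_of_isHomogeneous_zero hq
    exact ⟨c, mul_right_cancel₀ (hG.ne_zero 0) (by rw [← hw, hwq, mul_comm])⟩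
  refine ⟨c, ?_, hw⟩
  rintro rfl
  have restrict_eq_zero := congrArg (restrictCodimTwo l₀ l).toRingHom (hw (Fin.last 3))
  rw [map_zero, zero_mul, map_zero, map_maxMinor] at restrict_eq_zero
  have restrict_eq := (congrArg (maxMinor · (Fin.last 3)) restrict_M).symm.trans restrict_eq_zero
  rw [maxMinor_monomialSyzygies_last] at restrict_eq
  exact mul_ne_zero (pow_ne_zero _ (neg_ne_zero.2 one_ne_zero))
    (pow_ne_zero _ (X_ne_zero _)) restrict_eq

variable [Infinite K] (hJ : IsSaturationOf (I.map (restrictHyperplane l₀)) J l)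

include hJ

lemma exists_eq_sum {g : MvPolynomial (Fin 4) K} (hg : g ∈ degreePart I 3) :
    ∃ c : Fin 4 → K, g = ∑ k, C (c k) * G k := by
  obtain ⟨c, hc⟩ := exists_eq_sum_of_isHomogeneous (isHomogeneous_restrictCodimTwo l₀ l hg.2)
  refine ⟨c, sub_eq_zero.1 (hI.eq_zero_of_restrictCodimTwo_eq_zero hJ (sub_mem hg
    (sum_mem fun k _ => ⟨I.mul_mem_left _ (hG.mem k).1, (hG.mem k).2.C_mul _⟩)) ?_)⟩
  simp only [map_sub, map_sum, map_mul, restrictCodimTwo_C, hG.restrict_eq, hc, sub_self]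

/-- A form of `I` agrees with an element of the span on the subspace of codimension two, and the
difference is a combination of forms of `I` of smaller degree. -/
lemma span_range_eq : Ideal.span (Set.range G) = I := by
  have span_le : Ideal.span (Set.range G) ≤ I :=
    Ideal.span_le.2 (Set.range_subset_iff.2 fun j => (hG.mem j).1)
  have span_isHomogeneous :
      (Ideal.span (Set.range G)).IsHomogeneous (homogeneousSubmodule _ K) :=
    Ideal.homogeneous_span _ _ (Set.forall_mem_range.2 fun j => ⟨3, (hG.mem j).2⟩)
  refine span_le.antisymm (le_of_degreePart_le hI.isHomogeneous fun n f hf => ?_)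
  induction n generalizing f with
  | zero => rw [hI.eq_zero zero_le_two hf.2 hf.1]; exact zero_mem _
  | succ n ih =>
    rcases le_or_gt (n + 1) 2 with hn | hn
    · rw [hI.eq_zero hn hf.2 hf.1]
      exact zero_mem _
    have restrict_f_isHomogeneous := isHomogeneous_restrictCodimTwo l₀ l hf.2
    obtain ⟨g, hg, hgf : restrictCodimTwo l₀ l g = restrictCodimTwo l₀ l f⟩ :=
      (map_degreePart_restrictCodimTwo l₀ l span_isHomogeneous (n + 1)).ge
        ⟨hG.mem_map_span hn restrict_f_isHomogeneous, restrict_f_isHomogeneous⟩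
    obtain ⟨a, ha, b, hb, hfg⟩ := hI.exists_of_restrictCodimTwo_eq_zero hJ
      (sub_mem hf (degreePart_mono span_le _ hg)) (by rw [map_sub, hgf, sub_self])
    rw [sub_eq_iff_eq_add.1 hfg]
    exact ⟨add_mem (add_mem (Ideal.mul_mem_left _ _ (ih _ ha).1)
      (Ideal.mul_mem_left _ _ (ih _ hb).1)) hg.1, sub_eq_iff_eq_add.1 hfg ▸ hf.2⟩

lemma exists_syzygy (i : Fin 3) : ∃ a b : Fin 4 → K,
    X 3 * G i.castSucc - X 2 * G i.succ =
      rename Fin.succ (hyperplaneForm l) * ∑ k, C (a k) * G k +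
        hyperplaneForm l₀ * ∑ k, C (b k) * G k := by
  have X_mul_mem (j k : Fin 4) : X j * G k ∈ degreePart I 4 :=
    ⟨I.mul_mem_left _ (hG.mem k).1, (isHomogeneous_X K j).mul (hG.mem k).2⟩
  have restrict_eq_zero : restrictCodimTwo l₀ l (X 3 * G i.castSucc - X 2 * G i.succ) = 0 := by
    rw [map_sub, map_mul, map_mul, hG.restrict_eq, hG.restrict_eq, restrictCodimTwo_X_two,
      restrictCodimTwo_X_three, Fin.val_castSucc, Fin.val_succ,
      show 3 - (i : ℕ) = 3 - (i + 1) + 1 by lia]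
    ring
  obtain ⟨g, hg, g', hg', hgg'⟩ := hI.exists_of_restrictCodimTwo_eq_zero hJ
    (sub_mem (X_mul_mem 3 i.castSucc) (X_mul_mem 2 i.succ)) restrict_eq_zero
  obtain ⟨a, rfl⟩ := hG.exists_eq_sum hI hJ hg
  obtain ⟨b, rfl⟩ := hG.exists_eq_sum hI hJ hg'
  exact ⟨a, b, hgg'⟩

lemma exists_matrix : ∃ M : Matrix (Fin 3) (Fin 4) (MvPolynomial (Fin 4) K),
    (∀ i j, (M i j).IsHomogeneous 1) ∧ (∀ i, ∑ k, M i k * G k = 0) ∧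
      M.map (restrictCodimTwo l₀ l) = monomialSyzygies 3 (X 0) (X 1) := by
  choose a b syzygy using hG.exists_syzygy hI hJ
  refine ⟨monomialSyzygies 3 (X 2) (X 3) - Matrix.of fun i k =>
    C (a i k) * rename Fin.succ (hyperplaneForm l) + C (b i k) * hyperplaneForm l₀,
    fun i k => ?_, fun i => ?_, ?_⟩
  · exact (isHomogeneous_monomialSyzygies (isHomogeneous_X K 2) (isHomogeneous_X K 3) i k).sub
      (((isHomogeneous_hyperplaneForm l).rename_isHomogeneous.C_mul _).add
        ((isHomogeneous_hyperplaneForm l₀).C_mul _))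
  · simp only [Matrix.sub_apply, Matrix.of_apply, sub_mul, Finset.sum_sub_distrib,
      sum_monomialSyzygies_mul, syzygy, Finset.mul_sum, add_mul, Finset.sum_add_distrib, mul_assoc,
      mul_left_comm (C _), sub_self]
  · have map_X : (monomialSyzygies 3 (X 2) (X 3)).map (restrictCodimTwo l₀ l) =
        monomialSyzygies 3 (restrictCodimTwo l₀ l (X 2)) (restrictCodimTwo l₀ l (X 3)) :=
      map_monomialSyzygies (restrictCodimTwo l₀ l).toRingHom _ _
    rw [restrictCodimTwo_X_two, restrictCodimTwo_X_three] at map_X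
    rw [← map_X]
    ext1 i k
    simp only [Matrix.map_apply, Matrix.sub_apply, Matrix.of_apply, map_sub, map_add, map_mul,
      restrictCodimTwo_hyperplaneForm, restrictCodimTwo_rename_hyperplaneForm, mul_zero, add_zero,
      sub_zero]

end IsMonomialLift

theorem IsCubicSexticIdeal.exists_isDeterminantal [Infinite K] (hI : IsCubicSexticIdeal I) :
    ∃ M : Matrix (Fin 3) (Fin 4) (MvPolynomial (Fin 4) K), IsDeterminantal I M := by
  obtain ⟨J, l, hJ⟩ := exists_isSaturationOf (hI.isSixPointIdeal 0).isHomogeneous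
  obtain ⟨G, hG⟩ := hI.exists_isMonomialLift hJ
  obtain ⟨M, hM, hMG, restrict_M⟩ := hG.exists_matrix hI hJ
  obtain ⟨c, hc, maxMinor_eq⟩ := hG.exists_maxMinor_eq_C_mul hI hM hMG restrict_M
  have unit_c : IsUnit (C c : MvPolynomial (Fin 4) K) := (IsUnit.mk0 c hc).map C
  refine ⟨M, hM, ?_, fun j => ?_, fun j k hjk => ?_⟩
  · rw [← hG.span_range_eq hI hJ, funext maxMinor_eq]
    exact span_range_mul_eq_of_isUnit unit_c G
  · rw [maxMinor_eq]
    exact mul_ne_zero unit_c.ne_zero (hG.ne_zero j)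
  · rw [maxMinor_eq, maxMinor_eq]
    exact (isRelPrime_mul_unit_left unit_c).2 (hG.isRelPrime hI hjk)

end HilbertBurch

section Kernel

variable {S E : Type*} [CommRing S] [CommRing E]

lemma eval₂_mul_of_isHomogeneous {σ : Type*} {F : MvPolynomial σ S} {n : ℕ}
    (hF : F.IsHomogeneous n) (f : S →+* E) (c : E) (η : σ → E) :
    F.eval₂ f (fun j => c * η j) = c ^ n * F.eval₂ f η := by
  rw [eval₂_eq, eval₂_eq, Finset.mul_sum]
  refine Finset.sum_congr rfl fun d hd => ?_
  simp only [mul_pow, Finset.prod_mul_distrib, Finset.prod_pow_eq_pow_sum]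
  rw [← hF.degree_eq_sum_deg_support hd, mul_left_comm]

lemma exists_eq_C_mul_X_pow_add {B : MvPolynomial (Fin 2) S} {n : ℕ}
    (hB : B.IsHomogeneous (n + 1)) : ∃ (c : S) (A : MvPolynomial (Fin 2) S),
      A.IsHomogeneous n ∧ B = C c * X 1 ^ (n + 1) + X 0 * A := by
  obtain ⟨c, rfl⟩ := exists_eq_sum_of_isHomogeneous hB
  refine ⟨c (Fin.last _), ∑ j : Fin (n + 1), C (c j.castSucc) * (X 0 ^ (n - j) * X 1 ^ (j : ℕ)),
    IsHomogeneous.sum _ _ _ fun j _ =>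
      (isHomogeneous_X_pow_mul_X_pow (Nat.le_of_lt_succ j.isLt)).C_mul _, ?_⟩
  rw [Fin.sum_univ_castSucc, add_comm, Fin.val_last, Nat.sub_self, pow_zero, one_mul,
    Finset.mul_sum]
  refine congrArg _ (Finset.sum_congr rfl fun j _ => ?_)
  rw [Fin.val_castSucc, Nat.sub_add_comm (Nat.le_of_lt_succ j.isLt)]
  ring

/-- If `a` divides the coefficient of `X 1 ^ (n + 1)` in `B`, then modulo the linear form one can
replace that term by a multiple of `X 0`, and induct on the cofactor. -/
lemma dvd_of_eval_eq_zero [IsDomain S] [DecompositionMonoid S] {a b : S} (ha : a ≠ 0)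
    (hab : IsRelPrime a b) {B : MvPolynomial (Fin 2) S} {n : ℕ} (hB : B.IsHomogeneous n)
    (h0 : eval ![a, b] B = 0) : C b * X 0 - C a * X 1 ∣ B := by
  induction n generalizing B with
  | zero =>
    obtain ⟨c, rfl⟩ := exists_eq_C_of_isHomogeneous_zero hB
    rw [eval_C] at h0
    rw [h0, map_zero]
    exact dvd_zero _
  | succ n ih =>
    obtain ⟨c, A, hA, rfl⟩ := exists_eq_C_mul_X_pow_add hB
    simp only [map_add, map_mul, map_pow, eval_C, eval_X, Matrix.cons_val_zero,
      Matrix.cons_val_one, Matrix.cons_val_fin_one] at h0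
    obtain ⟨c, rfl⟩ : a ∣ c := (hab.pow_right (n := n + 1)).dvd_of_dvd_mul_right
      ⟨-eval ![a, b] A, by linear_combination h0⟩
    have dvd_cofactor := ih (B := C (c * b) * X 1 ^ n + A)
      (((isHomogeneous_X_pow _ _).C_mul _).add hA) (by
        refine (mul_eq_zero.1 ?_).resolve_left ha
        simp only [map_add, map_mul, map_pow, eval_C, eval_X, Matrix.cons_val_one,
          Matrix.cons_val_fin_one]
        linear_combination h0)
    have decomposition : C (a * c) * X 1 ^ (n + 1) + X 0 * A =
        X 0 * (C (c * b) * X 1 ^ n + A) - (C b * X 0 - C a * X 1) * (C c * X 1 ^ n) := by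
      rw [map_mul, map_mul]
      ring
    rw [decomposition]
    exact dvd_sub (dvd_cofactor.mul_left _) (dvd_mul_right _ _)

/-- Substituting `δ • X = α * X u + β * X v` turns `F` into a binary form with the zero
`(d u, d v)`; it is a multiple of the linear form of this point, which vanishes at
`(η u, η v)`. -/
lemma pow_mul_eval₂_eq_zero [IsDomain S] [DecompositionMonoid S] {σ : Type*} {d α β : σ → S}
    {δ : S} {u v : σ} (hu : d u ≠ 0) (huv : IsRelPrime (d u) (d v))
    (hd : ∀ j, δ * d j = α j * d u + β j * d v) {F : MvPolynomial σ S} {n : ℕ}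
    (hF : F.IsHomogeneous n) (h0 : eval d F = 0) {f : S →+* E} {η : σ → E}
    (hη : ∀ j, f δ * η j = f (α j) * η u + f (β j) * η v)
    (hηd : f (d v) * η u = f (d u) * η v) : f δ ^ n * F.eval₂ f η = 0 := by
  let B : MvPolynomial (Fin 2) S := bind₁ (fun j => C (α j) * X 0 + C (β j) * X 1) F
  have B_isHomogeneous : B.IsHomogeneous n := one_mul n ▸ hF.aeval _ fun j =>
    (isHomogeneous_C_mul_X _ _).add (isHomogeneous_C_mul_X _ _)
  have eval₂_B : B.eval₂ f ![η u, η v] = f δ ^ n * F.eval₂ f η := by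
    rw [← eval₂_mul_of_isHomogeneous hF, ← coe_eval₂Hom, eval₂Hom_bind₁]
    simp [hη]
  have eval_B : eval ![d u, d v] B = 0 := by
    have eval_eq : eval ![d u, d v] B = δ ^ n * eval d F := by
      rw [← eval₂_id, ← eval₂_id, ← eval₂_mul_of_isHomogeneous hF, ← coe_eval₂Hom, eval₂Hom_bind₁]
      simp [hd]
    rw [eval_eq, h0, mul_zero]
  obtain ⟨A, hA⟩ := dvd_of_eval_eq_zero hu huv B_isHomogeneous eval_B
  rw [← eval₂_B, hA, eval₂_mul, eval₂_sub, eval₂_mul, eval₂_mul, eval₂_C, eval₂_C, eval₂_X,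
    eval₂_X]
  exact mul_eq_zero_of_left (sub_eq_zero.2 hηd) _

section TwoByTwo

variable {m n : Type*} (M : Matrix m n S) (r s : m) (p q : n)

/-- The `2 × 2` minor with rows `r, s` and columns `p, q`. -/
def minorTwo : S := M r p * M s q - M r q * M s p

lemma map_minorTwo (f : S →+* E) : f (minorTwo M r s p q) = minorTwo (M.map f) r s p q := by
  simp only [minorTwo, map_sub, map_mul, Matrix.map_apply]

lemma sum_minorTwo_mul_eq_zero {M : Matrix m n S} {r s : m} [Fintype n] {w : n → S}
    (hr : ∑ j, M r j * w j = 0) (hs : ∑ j, M s j * w j = 0) :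
    ∑ u, minorTwo M r s p u * w u = 0 := by
  simp only [minorTwo, sub_mul, mul_right_comm _ (M s p), mul_assoc (M r p),
    Finset.sum_sub_distrib, ← Finset.mul_sum, ← Finset.sum_mul, hr, hs, mul_zero, zero_mul,
    sub_zero]

variable [DecidableEq n]

/-- The coefficient of `w u` when Cramer's rule for the rows `r, s` is used to express
`minorTwo M r s p q * w j` by the coordinates `w u` of a kernel vector `w` with `u ≠ p, q`. -/
def kernelCoeff (j u : n) : S :=
  if j = p then minorTwo M r s q u else if j = q then minorTwo M r s u p else
    if j = u then minorTwo M r s p q else 0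

lemma map_kernelCoeff (f : S →+* E) (j u : n) :
    f (kernelCoeff M r s p q j u) = kernelCoeff (M.map f) r s p q j u := by
  simp only [kernelCoeff, apply_ite f, map_minorTwo, map_zero]

variable {M r s p q}

lemma minorTwo_mul_eq_sum_kernelCoeff_mul [Fintype n] {w : n → S} (hr : ∑ j, M r j * w j = 0)
    (hs : ∑ j, M s j * w j = 0) (hpq : p ≠ q) (j : n) :
    minorTwo M r s p q * w j = ∑ u ∈ {p, q}ᶜ, kernelCoeff M r s p q j u * w u := by
  have relation (k : n) : minorTwo M r s k p * w p + minorTwo M r s k q * w q +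
      ∑ u ∈ {p, q}ᶜ, minorTwo M r s k u * w u = 0 := by
    rw [← Finset.sum_pair hpq (f := fun u => minorTwo M r s k u * w u),
      Finset.sum_add_sum_compl, sum_minorTwo_mul_eq_zero k hr hs]
  by_cases hjp : j = p
  · simp only [kernelCoeff, hjp, if_true]
    have := relation q
    simp only [minorTwo] at this ⊢
    linear_combination -this
  by_cases hjq : j = q
  · simp only [kernelCoeff, hjq, if_neg hpq.symm, if_true]
    have antisymm (u : n) : minorTwo M r s u p = -minorTwo M r s p u := by
      simp only [minorTwo]
      ring
    simp only [antisymm, neg_mul, Finset.sum_neg_distrib]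
    have := relation p
    simp only [minorTwo] at this ⊢
    linear_combination this
  · simp only [kernelCoeff, if_neg hjp, if_neg hjq, ite_mul, zero_mul]
    rw [Finset.sum_ite_eq, if_pos (by simp [hjp, hjq])]

end TwoByTwo

lemma minorTwo_pow_mul_eval₂_eq_zero [IsDomain S] [DecompositionMonoid S]
    {M : Matrix (Fin 3) (Fin 4) S} (hne : ∀ j, maxMinor M j ≠ 0)
    (hcop : ∀ j k, j ≠ k → IsRelPrime (maxMinor M j) (maxMinor M k))
    {F : MvPolynomial (Fin 4) S} {n : ℕ} (hF : F.IsHomogeneous n)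
    (h0 : eval (maxMinor M) F = 0) {f : S →+* E} {η : Fin 4 → E}
    (hη : ∀ i, ∑ j, f (M i j) * η j = 0) (r s : Fin 3) {p q : Fin 4} (hpq : p ≠ q) :
    f (minorTwo M r s p q) ^ n * F.eval₂ f η = 0 := by
  obtain ⟨u, v, huv, compl_eq⟩ : ∃ u v, u ≠ v ∧ ({p, q}ᶜ : Finset (Fin 4)) = {u, v} :=
    Finset.card_eq_two.1 (by rw [Finset.card_compl, Finset.card_pair hpq, Fintype.card_fin])
  refine pow_mul_eval₂_eq_zero (hne u) (hcop u v huv) (α := (kernelCoeff M r s p q · u))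
    (β := (kernelCoeff M r s p q · v)) (fun j => ?_) hF h0 (fun j => ?_) ?_
  · rw [minorTwo_mul_eq_sum_kernelCoeff_mul (sum_mul_maxMinor M r) (sum_mul_maxMinor M s) hpq,
      compl_eq, Finset.sum_pair huv]
  · have := minorTwo_mul_eq_sum_kernelCoeff_mul (M := M.map f) (hη r) (hη s) hpq j
    rwa [compl_eq, Finset.sum_pair huv, ← map_minorTwo, ← map_kernelCoeff,
      ← map_kernelCoeff] at this
  · rw [map_maxMinor, map_maxMinor]
    exact maxMinor_mul_eq (M := M.map f) hη v u

end Kernel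

section Points

universe u

variable {σ : Type*} {A B B' : Type u} [CommRing A] [CommRing B] [CommRing B'] [SetLike σ A]
  [AddSubgroupClass σ A] (𝒜 : ℕ → σ) [GradedRing 𝒜]

/-- The value at homogeneous fractions of a ring homomorphism that inverts the denominator. -/
def awayLift (φ : A →+* B) {f : A} (hu : IsUnit (φ f)) : Away 𝒜 f →+* B :=
  (IsLocalization.Away.lift (S := Localization.Away f) f hu).comp
    (algebraMap (Away 𝒜 f) (Localization.Away f))

variable {𝒜} {f g : A} {m m' : ℕ} (hf : f ∈ 𝒜 m) (hm : 0 < m) (hg : g ∈ 𝒜 m') (hm' : 0 < m')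

lemma awayLift_mk_mul (φ : A →+* B) (hu : IsUnit (φ f)) (n : ℕ) (a : A) (ha : a ∈ 𝒜 (n • m)) :
    awayLift 𝒜 φ hu (Away.mk 𝒜 hf n a ha) * φ f ^ n = φ a := by
  have clear_denominator : algebraMap A (Localization.Away f) a =
      algebraMap (Away 𝒜 f) (Localization.Away f) (Away.mk 𝒜 hf n a ha) *
        algebraMap A (Localization.Away f) f ^ n := by
    rw [HomogeneousLocalization.algebraMap_apply, Away.val_mk, Localization.mk_eq_mk', ← map_pow]
    exact (IsLocalization.mk'_spec _ _ (⟨f ^ n, _⟩ : Submonoid.powers f)).symm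
  rw [awayLift, RingHom.comp_apply, ← IsLocalization.Away.lift_eq (S := Localization.Away f) f hu a,
    clear_denominator, map_mul, map_pow, IsLocalization.Away.lift_eq]

include hf in
lemma awayLift_eq {φ : A →+* B} (hu : IsUnit (φ f)) {ψ : Away 𝒜 f →+* B}
    (h : ∀ n a ha, ψ (Away.mk 𝒜 hf n a ha) * φ f ^ n = φ a) : awayLift 𝒜 φ hu = ψ := by
  ext x
  obtain ⟨n, a, ha, rfl⟩ := Away.mk_surjective 𝒜 hf x
  exact (hu.pow n).mul_right_cancel ((awayLift_mk_mul hf φ hu n a ha).trans (h n a ha).symm)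

/-- The `B`-valued point of `Proj 𝒜` with homogeneous coordinates given by `φ`, at least one of
which, `φ f`, is invertible. -/
def point (φ : A →+* B) (hu : IsUnit (φ f)) : Spec (.of B) ⟶ Proj 𝒜 :=
  Spec.map (CommRingCat.ofHom (awayLift 𝒜 φ hu)) ≫ Proj.awayι 𝒜 f hf hm

include hg in
lemma point_eq_point_of_eq_mul {φ : A →+* B} (hu : IsUnit (φ f)) {x : A} {l : ℕ} (hx : x ∈ 𝒜 l)
    (hl : 0 < l) (hxu : IsUnit (φ x)) (hxfg : x = f * g) :
    point hf hm φ hu = point hx hl φ hxu := by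
  have x_mem : x ∈ 𝒜 (m + m') := hxfg ▸ SetLike.mul_mem_graded hf hg
  change _ = point x_mem (Nat.add_pos_left hm m') φ hxu
  rw [point, point, ← Proj.SpecMap_awayMap_awayι 𝒜 hf hm hg hxfg, ← Category.assoc, ← Spec.map_comp,
    ← CommRingCat.ofHom_comp]
  congr 3
  refine awayLift_eq hf hu fun n a ha => ?_
  have value := awayLift_mk_mul x_mem φ hxu n (a * g ^ n)
    (by rw [smul_add]; exact SetLike.mul_mem_graded ha (SetLike.pow_mem_graded n hg))
  rw [RingHom.comp_apply, awayMap_mk]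
  subst hxfg
  rw [map_mul, map_mul, mul_pow, map_pow, ← mul_assoc] at value
  exact ((isUnit_of_mul_isUnit_right (map_mul φ f g ▸ hxu)).pow n).mul_right_cancel value

lemma point_eq_point {φ : A →+* B} (hu : IsUnit (φ f)) (hu' : IsUnit (φ g)) :
    point hf hm φ hu = point hg hm' φ hu' := by
  have hfg := SetLike.mul_mem_graded hf hg
  have fg_isUnit : IsUnit (φ (f * g)) := map_mul φ f g ▸ hu.mul hu'
  rw [point_eq_point_of_eq_mul hf hm hg hu hfg (Nat.add_pos_left hm m') fg_isUnit rfl,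
    point_eq_point_of_eq_mul hg hm' hf hu' hfg (Nat.add_pos_left hm m') fg_isUnit (mul_comm f g)]

lemma point_eq_point_of_forall_eq_pow_mul {φ φ' : A →+* B} (hu : IsUnit (φ f))
    (hu' : IsUnit (φ' g)) {u : B} (unit_u : IsUnit u) (h : ∀ n, ∀ a ∈ 𝒜 n, φ' a = u ^ n * φ a) :
    point hf hm φ hu = point hg hm' φ' hu' := by
  have f_isUnit : IsUnit (φ' f) := h m f hf ▸ (unit_u.pow m).mul hu
  rw [point_eq_point hg hm' hf hm hu' f_isUnit, point, point]
  congr 3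
  refine awayLift_eq hf hu fun n a ha => ?_
  have value := awayLift_mk_mul hf φ' f_isUnit n a ha
  rw [h m f hf, h _ a ha, mul_pow, ← pow_mul, mul_left_comm, smul_eq_mul, mul_comm n] at value
  exact (unit_u.pow (m * n)).mul_left_cancel value

lemma SpecMap_point (ψ : B →+* B') (φ : A →+* B) (hu : IsUnit (φ f)) :
    Spec.map (CommRingCat.ofHom ψ) ≫ point hf hm φ hu = point hf hm (ψ.comp φ) (hu.map ψ) := by
  rw [point, point, ← Category.assoc, ← Spec.map_comp, ← CommRingCat.ofHom_comp]
  congr 3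
  refine (awayLift_eq hf (φ := ψ.comp φ) (hu.map ψ) fun n a ha => ?_).symm
  rw [RingHom.comp_apply, RingHom.comp_apply, RingHom.comp_apply, ← map_pow, ← map_mul,
    awayLift_mk_mul hf φ hu n a ha]

lemma basicOpen_eq_top_iff {R : Type*} [CommRing R] {b : R} :
    PrimeSpectrum.basicOpen b = ⊤ ↔ IsUnit b := by
  have := PrimeSpectrum.iSup_basicOpen_eq_top_iff (f := fun _ : Unit => b)
  rwa [iSup_const, Set.range_const, Ideal.span_singleton_eq_top] at this

include hg hm' in
lemma point_preimage_basicOpen (φ : A →+* B) (hu : IsUnit (φ f)) :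
    point hf hm φ hu ⁻¹ᵁ Proj.basicOpen 𝒜 g = PrimeSpectrum.basicOpen (φ g) := by
  rw [point, Scheme.Hom.comp_preimage, Proj.awayι_preimage_basicOpen 𝒜 hf hm hg hm']
  change PrimeSpectrum.basicOpen (awayLift 𝒜 φ hu _) = _
  have value := awayLift_mk_mul hf φ hu m' (g ^ m)
    (by rw [smul_eq_mul, mul_comm]; exact SetLike.pow_mem_graded m hg)
  rw [map_pow] at value
  rw [← PrimeSpectrum.basicOpen_pow (φ g) m hm, ← value, PrimeSpectrum.basicOpen_mul,
    basicOpen_eq_top_iff.2 (hu.pow m'), inf_top_eq]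

lemma isUnit_of_point_eq {φ φ' : A →+* B} {hf : f ∈ 𝒜 m} {hm : 0 < m} {hg : g ∈ 𝒜 m'}
    {hm' : 0 < m'} {hu : IsUnit (φ f)} {hu' : IsUnit (φ' g)}
    (h : point hf hm φ hu = point hg hm' φ' hu') : IsUnit (φ' f) := by
  rw [← basicOpen_eq_top_iff, ← point_preimage_basicOpen hg hm' hf hm φ' hu', ← h,
    point_preimage_basicOpen hf hm hf hm φ hu, basicOpen_eq_top_iff]
  exact hu

lemma mul_pow_eq_of_point_eq {φ φ' : A →+* B} {hf : f ∈ 𝒜 m} {hm : 0 < m} {hg : g ∈ 𝒜 m'}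
    {hm' : 0 < m'} {hu : IsUnit (φ f)} {hu' : IsUnit (φ' g)}
    (h : point hf hm φ hu = point hg hm' φ' hu') (n : ℕ) {a : A} (ha : a ∈ 𝒜 (n • m)) :
    φ a * φ' f ^ n = φ' a * φ f ^ n := by
  have f_isUnit := isUnit_of_point_eq h
  rw [point_eq_point hg hm' hf hm hu' f_isUnit, point, point, cancel_mono] at h
  have lifts_eq : awayLift 𝒜 φ hu = awayLift 𝒜 φ' f_isUnit :=
    congrArg CommRingCat.Hom.hom (Spec.map_injective h)
  rw [← awayLift_mk_mul hf φ hu n a ha, ← awayLift_mk_mul hf φ' f_isUnit n a ha, lifts_eq,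
    mul_right_comm]

section Dehomogenize

variable (hf : f ∈ 𝒜 1)

/-- Dehomogenization: setting a form of degree one equal to `1`. -/
def dehomogenize : A →+* Away 𝒜 f :=
  (DirectSum.toSemiring (A := fun n => 𝒜 n)
    (fun n => AddMonoidHom.mk' (fun a => Away.mk 𝒜 hf n a.1 (by simp)) fun a b => by
      apply val_injective
      simp [Localization.add_mk_self])
    (by apply val_injective; simp)
    (fun {i j} a b => by
      apply val_injective
      simp only [AddMonoidHom.mk'_apply, Away.val_mk, val_mul, Localization.mk_mul]
      congr 1
      exact Subtype.ext (pow_add f i j))).comp (DirectSum.decomposeRingEquiv 𝒜).toRingHom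

lemma dehomogenize_of_mem {n : ℕ} {a : A} (ha : a ∈ 𝒜 n) :
    dehomogenize hf a = Away.mk 𝒜 hf n a (by simpa using ha) := by
  rw [dehomogenize, RingHom.comp_apply]
  change DirectSum.toSemiring _ _ _ (DirectSum.decompose 𝒜 a) = _
  rw [DirectSum.decompose_of_mem 𝒜 ha, DirectSum.toSemiring_of]
  rfl

lemma dehomogenize_self : dehomogenize hf f = 1 := by
  rw [dehomogenize_of_mem hf hf]
  apply val_injective
  simp

lemma isUnit_dehomogenize_self : IsUnit (dehomogenize hf f) :=
  dehomogenize_self hf ▸ isUnit_one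

lemma awayι_eq_point :
    Proj.awayι 𝒜 f hf one_pos =
      point hf one_pos (dehomogenize hf) (isUnit_dehomogenize_self hf) := by
  rw [point, awayLift_eq hf (ψ := RingHom.id _) (isUnit_dehomogenize_self hf) fun n a ha => ?_,
    CommRingCat.ofHom_id, Spec.map_id, Category.id_comp]
  rw [dehomogenize_self, one_pow, mul_one, dehomogenize_of_mem hf (by simpa using ha)]
  rfl

lemma exists_eq_point (x : Spec (.of B) ⟶ Proj 𝒜) (hx : x ⁻¹ᵁ Proj.basicOpen 𝒜 f = ⊤) :
    ∃ (φ : A →+* B) (hφ : φ f = 1), x = point hf one_pos φ (hφ ▸ isUnit_one) := by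
  have range_subset : Set.range x ⊆ Set.range (Proj.awayι 𝒜 f hf one_pos) := by
    rw [← Scheme.Hom.coe_opensRange (Proj.awayι 𝒜 f hf one_pos), Proj.opensRange_awayι]
    rintro _ ⟨y, rfl⟩
    have : y ∈ x ⁻¹ᵁ Proj.basicOpen 𝒜 f := hx ▸ trivial
    exact this
  obtain ⟨ψ, hψ⟩ := Spec.map_surjective
    (IsOpenImmersion.lift (Proj.awayι 𝒜 f hf one_pos) x range_subset)
  refine ⟨ψ.hom.comp (dehomogenize hf), by rw [RingHom.comp_apply, dehomogenize_self, map_one], ?_⟩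
  rw [← SpecMap_point hf one_pos ψ.hom (dehomogenize hf) (isUnit_dehomogenize_self hf),
    ← awayι_eq_point, CommRingCat.ofHom_hom, hψ, IsOpenImmersion.lift_fac]

end Dehomogenize

end Points

lemma point_structureMap {k A B : Type} [CommRing k] [CommRing A] [CommRing B] [Algebra k A]
    {𝒜 : ℕ → Submodule k A} [GradedAlgebra 𝒜] {f : A} {m : ℕ} (hf : f ∈ 𝒜 m) (hm : 0 < m)
    (φ : A →+* B) (hu : IsUnit (φ f)) :
    point hf hm φ hu ≫ structureMap 𝒜 =
      Spec.map (CommRingCat.ofHom (φ.comp (algebraMap k A))) := by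
  rw [point, structureMap, Category.assoc, Proj.awayι_toSpecZero_assoc, ← Spec.map_comp,
    ← Spec.map_comp, ← CommRingCat.ofHom_comp, ← CommRingCat.ofHom_comp]
  congr 2
  ext r
  have value := awayLift_mk_mul hf φ hu 0 (algebraMap k A r)
    (by rw [zero_smul]; exact (algebraMap k (𝒜 0) r).2)
  rw [pow_zero, mul_one] at value
  rw [RingHom.comp_apply φ, ← value, RingHom.comp_apply, RingHom.comp_apply]
  congr 1
  apply val_injective
  rw [Away.val_mk]
  change Localization.mk _ _ = _
  congr 1
  exact Subtype.ext (pow_zero f).symm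

section SpecIdeal

universe u

variable {B B' : Type u} [CommRing B] [CommRing B']

/-- The ideal of `B` that corresponds to an ideal sheaf on `Spec B`. -/
def specIdeal (K : (Spec (.of B)).IdealSheafData) : Ideal B :=
  (K.ideal ⟨⊤, isAffineOpen_top _⟩).comap (Scheme.ΓSpecIso (.of B)).inv.hom

lemma specIdeal_mono {K K' : (Spec (.of B)).IdealSheafData} (h : K ≤ K') :
    specIdeal K ≤ specIdeal K' :=
  Ideal.comap_mono (h _)

lemma bijective_ΓSpecIso_inv : Function.Bijective (Scheme.ΓSpecIso (.of B)).inv.hom :=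
  ConcreteCategory.bijective_of_isIso (Scheme.ΓSpecIso (.of B)).inv

lemma le_of_specIdeal_le {K K' : (Spec (.of B)).IdealSheafData}
    (h : specIdeal K ≤ specIdeal K') : K ≤ K' := by
  refine Scheme.IdealSheafData.le_of_isAffine fun x hx => ?_
  obtain ⟨b, rfl⟩ := bijective_ΓSpecIso_inv.2 x
  exact h hx

lemma specIdeal_surjective :
    Function.Surjective (specIdeal : (Spec (.of B)).IdealSheafData → Ideal B) := by
  intro J
  refine ⟨.ofIdealTop (J.map (Scheme.ΓSpecIso (.of B)).inv.hom), ?_⟩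
  have ideal_top := Scheme.IdealSheafData.equivOfIsAffine.apply_symm_apply
    (J.map (Scheme.ΓSpecIso (.of B)).inv.hom)
  rw [Scheme.IdealSheafData.equivOfIsAffine_apply,
    Scheme.IdealSheafData.equivOfIsAffine_symm_apply] at ideal_top
  rw [specIdeal, ideal_top, Ideal.comap_map_of_bijective _ bijective_ΓSpecIso_inv]

lemma specIdeal_map (ψ : B →+* B') (K : (Spec (.of B')).IdealSheafData) :
    specIdeal (K.map (Spec.map (CommRingCat.ofHom ψ))) = (specIdeal K).comap ψ := by
  rw [specIdeal, Scheme.IdealSheafData.ideal_map_of_isAffineHom, specIdeal, Ideal.comap_comap,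
    Ideal.comap_comap]
  have naturality :=
    congrArg CommRingCat.Hom.hom (Scheme.ΓSpecIso_inv_naturality (CommRingCat.ofHom ψ))
  rw [CommRingCat.hom_comp, CommRingCat.hom_comp, CommRingCat.hom_ofHom] at naturality
  rw [naturality]
  rfl

/-- `Ideal.map` and `IdealSheafData.comap` are the left adjoints of the two functors that
`specIdeal_map` identifies. -/
lemma specIdeal_comap (ψ : B →+* B') (K : (Spec (.of B)).IdealSheafData) :
    specIdeal (K.comap (Spec.map (CommRingCat.ofHom ψ))) = (specIdeal K).map ψ := by
  refine le_antisymm ?_ ?_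
  · obtain ⟨L, hL⟩ := specIdeal_surjective ((specIdeal K).map ψ)
    rw [← hL]
    refine specIdeal_mono (Scheme.IdealSheafData.le_map_iff_comap_le.1 (le_of_specIdeal_le ?_))
    rw [specIdeal_map, hL]
    exact Ideal.le_comap_map
  · rw [Ideal.map_le_iff_le_comap, ← specIdeal_map]
    exact specIdeal_mono (Scheme.IdealSheafData.le_map_comap _ _)

/-- The ideal `J` is generated by one nonzerodivisor, as an invertible ideal sheaf is on
sufficiently small affine open subsets. -/
def IsGeneratedByNonZeroDivisor {R : Type*} [CommRing R] (J : Ideal R) : Prop :=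
  ∃ a ∈ nonZeroDivisors R, J = Ideal.span {a}

lemma isGeneratedByNonZeroDivisor_comap_equiv {R S : Type*} [CommRing R] [CommRing S]
    (e : R ≃+* S) (J : Ideal S) :
    IsGeneratedByNonZeroDivisor (J.comap (e : R →+* S)) ↔ IsGeneratedByNonZeroDivisor J := by
  have comap_span (r : R) : (Ideal.span {e r}).comap (e : R →+* S) = Ideal.span {r} := by
    have := Ideal.comap_map_of_bijective (e : R →+* S) e.bijective (I := Ideal.span {r})
    rwa [Ideal.map_span, Set.image_singleton] at this
  have mem_iff (r : R) : e r ∈ nonZeroDivisors S ↔ r ∈ nonZeroDivisors R := by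
    rw [mem_nonZeroDivisors_iff_right, mem_nonZeroDivisors_iff_right, e.surjective.forall]
    simp only [← map_mul, map_eq_zero_iff e e.injective]
  simp only [IsGeneratedByNonZeroDivisor, e.surjective.exists, mem_iff, ← comap_span,
    (Ideal.comap_injective_of_surjective (e : R →+* S) e.surjective).eq_iff]

lemma isGeneratedByNonZeroDivisor_specIdeal_comap_iff {T : Scheme.{u}} (K : T.IdealSheafData)
    (j : Spec (.of B) ⟶ T) [IsOpenImmersion j] {U : T.affineOpens} (h : j.opensRange = U.1) :
    IsGeneratedByNonZeroDivisor (specIdeal (K.comap j)) ↔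
      IsGeneratedByNonZeroDivisor (K.ideal U) := by
  obtain rfl : U = ⟨j ''ᵁ ⊤, (isAffineOpen_top _).image_of_isOpenImmersion j⟩ :=
    Subtype.ext (h.symm.trans (Scheme.Hom.image_top_eq_opensRange j).symm)
  let e : B ≃+* Γ(T, j ''ᵁ ⊤) :=
    ((Scheme.ΓSpecIso (.of B)).symm ≪≫ (j.appIso ⊤).symm).commRingCatIsoToRingEquiv
  rw [← isGeneratedByNonZeroDivisor_comap_equiv e, specIdeal,
    Scheme.IdealSheafData.ideal_comap_of_isOpenImmersion, Ideal.comap_comap]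
  rfl

lemma exists_SpecMap_algebraMap_away {R : Type u} [CommRing R] (W : (Spec (.of R)).Opens)
    {y : Spec (.of R)} (hy : y ∈ W) : ∃ b : R,
      y ∈ Set.range (Spec.map (CommRingCat.ofHom (algebraMap R (Localization.Away b)))) ∧
      Set.range (Spec.map (CommRingCat.ofHom (algebraMap R (Localization.Away b)))) ⊆ W := by
  obtain ⟨_, ⟨b, rfl⟩, hyb, hb⟩ :=
    PrimeSpectrum.isTopologicalBasis_basic_opens.exists_subset_of_mem_open hy W.2
  have range_eq : Set.range (Spec.map (CommRingCat.ofHom (algebraMap R (Localization.Away b)))) =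
      (PrimeSpectrum.basicOpen b).1 :=
    PrimeSpectrum.localization_away_comap_range (Localization.Away b) b
  exact ⟨b, range_eq ▸ hyb, range_eq ▸ hb⟩

end SpecIdeal

section InvertibleIdeal

variable {T T' : Scheme.{0}} {K : T.IdealSheafData}

/-- An affine chart of `T` at `x` on which the ideal sheaf `K` is generated by one
nonzerodivisor. -/
structure InvertibleChart (K : T.IdealSheafData) (x : T) where
  /-- The coordinate ring. -/
  ring : CommRingCat.{0}
  /-- The inclusion of the chart. -/
  ι : Spec (.of ring) ⟶ T
  [isOpenImmersion : IsOpenImmersion ι]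
  mem : x ∈ ι.opensRange
  isGeneratedByNonZeroDivisor : IsGeneratedByNonZeroDivisor (specIdeal (K.comap ι))

attribute [instance] InvertibleChart.isOpenImmersion

lemma IsInvertibleIdeal.exists_chart (hK : IsInvertibleIdeal K) {x : T} {W : T.Opens}
    (hx : x ∈ W) : ∃ c : InvertibleChart K x, c.ι.opensRange ≤ W := by
  obtain ⟨U, hxU, hU⟩ := hK x
  let j : Spec (.of Γ(T, U.1)) ⟶ T := U.2.fromSpec
  have : IsOpenImmersion j := IsAffineOpen.isOpenImmersion_fromSpec U.2
  obtain ⟨β, hβ, span_β⟩ := (isGeneratedByNonZeroDivisor_specIdeal_comap_iff K j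
    U.2.opensRange_fromSpec).2 hU
  obtain ⟨y, rfl⟩ : x ∈ j.opensRange := by rwa [U.2.opensRange_fromSpec]
  obtain ⟨b, ⟨z, hz⟩, hb⟩ := exists_SpecMap_algebraMap_away (j ⁻¹ᵁ W) (y := y) hx
  let l := Spec.map (CommRingCat.ofHom (algebraMap Γ(T, U.1) (Localization.Away b)))
  have : IsOpenImmersion l := inferInstance
  refine ⟨⟨.of (Localization.Away b), l ≫ j, ⟨z, ?_⟩, algebraMap _ _ β,
    IsLocalization.map_nonZeroDivisors_le (Submonoid.powers b) _ ⟨β, hβ, rfl⟩, ?_⟩, ?_⟩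
  · rw [Scheme.Hom.comp_apply, hz]
  · rw [Scheme.IdealSheafData.comap_comp, specIdeal_comap, span_β, Ideal.map_span,
      Set.image_singleton]
  · rintro _ ⟨z', rfl⟩
    exact hb ⟨z', rfl⟩

lemma isInvertibleIdeal_of_charts (c : ∀ x, InvertibleChart K x) : IsInvertibleIdeal K :=
  fun x => ⟨⟨(c x).ι.opensRange, isAffineOpen_opensRange (c x).ι⟩, (c x).mem,
    (isGeneratedByNonZeroDivisor_specIdeal_comap_iff K (c x).ι rfl).1
      (c x).isGeneratedByNonZeroDivisor⟩

lemma IsInvertibleIdeal.comap (hK : IsInvertibleIdeal K) (f : T' ⟶ T) [IsOpenImmersion f] :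
    IsInvertibleIdeal (K.comap f) := by
  refine isInvertibleIdeal_of_charts fun x => ?_
  choose c hc using hK.exists_chart (x := f x) (W := f.opensRange) ⟨x, rfl⟩
  have fac := IsOpenImmersion.lift_fac f c.ι hc
  have : IsOpenImmersion (IsOpenImmersion.lift f c.ι hc ≫ f) := by
    rw [fac]
    infer_instance
  exact
    { ring := c.ring
      ι := IsOpenImmersion.lift f c.ι hc
      isOpenImmersion := IsOpenImmersion.of_comp _ f
      mem := by
        obtain ⟨y, hy⟩ := c.mem
        exact ⟨y, f.isOpenEmbedding.injective (by rw [← Scheme.Hom.comp_apply, fac, hy])⟩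
      isGeneratedByNonZeroDivisor := by
        rw [← Scheme.IdealSheafData.comap_comp, fac]
        exact c.isGeneratedByNonZeroDivisor }

end InvertibleIdeal

section Curve

section Support

universe u

variable {B : Type u} [CommRing B]

lemma mem_support_iff_specIdeal_le (K : (Spec (.of B)).IdealSheafData) (q : Spec (.of B)) :
    q ∈ K.support ↔ specIdeal K ≤ q.asIdeal := by
  rw [Scheme.IdealSheafData.mem_support_iff_of_mem (U := ⟨⊤, isAffineOpen_top _⟩) trivial,
    Scheme.mem_zeroLocus_iff]
  have notMem_basicOpen_iff (b : B) :
      q ∉ (Spec (.of B)).basicOpen ((Scheme.ΓSpecIso (.of B)).inv.hom b) ↔ b ∈ q.asIdeal := by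
    rw [basicOpen_eq_of_affine]
    exact not_not
  constructor
  · intro hK b hb
    exact (notMem_basicOpen_iff b).1 (hK _ hb)
  · intro hK x hx
    obtain ⟨b, rfl⟩ := bijective_ΓSpecIso_inv.2 x
    exact (notMem_basicOpen_iff b).2 (hK hx)

lemma specIdeal_ker {Z : Scheme.{u}} (f : Z ⟶ Spec (.of B)) :
    specIdeal f.ker = RingHom.ker ((Scheme.ΓSpecIso (.of B)).inv ≫ f.appTop).hom := by
  have ideal_top := Scheme.IdealSheafData.equivOfIsAffine.apply_symm_apply
    (RingHom.ker f.appTop.hom)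
  rw [Scheme.IdealSheafData.equivOfIsAffine_apply,
    Scheme.IdealSheafData.equivOfIsAffine_symm_apply, ← Scheme.ker_of_isAffine] at ideal_top
  rw [specIdeal, ideal_top]
  rfl

variable {C T : Scheme.{u}} [IsReduced C] (i : C ⟶ T) [IsClosedImmersion i]
  (j : Spec (.of B) ⟶ T) [IsOpenImmersion j]

lemma isRadical_specIdeal_comap_ker : (specIdeal (i.ker.comap j)).IsRadical := by
  rw [← Scheme.IdealSheafData.ker_fst_of_isClosedImmersion, specIdeal_ker]
  have : IsReduced (Limits.pullback j i) := isReduced_of_isOpenImmersion (Limits.pullback.snd j i)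
  intro b ⟨n, hb⟩
  rw [RingHom.mem_ker, map_pow] at hb
  exact eq_zero_of_pow_eq_zero hb

variable {i j} in
lemma mem_specIdeal_comap_ker_iff {b : B} :
    b ∈ specIdeal (i.ker.comap j) ↔ ∀ q : Spec (.of B), j q ∈ Set.range i → b ∈ q.asIdeal := by
  rw [← (isRadical_specIdeal_comap_ker i j).radical, Ideal.radical_eq_sInf, Submodule.mem_sInf]
  have le_asIdeal_iff (q : Spec (.of B)) :
      specIdeal (i.ker.comap j) ≤ q.asIdeal ↔ j q ∈ Set.range i := by
    rw [← mem_support_iff_specIdeal_le, Scheme.IdealSheafData.support_comap]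
    change j q ∈ (i.ker.support : Set T) ↔ _
    rw [Scheme.Hom.support_ker, i.isClosedEmbedding.isClosed_range.closure_eq]
  exact ⟨fun h q hq => h _ ⟨(le_asIdeal_iff q).2 hq, q.isPrime⟩,
    fun h P hP => h ⟨P, hP.2⟩ ((le_asIdeal_iff ⟨P, hP.2⟩).1 hP.1)⟩

end Support

lemma dehomogenize_mem_asIdeal_iff {σ A : Type*} [CommRing A] [SetLike σ A] [AddSubgroupClass σ A]
    {𝒜 : ℕ → σ} [GradedRing 𝒜] {f g : A} (hf : f ∈ 𝒜 1) {n : ℕ} (hn : 0 < n) (hg : g ∈ 𝒜 n)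
    (q : Spec (.of (Away 𝒜 f))) :
    dehomogenize hf g ∈ q.asIdeal ↔
      g ∈ (show ProjectiveSpectrum 𝒜 from Proj.awayι 𝒜 f hf one_pos q).asHomogeneousIdeal := by
  have preimage_eq := point_preimage_basicOpen hf one_pos hg hn (dehomogenize hf)
    (isUnit_dehomogenize_self hf)
  rw [← awayι_eq_point] at preimage_eq
  have mem_basicOpen_iff : q ∈ PrimeSpectrum.basicOpen (dehomogenize hf g) ↔
      Proj.awayι 𝒜 f hf one_pos q ∈ Proj.basicOpen 𝒜 g := preimage_eq ▸ Iff.rfl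
  exact not_iff_not.1 mem_basicOpen_iff

variable {σ : Type} {C : Scheme.{0}} {i : C ⟶ projSpace σ}

lemma mem_idealOf {f : MvPolynomial σ ℂ} :
    f ∈ (idealOf i).toIdeal ↔
      ∀ x : C, f ∈ (show ProjectiveSpectrum (polyGrading σ) from i x).asHomogeneousIdeal := by
  change f ∈ ProjectiveSpectrum.vanishingIdeal _ ↔ _
  rw [ProjectiveSpectrum.mem_vanishingIdeal]
  exact ⟨fun h x => h _ ⟨x, rfl⟩, fun h _ ⟨x, hx⟩ => hx ▸ h x⟩

lemma isPrime_idealOf [IrreducibleSpace C] : (idealOf i).toIdeal.IsPrime := by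
  let y : ProjectiveSpectrum (polyGrading σ) := i (genericPoint C)
  have idealOf_eq : (idealOf i).toIdeal = y.asHomogeneousIdeal.toIdeal := by
    ext f
    rw [mem_idealOf]
    refine ⟨fun h => h _, fun h x => ?_⟩
    have specializes := (genericPoint_specializes x).map i.continuous
    rw [specializes_iff_mem_closure] at specializes
    exact (ProjectiveSpectrum.le_iff_mem_closure _ _ _).2 specializes h
  rw [idealOf_eq]
  exact y.isPrime

lemma finrank_degreePart_add_hilbertFunction [Fintype σ] (I : HomogeneousIdeal (polyGrading σ))
    (n : ℕ) :
    Module.finrank ℂ (degreePart I.toIdeal n) + hilbertFunction I n =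
      (Fintype.card σ).multichoose n := by
  let π : polyGrading σ n →ₗ[ℂ] MvPolynomial σ ℂ ⧸ I.toIdeal :=
    (Ideal.Quotient.mkₐ ℂ I.toIdeal).toLinearMap.domRestrict (polyGrading σ n)
  have ker_π : LinearMap.ker π = (degreePart I.toIdeal n).comap (polyGrading σ n).subtype := by
    ext f
    rw [LinearMap.mem_ker, Submodule.mem_comap, mem_degreePart]
    change Ideal.Quotient.mk I.toIdeal f.1 = 0 ↔ _
    rw [Ideal.Quotient.eq_zero_iff_mem]
    exact ⟨fun h => ⟨h, f.2⟩, fun h => h.1⟩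
  have finrank_ker : Module.finrank ℂ (LinearMap.ker π) =
      Module.finrank ℂ (degreePart I.toIdeal n) :=
    ker_π ▸ (Submodule.comapSubtypeEquivOfLe inf_le_right).finrank_eq
  rw [← finrank_homogeneousSubmodule (K := ℂ), ← π.finrank_range_add_finrank_ker, finrank_ker,
    add_comm, LinearMap.range_domRestrict]
  rfl

lemma isCubicSexticIdeal_idealOf {i : C ⟶ projSpace (Fin 4)} [IrreducibleSpace C]
    (hdg : HasDegreeGenus (idealOf i) 6 3)
    (hcubics : IsIntersectionOfDegree 3 (Set.range i)) :
    IsCubicSexticIdeal (idealOf i).toIdeal where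
  isPrime := isPrime_idealOf
  isHomogeneous := (idealOf i).isHomogeneous
  finrank_degreePart := by
    filter_upwards [hdg] with n hn
    have := finrank_degreePart_add_hilbertFunction (idealOf i) n
    rw [Fintype.card_fin] at this
    lia
  le_of_cubics P hP hPh hX hP3 f hf := by
    obtain ⟨T, hT3, hT⟩ := hcubics
    obtain ⟨a, ha⟩ := hX
    let p : ProjectiveSpectrum (polyGrading (Fin 4)) :=
      { asHomogeneousIdeal := ⟨P, hPh⟩
        isPrime := hP
        not_irrelevant_le := fun h => ha (h (by
          rw [HomogeneousIdeal.mem_irrelevant_iff]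
          exact DirectSum.decompose_of_mem_ne (polyGrading (Fin 4)) (isHomogeneous_X ℂ a)
            one_ne_zero)) }
    have p_mem : p ∈ ProjectiveSpectrum.zeroLocus (polyGrading (Fin 4)) T := fun f hf => by
      refine hP3 f ⟨mem_idealOf.2 fun x => ?_, hT3 hf⟩
      have : i x ∈ Set.range i := ⟨x, rfl⟩
      rw [hT] at this
      exact this hf
    rw [← hT] at p_mem
    obtain ⟨x, hx⟩ := p_mem
    have := mem_idealOf.1 hf x
    rwa [hx] at this

variable [IsIntegral C] [IsClosedImmersion i] {a : σ} (ha : X a ∈ polyGrading σ 1)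
  (haI : X a ∉ (idealOf i).toIdeal)

include haI

lemma dehomogenize_mem_specIdeal_iff {n : ℕ} (hn : 0 < n) {f : MvPolynomial σ ℂ}
    (hf : f ∈ polyGrading σ n) :
    dehomogenize ha f ∈ specIdeal (i.ker.comap (Proj.awayι (polyGrading σ) (X a) ha one_pos)) ↔
      f ∈ (idealOf i).toIdeal := by
  rw [mem_specIdeal_comap_ker_iff]
  constructor
  · intro h
    refine (isPrime_idealOf.mem_or_mem (mem_idealOf.2 fun x => ?_)).resolve_right haI
    by_cases hx : X a ∈ (show ProjectiveSpectrum (polyGrading σ) from i x).asHomogeneousIdeal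
    · exact Ideal.mul_mem_left _ _ hx
    · have x_mem : i x ∈ (Proj.awayι (polyGrading σ) (X a) ha one_pos).opensRange := by
        rw [Proj.opensRange_awayι]
        exact hx
      obtain ⟨q, hq⟩ := x_mem
      have := (dehomogenize_mem_asIdeal_iff ha hn hf q).1 (h q ⟨x, hq.symm⟩)
      rw [hq] at this
      exact Ideal.mul_mem_right _ _ this
  · rintro h q ⟨x, hx⟩
    rw [dehomogenize_mem_asIdeal_iff ha hn hf, ← hx]
    exact mem_idealOf.1 h x

/-- Multiplying a form by `X a` does not change its dehomogenization, so all forms may be assumed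
to have positive degree. -/
lemma specIdeal_comap_awayι :
    specIdeal (i.ker.comap (Proj.awayι (polyGrading σ) (X a) ha one_pos)) =
      (idealOf i).toIdeal.map (dehomogenize ha) := by
  have mul_mem {n : ℕ} {f : MvPolynomial σ ℂ} (hf : f ∈ polyGrading σ n) :
      f * X a ∈ polyGrading σ (n + 1) := SetLike.mul_mem_graded hf ha
  have dehomogenize_mul (f : MvPolynomial σ ℂ) :
      dehomogenize ha (f * X a) = dehomogenize ha f := by
    rw [map_mul, dehomogenize_self, mul_one]
  refine le_antisymm (fun b hb => ?_) (Ideal.map_le_iff_le_comap.2 fun f hf => ?_)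
  · obtain ⟨n, f, hf, rfl⟩ := Away.mk_surjective _ ha b
    have f_mem : f ∈ polyGrading σ n := by simpa using hf
    rw [← dehomogenize_of_mem ha f_mem, ← dehomogenize_mul] at hb ⊢
    exact Ideal.mem_map_of_mem _
      ((dehomogenize_mem_specIdeal_iff ha haI n.succ_pos (mul_mem f_mem)).1 hb)
  · rw [Ideal.mem_comap, ← sum_homogeneousComponent f, map_sum]
    refine sum_mem fun n _ => ?_
    rw [← dehomogenize_mul]
    exact (dehomogenize_mem_specIdeal_iff ha haI n.succ_pos
      (mul_mem (homogeneousComponent_mem n f))).2 (Ideal.mul_mem_right _ _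
        (homogeneousComponent_mem_of_mem (idealOf i).isHomogeneous hf n))

end Curve

section Tangent

universe u

variable {R B κ : Type*} [CommRing R] [CommRing B] [CommRing κ]

/-- `τ` is a tangent vector of the `R`-algebra `f : R →+* B` at the point `ρ : B →+* κ`: a
`κ[ε]`-valued point that reduces to `ρ` modulo `ε` and is constant along `R`. -/
structure IsTangentVector (f : R →+* B) (ρ : B →+* κ) (τ : B →+* DualNumber κ) : Prop where
  fst_eq (b : B) : (τ b).fst = ρ b
  snd_eq_zero (r : R) : (τ (f r)).snd = 0

variable {f : R →+* B} {ρ : B →+* κ} {τ τ' : B →+* DualNumber κ}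

lemma IsTangentVector.isUnit (hτ : IsTangentVector f ρ τ) {b : B} (hb : IsUnit (ρ b)) :
    IsUnit (τ b) :=
  TrivSqZeroExt.isUnit_iff_isUnit_fst.2 (hτ.fst_eq b ▸ hb)

lemma IsTangentVector.awayLift (hτ : IsTangentVector f ρ τ) {t : B} (ht : IsUnit (ρ t)) :
    IsTangentVector ((algebraMap B (Localization.Away t)).comp f)
      (IsLocalization.Away.lift t ht) (IsLocalization.Away.lift t (hτ.isUnit ht)) where
  fst_eq x := by
    have fst_comp : (TrivSqZeroExt.fstHom κ κ κ).toRingHom.comp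
        (IsLocalization.Away.lift t (hτ.isUnit ht)) =
          IsLocalization.Away.lift (S := Localization.Away t) t ht := by
      refine IsLocalization.ringHom_ext (Submonoid.powers t) (RingHom.ext fun b => ?_)
      change (IsLocalization.Away.lift t (hτ.isUnit ht) (algebraMap B _ b)).fst =
        IsLocalization.Away.lift t ht (algebraMap B _ b)
      rw [IsLocalization.Away.lift_eq, IsLocalization.Away.lift_eq, hτ.fst_eq]
    exact RingHom.congr_fun fst_comp x
  snd_eq_zero r := by
    rw [RingHom.comp_apply, IsLocalization.Away.lift_eq, hτ.snd_eq_zero]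

lemma IsTangentVector.quotientLift {I : Ideal B}
    (hτ : IsTangentVector f ρ τ) (hρI : ∀ b ∈ I, ρ b = 0) (hI : ∀ b ∈ I, τ b = 0) :
    IsTangentVector ((Ideal.Quotient.mk I).comp f) (Ideal.Quotient.lift I ρ hρI)
      (Ideal.Quotient.lift I τ hI) where
  fst_eq x := by
    obtain ⟨b, rfl⟩ := Ideal.Quotient.mk_surjective x
    exact hτ.fst_eq b
  snd_eq_zero := hτ.snd_eq_zero

/-- The derivation `b ↦ db(τ)` defined by a tangent vector `τ`. -/
def IsTangentVector.derivation [Algebra R B] [Algebra B κ] [Algebra R κ] [IsScalarTower R B κ]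
    (hτ : IsTangentVector (algebraMap R B) (algebraMap B κ) τ) : Derivation R B κ :=
  Derivation.mk'
    { toFun x := (τ x).snd
      map_add' x y := by rw [map_add, TrivSqZeroExt.snd_add]
      map_smul' r x := by
        rw [Algebra.smul_def, map_mul, DualNumber.snd_mul, hτ.fst_eq, hτ.snd_eq_zero, zero_mul,
          add_zero, ← IsScalarTower.algebraMap_apply, RingHom.id_apply, Algebra.smul_def] }
    fun x y => by
      change (τ (x * y)).snd = x • (τ y).snd + y • (τ x).snd
      rw [map_mul, DualNumber.snd_mul, hτ.fst_eq, hτ.fst_eq, Algebra.smul_def, Algebra.smul_def,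
        mul_comm (τ x).snd]

lemma derivation_mul_derivation_comm [Algebra R B] [Algebra B κ] [Algebra R κ]
    [IsScalarTower R B κ] [Algebra.IsStandardSmoothOfRelativeDimension 1 R B] [Nontrivial B]
    (D D' : Derivation R B κ) (b b' : B) : D b * D' b' = D b' * D' b := by
  have : Algebra.IsStandardSmooth R B :=
    Algebra.IsStandardSmoothOfRelativeDimension.isStandardSmooth 1
  have finrank_eq_one : Module.finrank B (Ω[B⁄R]) = 1 := Module.finrank_eq_of_rank_eq
    (Algebra.IsStandardSmoothOfRelativeDimension.rank_kaehlerDifferential 1)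
  let e := Module.basisUnique Unit finrank_eq_one
  have apply_eq (D : Derivation R B κ) (x : B) :
      D x = e.repr (KaehlerDifferential.D R B x) () • D.liftKaehlerDifferential (e ()) := by
    rw [← map_smul, ← Fintype.sum_unique fun k => e.repr (KaehlerDifferential.D R B x) k • e k,
      e.sum_repr, Derivation.liftKaehlerDifferential_comp_D]
  rw [apply_eq D b, apply_eq D b', apply_eq D' b, apply_eq D' b', smul_mul_smul_comm,
    smul_mul_smul_comm, mul_comm (e.repr _ ())]

lemma snd_mul_snd_comm_of_isStandardSmooth [Nontrivial B]
    (hf : f.IsStandardSmoothOfRelativeDimension 1) (hτ : IsTangentVector f ρ τ)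
    (hτ' : IsTangentVector f ρ τ') (b b' : B) :
    (τ b).snd * (τ' b').snd = (τ b').snd * (τ' b).snd := by
  algebraize [f, ρ, ρ.comp f]
  have : Algebra.IsStandardSmoothOfRelativeDimension 1 R B := hf
  exact derivation_mul_derivation_comm (IsTangentVector.derivation hτ)
    (IsTangentVector.derivation hτ') b b'

/-- The tangent space of a smooth curve at a point is one-dimensional. -/
lemma snd_mul_snd_comm_of_locally {R B κ : Type u} [CommRing R] [CommRing B] [Field κ] {f : R →+* B}
    (hf : RingHom.Locally (RingHom.IsStandardSmoothOfRelativeDimension 1) f)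
    {ρ : B →+* κ} {τ τ' : B →+* DualNumber κ} (hτ : IsTangentVector f ρ τ)
    (hτ' : IsTangentVector f ρ τ') (b b' : B) :
    (τ b).snd * (τ' b').snd = (τ b').snd * (τ' b).snd := by
  obtain ⟨s, span_s, smooth⟩ := hf
  obtain ⟨t, ht, ρt_ne⟩ : ∃ t ∈ s, ρ t ≠ 0 := by
    by_contra! vanish
    have : Ideal.span s ≤ RingHom.ker ρ := Ideal.span_le.2 vanish
    exact RingHom.ker_ne_top ρ (top_le_iff.1 (span_s ▸ this))
  have : Nontrivial (Localization.Away t) :=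
    RingHom.domain_nontrivial (IsLocalization.Away.lift t ρt_ne.isUnit)
  have comm := snd_mul_snd_comm_of_isStandardSmooth (smooth t ht) (hτ.awayLift ρt_ne.isUnit)
    (hτ'.awayLift ρt_ne.isUnit) (algebraMap B _ b) (algebraMap B _ b')
  simpa only [IsLocalization.Away.lift_eq] using comm

variable {σ : Type*} (φ : MvPolynomial σ R →+* κ) (d : σ → κ)

/-- The tangent vector `d` of affine space at the point `φ`. -/
def tangentHom : MvPolynomial σ R →+* DualNumber κ :=
  eval₂Hom ((TrivSqZeroExt.inlHom κ κ).comp (φ.comp MvPolynomial.C))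
    fun j => TrivSqZeroExt.inl (φ (X j)) + TrivSqZeroExt.inr (d j)

lemma tangentHom_X (j : σ) :
    tangentHom φ d (X j) = TrivSqZeroExt.inl (φ (X j)) + TrivSqZeroExt.inr (d j) :=
  eval₂Hom_X' _ _ _

lemma isTangentVector_tangentHom : IsTangentVector MvPolynomial.C φ (tangentHom φ d) where
  fst_eq p := by
    have fst_comp : (TrivSqZeroExt.fstHom κ κ κ).toRingHom.comp (tangentHom φ d) = φ := by
      ext x
      · change (tangentHom φ d (MvPolynomial.C x)).fst = φ (MvPolynomial.C x)
        rw [tangentHom, eval₂Hom_C]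
        exact TrivSqZeroExt.fst_inl _ _
      · change (tangentHom φ d (X x)).fst = φ (X x)
        rw [tangentHom_X, TrivSqZeroExt.fst_add, TrivSqZeroExt.fst_inl, TrivSqZeroExt.fst_inr,
          add_zero]
    exact RingHom.congr_fun fst_comp p
  snd_eq_zero r := by
    rw [tangentHom, eval₂Hom_C]
    exact TrivSqZeroExt.snd_inl _ _

end Tangent

section Minors

variable {κ : Type*} [CommRing κ]

/-- By the Leibniz rule the `ε`-part of the determinant is a combination of `2 × 2` minors. -/
lemma det_dualNumber_eq_zero {N : Matrix (Fin 3) (Fin 3) (DualNumber κ)}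
    (h : ∀ r s p q, (N r p).fst * (N s q).fst - (N r q).fst * (N s p).fst = 0) : N.det = 0 := by
  rw [Matrix.det_fin_three]
  ext
  · simp only [TrivSqZeroExt.fst_add, TrivSqZeroExt.fst_sub, TrivSqZeroExt.fst_mul,
      TrivSqZeroExt.fst_zero]
    linear_combination (N 0 0).fst * h 1 2 1 2 - (N 0 1).fst * h 1 2 0 2 + (N 0 2).fst * h 1 2 0 1
  · simp only [TrivSqZeroExt.snd_add, TrivSqZeroExt.snd_sub, DualNumber.snd_mul,
      TrivSqZeroExt.fst_mul, TrivSqZeroExt.snd_zero]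
    linear_combination (N 0 0).snd * h 1 2 1 2 - (N 0 1).snd * h 1 2 0 2 +
      (N 0 2).snd * h 1 2 0 1 - (N 1 0).snd * h 0 2 1 2 + (N 1 1).snd * h 0 2 0 2 -
      (N 1 2).snd * h 0 2 0 1 + (N 2 0).snd * h 0 1 1 2 - (N 2 1).snd * h 0 1 0 2 +
      (N 2 2).snd * h 0 1 0 1

lemma maxMinor_dualNumber_eq_zero {N : Matrix (Fin 3) (Fin 4) (DualNumber κ)}
    (h : ∀ r s p q, (minorTwo N r s p q).fst = 0) (j : Fin 4) : maxMinor N j = 0 := by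
  rw [maxMinor, det_dualNumber_eq_zero, mul_zero]
  intro r s p q
  have minor_eq := h r s (j.succAbove p) (j.succAbove q)
  rwa [minorTwo, TrivSqZeroExt.fst_sub, TrivSqZeroExt.fst_mul, TrivSqZeroExt.fst_mul] at minor_eq

end Minors

section Smooth

universe u

lemma awayLift_dehomogenize_mul {σ : Type*} {A B : Type u} [CommRing A] [CommRing B] [SetLike σ A]
    [AddSubgroupClass σ A] {𝒜 : ℕ → σ} [GradedRing 𝒜] {f a : A} {n : ℕ} (hf : f ∈ 𝒜 1)
    (ha : a ∈ 𝒜 n) (φ : A →+* B) (hu : IsUnit (φ f)) :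
    awayLift 𝒜 φ hu (dehomogenize hf a) * φ f ^ n = φ a := by
  rw [dehomogenize_of_mem hf ha]
  exact awayLift_mk_mul hf φ hu n a _

lemma specIdeal_ker_SpecMap {B B' : Type u} [CommRing B] [CommRing B'] (ψ : B →+* B') :
    specIdeal (Spec.map (CommRingCat.ofHom ψ)).ker = RingHom.ker ψ := by
  rw [← Scheme.IdealSheafData.map_bot, specIdeal_map, RingHom.ker_eq_comap_bot]
  congr 1
  rw [specIdeal, Scheme.IdealSheafData.ideal_bot]
  exact (RingHom.injective_iff_ker_eq_bot _).1 bijective_ΓSpecIso_inv.1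

variable {σ : Type} {C : Scheme.{0}} {i : C ⟶ projSpace σ} {a : σ}
  (ha : X a ∈ polyGrading σ 1)

lemma locally_isStandardSmooth {n : ℕ} [IsIntegral C] [IsClosedImmersion i]
    [SmoothOfRelativeDimension n (i ≫ structureMap (polyGrading σ))]
    (haI : X a ∉ (idealOf i).toIdeal) :
    RingHom.Locally (RingHom.IsStandardSmoothOfRelativeDimension n)
      ((Ideal.Quotient.mk ((idealOf i).toIdeal.map (dehomogenize ha))).comp
        ((dehomogenize ha).comp MvPolynomial.C)) := by
  let j := Proj.awayι (polyGrading σ) (X a) ha one_pos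
  obtain ⟨J, e, fst_eq⟩ := IsClosedImmersion.Spec_iff.1
    (inferInstance : IsClosedImmersion (Limits.pullback.fst j i))
  have J_eq : J = (idealOf i).toIdeal.map (dehomogenize ha) := by
    rw [← specIdeal_comap_awayι ha haI, ← Scheme.IdealSheafData.ker_fst_of_isClosedImmersion,
      fst_eq, Scheme.Hom.ker_comp_of_isIso]
    exact ((specIdeal_ker_SpecMap _).trans Ideal.mk_ker).symm
  subst J_eq
  have chart_structureMap :
      (e.inv ≫ Limits.pullback.snd j i) ≫ (i ≫ structureMap (polyGrading σ)) =
        Spec.map (CommRingCat.ofHom ((Ideal.Quotient.mk ((idealOf i).toIdeal.map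
          (dehomogenize ha))).comp ((dehomogenize ha).comp MvPolynomial.C))) := by
    rw [Category.assoc, ← Limits.pullback.condition_assoc, fst_eq, Category.assoc,
      Iso.inv_hom_id_assoc]
    simp only [j]
    rw [awayι_eq_point, point_structureMap, ← Spec.map_comp]
    rfl
  have smooth : SmoothOfRelativeDimension (0 + n)
    ((e.inv ≫ Limits.pullback.snd j i) ≫ (i ≫ structureMap (polyGrading σ))) := inferInstance
  rwa [chart_structureMap, zero_add,
    HasRingHomProperty.Spec_iff (P := @SmoothOfRelativeDimension n)] at smooth

section TangentLift

variable {κ : Type} [CommRing κ] {φ : MvPolynomial σ ℂ →+* κ} (hφ : IsUnit (φ (X a)))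
  (d : σ → κ)

/-- The tangent vector of the chart `X a ≠ 0` of projective space induced by the tangent vector `d`
of its affine cone. -/
def tangentLift : Away (polyGrading σ) (X a) →+* DualNumber κ :=
  awayLift _ (tangentHom φ d) ((isTangentVector_tangentHom φ d).isUnit hφ)

include ha in
lemma isTangentVector_tangentLift :
    IsTangentVector ((dehomogenize ha).comp MvPolynomial.C) (awayLift _ φ hφ)
      (tangentLift hφ d) where
  fst_eq b := by
    have fst_comp : awayLift _ φ hφ =
        (TrivSqZeroExt.fstHom κ κ κ).toRingHom.comp (tangentLift hφ d) := by
      refine awayLift_eq ha hφ fun n p hp => ?_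
      have value := congrArg TrivSqZeroExt.fst (awayLift_mk_mul ha (tangentHom φ d)
        ((isTangentVector_tangentHom φ d).isUnit hφ) n p hp)
      rwa [TrivSqZeroExt.fst_mul, TrivSqZeroExt.fst_pow, (isTangentVector_tangentHom φ d).fst_eq,
        (isTangentVector_tangentHom φ d).fst_eq] at value
    exact (RingHom.congr_fun fst_comp b).symm
  snd_eq_zero c := by
    have value := awayLift_dehomogenize_mul ha (isHomogeneous_C σ c) (tangentHom φ d)
      ((isTangentVector_tangentHom φ d).isUnit hφ)
    rw [pow_zero, mul_one] at value
    exact (congrArg TrivSqZeroExt.snd value).trans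
      ((isTangentVector_tangentHom φ d).snd_eq_zero c)

lemma snd_tangentLift_mul (hd : d a = 0) (j : σ) :
    (tangentLift hφ d (dehomogenize ha (X j))).snd * φ (X a) = d j := by
  have value := congrArg TrivSqZeroExt.snd (awayLift_dehomogenize_mul ha (isHomogeneous_X ℂ j)
    (tangentHom φ d) ((isTangentVector_tangentHom φ d).isUnit hφ))
  rw [pow_one, tangentHom_X, tangentHom_X, hd] at value
  simpa [tangentLift] using value

end TangentLift

variable {i : C ⟶ projSpace (Fin 4)} {a : Fin 4} (ha : X a ∈ polyGrading (Fin 4) 1)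
  {M : Matrix (Fin 3) (Fin 4) (MvPolynomial (Fin 4) ℂ)}
  (hM : IsDeterminantal (idealOf i).toIdeal M)

include hM in
/-- At a common zero of the `2 × 2` minors every tangent vector of `ℙ³` is tangent to the curve. -/
lemma tangentLift_eq_zero {κ : Type} [CommRing κ] {φ : MvPolynomial (Fin 4) ℂ →+* κ}
    (hφ : IsUnit (φ (X a))) (hminors : ∀ r s p q, φ (minorTwo M r s p q) = 0) (d : Fin 4 → κ)
    {b : Away (polyGrading (Fin 4)) (X a)} (hb : b ∈ (idealOf i).toIdeal.map (dehomogenize ha)) :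
    tangentLift hφ d b = 0 := by
  suffices (idealOf i).toIdeal.map (dehomogenize ha) ≤ RingHom.ker (tangentLift hφ d) from this hb
  rw [← hM.span_eq, Ideal.map_span, Ideal.span_le]
  rintro _ ⟨_, ⟨j, rfl⟩, rfl⟩
  have hu := (isTangentVector_tangentHom φ d).isUnit hφ
  refine (hu.pow 3).mul_left_injective ?_
  dsimp only
  rw [tangentLift, awayLift_dehomogenize_mul ha (isHomogeneous_maxMinor hM.isHomogeneous j),
    zero_mul, map_maxMinor]
  refine maxMinor_dualNumber_eq_zero (fun r s p q => ?_) j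
  rw [← map_minorTwo, (isTangentVector_tangentHom φ d).fst_eq, hminors]

include hM in
/-- A common zero of the `2 × 2` minors of `M` would be a point of the curve with a tangent space of
dimension at least two. -/
lemma eq_zero_of_minorTwo_eq_zero [IsIntegral C] [IsClosedImmersion i]
    [SmoothOfRelativeDimension 1 (i ≫ structureMap (polyGrading (Fin 4)))] {κ : Type} [Field κ]
    (φ : MvPolynomial (Fin 4) ℂ →+* κ) (hminors : ∀ r s p q, φ (minorTwo M r s p q) = 0)
    (haI : X a ∉ (idealOf i).toIdeal) : φ (X a) = 0 := by
  by_contra φ_ne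
  have ha : X a ∈ polyGrading (Fin 4) 1 := isHomogeneous_X ℂ a
  have hφ : IsUnit (φ (X a)) := Ne.isUnit φ_ne
  have exists_two_ne : ∀ a : Fin 4, ∃ p q, p ≠ a ∧ q ≠ a ∧ p ≠ q := by decide
  obtain ⟨p, q, hpa, hqa, hpq⟩ := exists_two_ne a
  have point_mem (b) (hb : b ∈ (idealOf i).toIdeal.map (dehomogenize ha)) :
      awayLift _ φ hφ b = 0 := by
    rw [← (isTangentVector_tangentLift ha hφ 0).fst_eq, tangentLift_eq_zero ha hM hφ hminors 0 hb,
      TrivSqZeroExt.fst_zero]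
  have tangent (d : Fin 4 → κ) := (isTangentVector_tangentLift ha hφ d).quotientLift point_mem
    fun b hb => tangentLift_eq_zero ha hM hφ hminors d hb
  have comm := snd_mul_snd_comm_of_locally (locally_isStandardSmooth ha haI)
    (tangent (Pi.single p 1)) (tangent (Pi.single q 1))
    (Ideal.Quotient.mk _ (dehomogenize ha (X p))) (Ideal.Quotient.mk _ (dehomogenize ha (X q)))
  simp only [Ideal.Quotient.lift_mk] at comm
  have coord_p := snd_tangentLift_mul ha hφ (Pi.single p 1) (by simp [hpa.symm])
  have coord_q := snd_tangentLift_mul ha hφ (Pi.single q 1) (by simp [hqa.symm])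
  have scaled := congrArg (· * (φ (X a) * φ (X a))) comm
  simp only [mul_mul_mul_comm _ _ (φ (X a)), coord_p, coord_q] at scaled
  simp [hpq, hpq.symm] at scaled

end Smooth

section Polynomials

variable {R σ B : Type*} [CommRing R] [CommRing B]

lemma map_eq_pow_mul_of_isHomogeneous {φ φ' : MvPolynomial σ R →+* B} {u : B}
    (hC : ∀ z, φ' (C z) = φ (C z)) (hX : ∀ s, φ' (X s) = u * φ (X s)) {n : ℕ}
    {f : MvPolynomial σ R} (hf : f.IsHomogeneous n) : φ' f = u ^ n * φ f := by
  have eq_eval₂ (ψ : MvPolynomial σ R →+* B) : ψ f = f.eval₂ (ψ.comp C) fun s => ψ (X s) := by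
    have : ψ = eval₂Hom (ψ.comp C) fun s => ψ (X s) := by ext <;> simp
    exact RingHom.congr_fun this f
  rw [eq_eval₂ φ', eq_eval₂ φ, ← eval₂_mul_of_isHomogeneous hf]
  congr 1
  · exact RingHom.ext hC
  · exact funext hX

lemma sub_homogeneousComponent_zero_mem_span_range_X (f : MvPolynomial σ R) :
    f - homogeneousComponent 0 f ∈ Ideal.span (Set.range X) := by
  rw [← Set.image_univ, mem_ideal_span_X_image]
  intro m hm
  by_contra! m_eq
  have m_eq_zero : m = 0 := Finsupp.ext fun s => m_eq s trivial
  rw [m_eq_zero, mem_support_iff, coeff_sub, homogeneousComponent_zero, coeff_zero_C,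
    sub_self] at hm
  exact hm rfl

lemma exists_mem_basicOpen_X {σ : Type} (x : projSpace σ) :
    ∃ a, x ∈ Proj.basicOpen (polyGrading σ) (X a) := by
  have iSup_eq_top := Proj.iSup_basicOpen_eq_top (polyGrading σ) X fun f hf => by
    have component_zero : homogeneousComponent 0 f = 0 := by
      rw [← decomposition.decompose'_apply]
      exact (HomogeneousIdeal.mem_irrelevant_iff _ _).1 hf
    simpa only [component_zero, sub_zero] using sub_homogeneousComponent_zero_mem_span_range_X f
  exact TopologicalSpace.Opens.mem_iSup.1 (iSup_eq_top.ge (TopologicalSpace.Opens.mem_top x))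

lemma specIdeal_comap_point {B : Type} [CommRing B] {C : Scheme.{0}} {i : C ⟶ projSpace (Fin 4)}
    [IsIntegral C] [IsClosedImmersion i] {M : Matrix (Fin 3) (Fin 4) (MvPolynomial (Fin 4) ℂ)}
    (hM : IsDeterminantal (idealOf i).toIdeal M) {a : Fin 4} (haI : X a ∉ (idealOf i).toIdeal)
    (ha : X a ∈ polyGrading (Fin 4) 1) (φ : MvPolynomial (Fin 4) ℂ →+* B) (hu : IsUnit (φ (X a))) :
    specIdeal (i.ker.comap (point ha one_pos φ hu)) =
      Ideal.span (Set.range fun j => φ (maxMinor M j)) := by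
  rw [point, Scheme.IdealSheafData.comap_comp, specIdeal_comap, specIdeal_comap_awayι ha haI,
    ← hM.span_eq, Ideal.map_span, Ideal.map_span, ← Set.range_comp, ← Set.range_comp]
  have awayLift_mul (j : Fin 4) :
      awayLift _ φ hu (dehomogenize ha (maxMinor M j)) * φ (X a) ^ 3 = φ (maxMinor M j) :=
    awayLift_dehomogenize_mul ha (isHomogeneous_maxMinor hM.isHomogeneous j) φ hu
  refine le_antisymm (Ideal.span_le.2 ?_) (Ideal.span_le.2 ?_)
  · rintro _ ⟨j, rfl⟩
    refine (Ideal.mul_unit_mem_iff_mem _ (hu.pow 3)).1 ?_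
    rw [Function.comp_apply, Function.comp_apply, awayLift_mul]
    exact Ideal.subset_span ⟨j, rfl⟩
  · rintro _ ⟨j, rfl⟩
    dsimp only
    rw [← awayLift_mul]
    exact Ideal.mul_mem_right _ _ (Ideal.subset_span ⟨j, rfl⟩)

end Polynomials

section BilinearForms

section LinMatrix

variable {R α β ρ B : Type*} [CommRing R] [CommRing B] [Fintype α] (c : ρ → α × β → R)

/-- The matrix of linear forms that encodes the bilinear forms `∑ c r (i, j) xᵢ yⱼ`: its `r`-th row
lists the coefficients of the `yⱼ` in the `r`-th form. -/
def linMatrix : Matrix ρ β (MvPolynomial α R) :=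
  Matrix.of fun r j => ∑ i, C (c r (i, j)) * X i

lemma linMatrix_apply (r : ρ) (j : β) : linMatrix c r j = ∑ i, C (c r (i, j)) * X i := rfl

lemma isHomogeneous_linMatrix (r : ρ) (j : β) : (linMatrix c r j).IsHomogeneous 1 :=
  IsHomogeneous.sum _ _ _ fun _ _ => isHomogeneous_C_mul_X _ _

lemma sum_map_linMatrix_mul [Fintype β] (φ : MvPolynomial α R →+* B) (η : β → B) (r : ρ) :
    ∑ j, φ (linMatrix c r j) * η j = ∑ p, φ (C (c r p)) * (φ (X p.1) * η p.2) := by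
  simp only [linMatrix_apply, map_sum, map_mul, Finset.sum_mul, mul_assoc,
    Fintype.sum_prod_type_right]

lemma linearIndependent_of_maxMinor_linMatrix_ne_zero [IsDomain R] {n : ℕ}
    {c : Fin n → α × Fin (n + 1) → R} {j : Fin (n + 1)} (hj : maxMinor (linMatrix c) j ≠ 0) :
    LinearIndependent R c := by
  rw [Fintype.linearIndependent_iff]
  intro g sum_eq_zero
  by_contra! exists_ne
  obtain ⟨r, gr_ne⟩ := exists_ne
  refine hj ?_
  have det_eq_zero : ((linMatrix c).submatrix id j.succAbove).det = 0 := by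
    rw [← Matrix.exists_vecMul_eq_zero_iff]
    refine ⟨fun r => C (g r), fun h => gr_ne (by simpa using congrFun h r), ?_⟩
    ext1 k
    change ∑ r, C (g r) * linMatrix c r (j.succAbove k) = 0
    simp only [linMatrix_apply, Finset.mul_sum]
    rw [Finset.sum_comm]
    refine Finset.sum_eq_zero fun i _ => ?_
    have coeff_sum := congrFun sum_eq_zero (i, j.succAbove k)
    simp only [Finset.sum_apply, Pi.smul_apply, smul_eq_mul, Pi.zero_apply] at coeff_sum
    simp only [← mul_assoc, ← C_mul, ← Finset.sum_mul, ← map_sum, coeff_sum, C_0, zero_mul]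
  rw [maxMinor, det_eq_zero, mul_zero]

end LinMatrix

section SectionSpace

variable {K s ρ : Type*} [Field K] [Fintype s] {c : ρ → s → K}

variable (c) in
/-- The subspace of common zeros of the linear forms with coefficients `c`. -/
def sectionSpace : Submodule K (s → K) := LinearMap.ker (Matrix.of c).mulVecLin

lemma mem_sectionSpace {v : s → K} : v ∈ sectionSpace c ↔ ∀ r, ∑ t, c r t * v t = 0 := by
  rw [sectionSpace, LinearMap.mem_ker, funext_iff]
  rfl

lemma finrank_sectionSpace [Fintype ρ] (hc : LinearIndependent K c) :
    Fintype.card ρ + Module.finrank K (sectionSpace c) = Fintype.card s := by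
  have rank_eq : (Matrix.of c).rank = Fintype.card ρ :=
    LinearIndependent.rank_matrix (M := Matrix.of c) hc
  rw [← rank_eq, Matrix.rank, sectionSpace, LinearMap.finrank_range_add_finrank_ker,
    Module.finrank_pi]

lemma mem_span_of_forall_mem_sectionSpace [Finite ρ] {a : s → K}
    (ha : ∀ v ∈ sectionSpace c, ∑ t, a t * v t = 0) : a ∈ Submodule.span K (Set.range c) := by
  classical
  let F := dotProductEquiv K s
  have mem_span : F a ∈ Submodule.span K (Set.range (F ∘ c)) := by
    refine mem_span_of_iInf_ker_le_ker fun v hv => ?_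
    rw [Submodule.mem_iInf] at hv
    exact ha v (mem_sectionSpace.2 hv)
  rw [Set.range_comp, ← LinearEquiv.coe_coe, ← Submodule.map_span] at mem_span
  obtain ⟨b, hb, hba⟩ := mem_span
  rwa [← F.injective hba]

end SectionSpace

lemma sum_map_mul_eq_zero_of_mem_span {R B s ρ : Type*} [CommRing R] [CommRing B] [Fintype s]
    {c : ρ → s → R} {f : R →+* B} {x : s → B} (hx : ∀ r, ∑ t, f (c r t) * x t = 0) {a : s → R}
    (ha : a ∈ Submodule.span R (Set.range c)) : ∑ t, f (a t) * x t = 0 := by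
  induction ha using Submodule.span_induction with
  | mem a ha => obtain ⟨r, rfl⟩ := ha; exact hx r
  | zero => simp
  | add a b _ _ ha hb =>
    simp only [Pi.add_apply, map_add, add_mul, Finset.sum_add_distrib, ha, hb, add_zero]
  | smul z a _ ha =>
    simp only [Pi.smul_apply, smul_eq_mul, map_mul, mul_assoc, ← Finset.mul_sum, ha, mul_zero]

section Kernel

variable {B : Type*} [CommRing B] {f : ℂ →+* B}

variable (f) in
lemma segreIdeal_le_ker {α β : Type} (x : α → B) (y : β → B) :
    (segreIdeal α β).toIdeal ≤ RingHom.ker (eval₂Hom f fun p => x p.1 * y p.2) := by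
  intro g hg
  have eq_comp : eval₂Hom f (fun p : α × β => x p.1 * y p.2) =
      (eval₂Hom f (Sum.elim x y)).comp (segreHom α β).toRingHom := by
    ext <;> simp [segreHom]
  rw [RingHom.mem_ker, eq_comp, RingHom.comp_apply]
  exact (congrArg _ (show segreHom α β g = 0 from hg)).trans (map_zero _)

lemma linearIdeal_sectionSpace_le_ker {s : Type} {ρ : Type*} [Fintype s] [Finite ρ]
    {c : ρ → s → ℂ} {x : s → B} (hx : ∀ r, ∑ t, f (c r t) * x t = 0) :
    (linearIdeal (sectionSpace c)).toIdeal ≤ RingHom.ker (eval₂Hom f x) := by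
  refine Ideal.span_le.2 ?_
  rintro _ ⟨a, ha, rfl⟩
  change eval₂Hom f x (linearForm a) = 0
  simp only [linearForm, map_sum, map_mul, eval₂Hom_C, eval₂Hom_X']
  exact sum_map_mul_eq_zero_of_mem_span hx (mem_span_of_forall_mem_sectionSpace ha)

end Kernel

end BilinearForms

section SectionRing

variable (c : Fin 3 → Fin 4 × Fin 4 → ℂ)

/-- The homogeneous coordinate ring of the section of the Segre variety by the bilinear forms with
coefficients `c`. -/
abbrev SectionRing : Type :=
  MvPolynomial (Fin 4 × Fin 4) ℂ ⧸ (segreSectionIdeal (sectionSpace c)).toIdeal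

/-- The grading of `SectionRing c` by degree. -/
abbrev sectionGrading : ℕ → Submodule ℂ (SectionRing c) :=
  quotientGrading (polyGrading (Fin 4 × Fin 4)) (segreSectionIdeal (sectionSpace c))

/-- The coordinates of `ℙ¹⁵` on the section of the Segre variety. -/
def coord (p : Fin 4 × Fin 4) : SectionRing c := Ideal.Quotient.mk _ (X p)

lemma coord_mem (p : Fin 4 × Fin 4) : coord c p ∈ sectionGrading c 1 :=
  mk_mem_quotientGrading _ (isHomogeneous_X ℂ p)

lemma coord_mul_coord (i j k l : Fin 4) :
    coord c (i, j) * coord c (k, l) = coord c (i, l) * coord c (k, j) := by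
  rw [coord, coord, coord, coord, ← map_mul, ← map_mul, Ideal.Quotient.eq]
  refine (le_sup_left : segreIdeal (Fin 4) (Fin 4) ≤ segreSectionIdeal (sectionSpace c)) ?_
  change segreHom _ _ _ = 0
  simp only [segreHom, map_sub, map_mul, aeval_X]
  ring

lemma irrelevant_le_span_range_coord :
    (HomogeneousIdeal.irrelevant (sectionGrading c)).toIdeal ≤
      Ideal.span (Set.range (coord c)) := by
  intro x hx
  obtain ⟨f, rfl⟩ := Ideal.Quotient.mk_surjective x
  have mk_component_zero : Ideal.Quotient.mk (segreSectionIdeal (sectionSpace c)).toIdeal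
      (homogeneousComponent 0 f) = 0 := by
    rw [← decomposition.decompose'_apply]
    exact (HomogeneousIdeal.mem_irrelevant_iff _ _).1 hx
  have mk_sub_mem := Ideal.mem_map_of_mem
    (Ideal.Quotient.mk (segreSectionIdeal (sectionSpace c)).toIdeal)
    (sub_homogeneousComponent_zero_mem_span_range_X f)
  rwa [map_sub, mk_component_zero, sub_zero, Ideal.map_span, ← Set.range_comp] at mk_sub_mem

variable {B : Type*} [CommRing B]

lemma sum_mul_coord (r : Fin 3) (ψ : SectionRing c →+* B) :
    ∑ p, ψ (Ideal.Quotient.mk _ (C (c r p))) * ψ (coord c p) = 0 := by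
  have linearForm_mem : linearForm (c r) ∈ (segreSectionIdeal (sectionSpace c)).toIdeal :=
    (le_sup_right : linearIdeal _ ≤ segreSectionIdeal (sectionSpace c))
      (Ideal.subset_span ⟨c r, fun v hv => mem_sectionSpace.1 hv r, rfl⟩)
  rw [← Ideal.Quotient.eq_zero_iff_mem] at linearForm_mem
  simpa [linearForm, coord] using congrArg ψ linearForm_mem

variable {c}

lemma map_eq_pow_mul_of_mem_sectionGrading {ψ ψ' : SectionRing c →+* B} {u : B}
    (hC : ∀ z, ψ' (Ideal.Quotient.mk _ (C z)) = ψ (Ideal.Quotient.mk _ (C z)))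
    (hX : ∀ p, ψ' (coord c p) = u * ψ (coord c p)) (n : ℕ) :
    ∀ a ∈ sectionGrading c n, ψ' a = u ^ n * ψ a := by
  rintro _ ⟨f, hf, rfl⟩
  exact map_eq_pow_mul_of_isHomogeneous (φ := ψ.comp (Ideal.Quotient.mk _))
    (φ' := ψ'.comp (Ideal.Quotient.mk _)) hC hX hf

variable (φ : MvPolynomial (Fin 4) ℂ →+* B) (η : Fin 4 → B)
  (hη : ∀ r, ∑ j, φ (linMatrix c r j) * η j = 0)

/-- The homogeneous coordinates `xᵢ ηⱼ` of the point `([x], [η])` of the section of the Segre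
variety, where `x` is the point with coordinates given by `φ`. -/
def pointHom : SectionRing c →+* B :=
  Ideal.Quotient.lift _ (eval₂Hom (φ.comp C) fun p => φ (X p.1) * η p.2) <| by
    change (segreIdeal _ _ ⊔ linearIdeal (sectionSpace c)).toIdeal ≤ RingHom.ker _
    rw [HomogeneousIdeal.toIdeal_sup]
    refine sup_le (segreIdeal_le_ker _ (fun i => φ (X i)) η)
      (linearIdeal_sectionSpace_le_ker fun r => ?_)
    rw [← hη r, sum_map_linMatrix_mul]
    rfl

@[simp] lemma pointHom_coord (p : Fin 4 × Fin 4) :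
    pointHom φ η hη (coord c p) = φ (X p.1) * η p.2 :=
  eval₂Hom_X' _ _ _

@[simp] lemma pointHom_C (z : ℂ) : pointHom φ η hη (Ideal.Quotient.mk _ (C z)) = φ (C z) :=
  eval₂Hom_C _ _ _

end SectionRing

section Projection

variable {B : Type} [CommRing B] (c : Fin 3 → Fin 4 × Fin 4 → ℂ)

lemma X_mem_polyGrading {σ : Type} (a : σ) : X a ∈ polyGrading σ 1 := isHomogeneous_X ℂ a

/-- The homomorphism `xᵢ ↦ coord c (i, k)` from the coordinate ring of `ℙ³`, which reads the first
point `[x]` of `([x], [y])` off the `k`-th column of the matrix `xᵢ yⱼ`. -/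
def slice (k : Fin 4) : MvPolynomial (Fin 4) ℂ →+* SectionRing c :=
  eval₂Hom ((Ideal.Quotient.mk _).comp C) fun i => coord c (i, k)

@[simp] lemma slice_X (k i : Fin 4) : slice c k (X i) = coord c (i, k) := eval₂Hom_X' _ _ _

@[simp] lemma slice_C (k : Fin 4) (z : ℂ) : slice c k (C z) = Ideal.Quotient.mk _ (C z) :=
  eval₂Hom_C _ _ _

lemma isUnit_slice_X {c : Fin 3 → Fin 4 × Fin 4 → ℂ} {ψ : SectionRing c →+* B} {a k : Fin 4}
    (h : IsUnit (ψ (coord c (a, k)))) : IsUnit (ψ.comp (slice c k) (X a)) := by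
  rwa [RingHom.comp_apply, slice_X]

variable {c}

/-- The matrix `coord c (i, j)` has rank one, so its columns are proportional. -/
lemma point_slice_eq_point_slice {ψ ψ' : SectionRing c →+* B} {a b k l : Fin 4} {u : B}
    (hu : IsUnit u) (h_pow : ∀ n, ∀ x ∈ sectionGrading c n, ψ' x = u ^ n * ψ x)
    (h : IsUnit (ψ (coord c (a, k)))) (h' : IsUnit (ψ' (coord c (b, l)))) :
    point (X_mem_polyGrading a) one_pos (ψ.comp (slice c k)) (isUnit_slice_X h) =
      point (X_mem_polyGrading b) one_pos (ψ'.comp (slice c l)) (isUnit_slice_X h') := by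
  have map_coord_eq (p) : ψ' (coord c p) = u * ψ (coord c p) := by
    simpa using h_pow 1 _ (coord_mem c p)
  have isUnit_al : IsUnit (ψ (coord c (a, l))) := by
    have isUnit_mul := h.mul (isUnit_of_mul_isUnit_right (map_coord_eq (b, l) ▸ h'))
    rw [← map_mul, coord_mul_coord, map_mul] at isUnit_mul
    exact isUnit_of_mul_isUnit_left isUnit_mul
  obtain ⟨w, hw⟩ := h
  refine point_eq_point_of_forall_eq_pow_mul _ _ _ _ _ _ (u := u * (ψ (coord c (a, l)) * ↑w⁻¹))
    (hu.mul (isUnit_al.mul (Units.isUnit _))) fun n f hf => ?_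
  refine map_eq_pow_mul_of_isHomogeneous (fun z => ?_) (fun i => ?_) hf
  · simpa using h_pow 0 _ (mk_mem_quotientGrading _ (isHomogeneous_C _ z))
  · have column_eq : ψ (coord c (i, l)) = ↑w⁻¹ * (ψ (coord c (a, l)) * ψ (coord c (i, k))) := by
      rw [← map_mul, ← coord_mul_coord, map_mul, ← hw, Units.inv_mul_cancel_left]
    simp only [RingHom.comp_apply, slice_X, map_coord_eq, column_eq]
    ring

variable (c)

/-- The affine charts `coord c p ≠ 0` of the section of the Segre variety. -/
def sectionCover : (projSubscheme (segreSectionIdeal (sectionSpace c))).AffineOpenCover :=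
  Proj.affineOpenCoverOfIrrelevantLESpan (sectionGrading c) (coord c) (coord_mem c)
    (fun _ => one_pos) (irrelevant_le_span_range_coord c)

/-- The projection `([x], [y]) ↦ [x]` on the chart `coord c p ≠ 0`. -/
def projChart (p : Fin 4 × Fin 4) :
    Spec (.of (Away (sectionGrading c) (coord c p))) ⟶ projSpace (Fin 4) :=
  point (X_mem_polyGrading p.1) one_pos ((dehomogenize (coord_mem c p)).comp (slice c p.2))
    (isUnit_slice_X (isUnit_dehomogenize_self (coord_mem c p)))

lemma pullback_fst_projChart (p q : Fin 4 × Fin 4) :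
    Limits.pullback.fst (Proj.awayι (sectionGrading c) (coord c p) (coord_mem c p) one_pos)
        (Proj.awayι (sectionGrading c) (coord c q) (coord_mem c q) one_pos) ≫ projChart c p =
      Limits.pullback.snd _ _ ≫ projChart c q := by
  rw [← cancel_epi (Proj.pullbackAwayιIso (sectionGrading c) (coord_mem c p) one_pos
    (coord_mem c q) one_pos rfl).inv, Proj.pullbackAwayιIso_inv_fst_assoc,
    Proj.pullbackAwayιIso_inv_snd_assoc, projChart, projChart, SpecMap_point, SpecMap_point]
  let ψ := (awayMap (sectionGrading c) (coord_mem c q) rfl).comp (dehomogenize (coord_mem c p))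
  let ψ' := (awayMap (sectionGrading c) (coord_mem c p) (mul_comm _ _)).comp
    (dehomogenize (coord_mem c q))
  have ψ_coord : ψ (coord c p) = 1 := by simp [ψ, dehomogenize_self]
  have isUnit_ψ : IsUnit (ψ (coord c p)) := ψ_coord ▸ isUnit_one
  have isUnit_ψ' : IsUnit (ψ' (coord c q)) := by simp [ψ', dehomogenize_self]
  have points_eq : point (coord_mem c p) one_pos ψ isUnit_ψ =
      point (coord_mem c q) one_pos ψ' isUnit_ψ' := by
    rw [← SpecMap_point _ _ _ _ (isUnit_dehomogenize_self (coord_mem c p)), ← awayι_eq_point,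
      ← SpecMap_point _ _ _ _ (isUnit_dehomogenize_self (coord_mem c q)), ← awayι_eq_point,
      Proj.SpecMap_awayMap_awayι, Proj.SpecMap_awayMap_awayι]
  refine point_slice_eq_point_slice (isUnit_of_point_eq points_eq) (fun n x hx => ?_)
    isUnit_ψ isUnit_ψ'
  have proportional := mul_pow_eq_of_point_eq points_eq n (a := x) (by simpa using hx)
  rw [ψ_coord, one_pow, mul_one] at proportional
  exact proportional.symm.trans (mul_comm _ _)

/-- The projection `([x], [y]) ↦ [x]` of the section of the Segre variety. -/
def sectionProj : projSubscheme (segreSectionIdeal (sectionSpace c)) ⟶ projSpace (Fin 4) :=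
  (sectionCover c).openCover.glueMorphisms (projChart c) (pullback_fst_projChart c)

variable {c}

lemma awayι_sectionProj (p : Fin 4 × Fin 4) :
    Proj.awayι (sectionGrading c) (coord c p) (coord_mem c p) one_pos ≫ sectionProj c =
      projChart c p :=
  (sectionCover c).openCover.ι_glueMorphisms (projChart c) (pullback_fst_projChart c) p

lemma point_sectionProj (ψ : SectionRing c →+* B) {a k : Fin 4}
    (hu : IsUnit (ψ (coord c (a, k)))) :
    point (coord_mem c (a, k)) one_pos ψ hu ≫ sectionProj c =
      point (X_mem_polyGrading a) one_pos (ψ.comp (slice c k)) (isUnit_slice_X hu) := by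
  rw [point, Category.assoc, awayι_sectionProj, projChart, SpecMap_point]
  refine point_slice_eq_point_slice
    (ψ := (awayLift _ ψ hu).comp (dehomogenize (coord_mem c (a, k)))) hu (fun n x hx => ?_)
    ((isUnit_dehomogenize_self (coord_mem c (a, k))).map (awayLift _ ψ hu)) hu
  rw [mul_comm, RingHom.comp_apply, awayLift_dehomogenize_mul (coord_mem c (a, k)) hx]

lemma sectionProj_structureMap :
    sectionProj c ≫ structureMap (polyGrading (Fin 4)) = structureMap (sectionGrading c) := by
  refine (sectionCover c).openCover.hom_ext _ _ fun (p : Fin 4 × Fin 4) => ?_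
  change Proj.awayι (sectionGrading c) (coord c p) (coord_mem c p) one_pos ≫ _ =
    Proj.awayι (sectionGrading c) (coord c p) (coord_mem c p) one_pos ≫ _
  rw [← Category.assoc, awayι_sectionProj, projChart, point_structureMap, awayι_eq_point,
    point_structureMap]
  congr 2
  refine RingHom.ext fun z => ?_
  exact congrArg (dehomogenize (coord_mem c p)) (slice_C c p.2 z)

lemma isUnit_pointHom_coord {φ : MvPolynomial (Fin 4) ℂ →+* B} {η : Fin 4 → B}
    (hη : ∀ r, ∑ j, φ (linMatrix c r j) * η j = 0) {a k : Fin 4} (ha : IsUnit (φ (X a)))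
    (hk : IsUnit (η k)) : IsUnit (pointHom φ η hη (coord c (a, k))) := by
  rw [pointHom_coord]
  exact ha.mul hk

lemma point_pointHom_sectionProj {φ : MvPolynomial (Fin 4) ℂ →+* B} {η : Fin 4 → B}
    (hη : ∀ r, ∑ j, φ (linMatrix c r j) * η j = 0) {a k : Fin 4} (ha : IsUnit (φ (X a)))
    (hk : IsUnit (η k)) :
    point (coord_mem c (a, k)) one_pos (pointHom φ η hη) (isUnit_pointHom_coord hη ha hk) ≫
      sectionProj c = point (X_mem_polyGrading a) one_pos φ ha := by
  rw [point_sectionProj]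
  refine (point_eq_point_of_forall_eq_pow_mul _ _ _ _ _ _ hk fun n f hf => ?_).symm
  refine map_eq_pow_mul_of_isHomogeneous (fun z => by simp) (fun i => ?_) hf
  simp [mul_comm]

lemma map_coord_eq_mul {ψ : SectionRing c →+* B} {a k : Fin 4} (hψ : ψ (coord c (a, k)) = 1)
    (i j : Fin 4) : ψ (coord c (i, j)) = ψ (coord c (i, k)) * ψ (coord c (a, j)) := by
  rw [← mul_one (ψ (coord c (i, j))), ← hψ, ← map_mul, coord_mul_coord, map_mul]

lemma sum_map_slice_linMatrix_mul_coord {ψ : SectionRing c →+* B} {a k : Fin 4}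
    (hψ : ψ (coord c (a, k)) = 1) (r : Fin 3) :
    ∑ j, ψ (slice c k (linMatrix c r j)) * ψ (coord c (a, j)) = 0 := by
  rw [← sum_mul_coord c r ψ]
  refine (sum_map_linMatrix_mul c (ψ.comp (slice c k)) (fun j => ψ (coord c (a, j))) r).trans
    (Finset.sum_congr rfl fun p _ => ?_)
  rw [RingHom.comp_apply, RingHom.comp_apply, slice_C, slice_X, ← map_coord_eq_mul hψ]

lemma exists_eq_point_pointHom {φ : MvPolynomial (Fin 4) ℂ →+* B} {a : Fin 4}
    {ha : IsUnit (φ (X a))}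
    {h : Spec (.of B) ⟶ projSubscheme (segreSectionIdeal (sectionSpace c))}
    (hh : h ≫ sectionProj c = point (X_mem_polyGrading a) one_pos φ ha) {b k : Fin 4}
    (hbk : h ⁻¹ᵁ Proj.basicOpen (sectionGrading c) (coord c (b, k)) = ⊤) :
    ∃ (η : Fin 4 → B) (hη : ∀ r, ∑ j, φ (linMatrix c r j) * η j = 0) (hk : IsUnit (η k)),
      h = point (coord_mem c (a, k)) one_pos (pointHom φ η hη)
        (isUnit_pointHom_coord hη ha hk) := by
  obtain ⟨ψ, hψ, rfl⟩ := exists_eq_point (coord_mem c (b, k)) h hbk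
  rw [point_sectionProj] at hh
  have proportional (n : ℕ) {f} (hf : f ∈ polyGrading (Fin 4) n) :
      φ f = φ (X b) ^ n * ψ (slice c k f) := by
    have eq_mul := mul_pow_eq_of_point_eq hh n (a := f) (by simpa using hf)
    simp only [RingHom.comp_apply, slice_X, hψ, one_pow, mul_one] at eq_mul
    rw [← eq_mul, mul_comm]
  have hη (r : Fin 3) : ∑ j, φ (linMatrix c r j) * ψ (coord c (b, j)) = 0 := by
    simp only [proportional 1 (isHomogeneous_linMatrix c r _), pow_one, mul_assoc,
      ← Finset.mul_sum, sum_map_slice_linMatrix_mul_coord hψ, mul_zero]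
  refine ⟨_, hη, hψ ▸ isUnit_one, ?_⟩
  refine point_eq_point_of_forall_eq_pow_mul _ _ _ _ _ _ (isUnit_of_point_eq hh)
    (map_eq_pow_mul_of_mem_sectionGrading (fun z => ?_) fun p => ?_)
  · rw [pointHom_C]
    simpa using proportional 0 (isHomogeneous_C _ z)
  · rw [pointHom_coord, proportional 1 (X_mem_polyGrading p.1), slice_X, pow_one, mul_assoc,
      ← map_coord_eq_mul hψ p.1 p.2]

end Projection

section Kernel

variable {R : Type*} [CommRing R] {n : ℕ} {M : Matrix (Fin n) (Fin (n + 1)) R}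
  {η η' : Fin (n + 1) → R} {k l : Fin (n + 1)}

lemma span_range_maxMinor_eq_span_singleton (hη : ∀ r, ∑ j, M r j * η j = 0) (hk : IsUnit (η k)) :
    Ideal.span (Set.range (maxMinor M)) = Ideal.span {maxMinor M k} := by
  refine le_antisymm (Ideal.span_le.2 ?_) (Ideal.span_mono (by simp))
  rintro _ ⟨j, rfl⟩
  refine (Ideal.mul_unit_mem_iff_mem _ hk).1 ?_
  rw [maxMinor_mul_eq hη j k]
  exact Ideal.mul_mem_right _ _ (Ideal.mem_span_singleton_self _)

lemma maxMinor_mem_nonZeroDivisors (hη : ∀ r, ∑ j, M r j * η j = 0) (hk : IsUnit (η k))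
    (h : IsGeneratedByNonZeroDivisor (Ideal.span (Set.range (maxMinor M)))) :
    maxMinor M k ∈ nonZeroDivisors R := by
  obtain ⟨β, hβ, span_eq⟩ := h
  rw [span_range_maxMinor_eq_span_singleton hη hk] at span_eq
  obtain ⟨t, rfl⟩ := Ideal.mem_span_singleton.1 (span_eq.ge (Ideal.mem_span_singleton_self β))
  exact (mul_mem_nonZeroDivisors.1 hβ).1

/-- Both vectors are proportional to the vector of maximal minors, whose entries can be
cancelled. -/
lemma exists_isUnit_forall_eq_mul (hη : ∀ r, ∑ j, M r j * η j = 0) (hk : IsUnit (η k))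
    (hη' : ∀ r, ∑ j, M r j * η' j = 0) (hl : IsUnit (η' l))
    (h : IsGeneratedByNonZeroDivisor (Ideal.span (Set.range (maxMinor M)))) :
    ∃ u, IsUnit u ∧ ∀ j, η' j = u * η j := by
  have proportional (j) : η' j * η k = η' k * η j := by
    refine (mul_cancel_left_mem_nonZeroDivisors (maxMinor_mem_nonZeroDivisors hη hk h)).1 ?_
    linear_combination η' k * maxMinor_mul_eq hη j k - η k * maxMinor_mul_eq hη' j k
  have isUnit_η'_k : IsUnit (η' k) := isUnit_of_mul_isUnit_left (proportional l ▸ hl.mul hk)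
  obtain ⟨w, hw⟩ := hk
  refine ⟨η' k * ↑w⁻¹, isUnit_η'_k.mul (Units.isUnit _), fun j => ?_⟩
  rw [mul_right_comm, ← proportional, ← hw, Units.mul_inv_cancel_right]

lemma exists_kernel_of_isGeneratedByNonZeroDivisor
    (h : IsGeneratedByNonZeroDivisor (Ideal.span (Set.range (maxMinor M)))) :
    ∃ η : Fin (n + 1) → R, (∀ r, ∑ j, M r j * η j = 0) ∧ Ideal.span (Set.range η) = ⊤ := by
  obtain ⟨β, hβ, span_eq⟩ := h
  have dvd_maxMinor (j) : β ∣ maxMinor M j :=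
    Ideal.mem_span_singleton.1 (span_eq.le (Ideal.subset_span ⟨j, rfl⟩))
  choose η hη using dvd_maxMinor
  obtain ⟨b, hb⟩ := Ideal.mem_span_range_iff_exists_fun.1
    (span_eq.ge (Ideal.mem_span_singleton_self β))
  refine ⟨η, fun r => (mul_cancel_left_mem_nonZeroDivisors hβ).1 ?_, ?_⟩
  · rw [mul_zero, Finset.mul_sum, ← sum_mul_maxMinor M r]
    exact Finset.sum_congr rfl fun j _ => by rw [hη]; ring
  · rw [Ideal.eq_top_iff_one, Ideal.mem_span_range_iff_exists_fun]
    refine ⟨b, (mul_cancel_left_mem_nonZeroDivisors hβ).1 ?_⟩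
    rw [mul_one, Finset.mul_sum]
    refine (Finset.sum_congr rfl fun j _ => ?_).trans hb
    rw [hη]
    ring

end Kernel

section Lift

variable {c : Fin 3 → Fin 4 × Fin 4 → ℂ}

lemma exists_mem_basicOpen_coord (x : projSubscheme (segreSectionIdeal (sectionSpace c))) :
    ∃ p, x ∈ Proj.basicOpen (sectionGrading c) (coord c p) := by
  have iSup_eq_top := Proj.iSup_basicOpen_eq_top (sectionGrading c) (coord c)
    (irrelevant_le_span_range_coord c)
  exact TopologicalSpace.Opens.mem_iSup.1 (iSup_eq_top.ge (TopologicalSpace.Opens.mem_top x))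

lemma preimage_eq_top_of_opensRange_le {X Y Z : Scheme.{0}} {j : X ⟶ Y} [IsOpenImmersion j]
    {f : Y ⟶ Z} {W : Z.Opens} (h : j.opensRange ≤ f ⁻¹ᵁ W) : (j ≫ f) ⁻¹ᵁ W = ⊤ :=
  TopologicalSpace.Opens.ext (Set.eq_univ_of_forall fun y => h ⟨y, rfl⟩)

variable {C : Scheme.{0}} {i : C ⟶ projSpace (Fin 4)} [IsIntegral C] [IsClosedImmersion i]
  {T : Scheme.{0}} {g : T ⟶ projSpace (Fin 4)}

lemma exists_chart_eq_point {M : Matrix (Fin 3) (Fin 4) (MvPolynomial (Fin 4) ℂ)}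
    (hM : IsDeterminantal (idealOf i).toIdeal M) (hX : ∀ a, X a ∉ (idealOf i).toIdeal)
    (hI : IsInvertibleIdeal (i.ker.comap g)) {x : T} {W : T.Opens} (hx : x ∈ W) :
    ∃ (e : InvertibleChart (i.ker.comap g) x) (a : Fin 4)
      (φ : MvPolynomial (Fin 4) ℂ →+* e.ring) (ha : IsUnit (φ (X a))),
      e.ι.opensRange ≤ W ∧ e.ι ≫ g = point (X_mem_polyGrading a) one_pos φ ha ∧
      IsGeneratedByNonZeroDivisor (Ideal.span (Set.range (maxMinor (M.map φ)))) := by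
  obtain ⟨a, ha⟩ := exists_mem_basicOpen_X (g x)
  obtain ⟨e, he⟩ := hI.exists_chart
    (W := W ⊓ g ⁻¹ᵁ Proj.basicOpen (polyGrading (Fin 4)) (X a)) ⟨hx, ha⟩
  obtain ⟨φ, hφ, ι_comp⟩ := exists_eq_point (X_mem_polyGrading a) (e.ι ≫ g)
    (preimage_eq_top_of_opensRange_le (he.trans inf_le_right))
  refine ⟨e, a, φ, hφ ▸ isUnit_one, he.trans inf_le_left, ι_comp, ?_⟩
  have generated := e.isGeneratedByNonZeroDivisor
  rw [← Scheme.IdealSheafData.comap_comp, ι_comp, specIdeal_comap_point hM (hX a)] at generated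
  simpa only [map_maxMinor] using generated

variable (hM : IsDeterminantal (idealOf i).toIdeal (linMatrix c))
  (hX : ∀ a, X a ∉ (idealOf i).toIdeal)

include hM hX

lemma eq_of_comp_sectionProj_eq
    {h₁ h₂ : T ⟶ projSubscheme (segreSectionIdeal (sectionSpace c))}
    (h : h₁ ≫ sectionProj c = h₂ ≫ sectionProj c)
    (hI : IsInvertibleIdeal (i.ker.comap (h₁ ≫ sectionProj c))) : h₁ = h₂ := by
  refine Scheme.hom_ext_of_forall _ _ fun x => ?_
  obtain ⟨⟨b₁, k⟩, hx₁⟩ := exists_mem_basicOpen_coord (h₁ x)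
  obtain ⟨⟨b₂, l⟩, hx₂⟩ := exists_mem_basicOpen_coord (h₂ x)
  obtain ⟨e, a, φ, ha, he, ι_comp, generated⟩ := exists_chart_eq_point hM hX hI
    (W := h₁ ⁻¹ᵁ Proj.basicOpen (sectionGrading c) (coord c (b₁, k)) ⊓
      h₂ ⁻¹ᵁ Proj.basicOpen (sectionGrading c) (coord c (b₂, l))) ⟨hx₁, hx₂⟩
  refine ⟨e.ι.opensRange, e.mem, ?_⟩
  rw [← cancel_epi e.ι.isoOpensRange.hom, Scheme.Hom.isoOpensRange_hom_ι_assoc,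
    Scheme.Hom.isoOpensRange_hom_ι_assoc]
  obtain ⟨η, hη, hk, ι_comp_h₁⟩ := exists_eq_point_pointHom (h := e.ι ≫ h₁) (ha := ha)
    (b := b₁) (k := k) (by rw [Category.assoc, ι_comp])
    (preimage_eq_top_of_opensRange_le (he.trans inf_le_left))
  obtain ⟨η', hη', hl, ι_comp_h₂⟩ := exists_eq_point_pointHom (h := e.ι ≫ h₂) (ha := ha)
    (b := b₂) (k := l) (by rw [Category.assoc, ← h, ι_comp])
    (preimage_eq_top_of_opensRange_le (he.trans inf_le_right))
  obtain ⟨u, hu, eq_mul⟩ := exists_isUnit_forall_eq_mul hη hk hη' hl generated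
  rw [ι_comp_h₁, ι_comp_h₂]
  refine point_eq_point_of_forall_eq_pow_mul _ _ _ _ _ _ hu
    (map_eq_pow_mul_of_mem_sectionGrading (fun z => by simp) fun p => ?_)
  rw [pointHom_coord, pointHom_coord, eq_mul]
  ring

lemma exists_local_lift (hI : IsInvertibleIdeal (i.ker.comap g)) (x : T) :
    ∃ (B : CommRingCat.{0}) (j : Spec (.of B) ⟶ T) (_ : IsOpenImmersion j),
      x ∈ Set.range j ∧ ∃ h : Spec (.of B) ⟶ projSubscheme (segreSectionIdeal (sectionSpace c)),
        h ≫ sectionProj c = j ≫ g := by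
  obtain ⟨e, a, φ, ha, -, ι_comp, generated⟩ :=
    exists_chart_eq_point hM hX hI (TopologicalSpace.Opens.mem_top x)
  obtain ⟨η, hη, span_eq_top⟩ := exists_kernel_of_isGeneratedByNonZeroDivisor generated
  obtain ⟨y, hy⟩ := e.mem
  obtain ⟨k, hk⟩ : ∃ k, η k ∉ y.asIdeal := by
    by_contra! hmem
    refine y.isPrime.ne_top (top_le_iff.1 (span_eq_top ▸ Ideal.span_le.2 ?_))
    rintro _ ⟨k, rfl⟩
    exact hmem k
  let φ_k := (algebraMap e.ring (Localization.Away (η k))).comp φ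
  let l := Spec.map (CommRingCat.ofHom (algebraMap e.ring (Localization.Away (η k))))
  have : IsOpenImmersion l := inferInstance
  obtain ⟨z, hz⟩ : y ∈ Set.range l :=
    (PrimeSpectrum.localization_away_comap_range (Localization.Away (η k)) (η k)).ge hk
  have kernel_map (r : Fin 3) : ∑ j, φ_k (linMatrix c r j) *
      algebraMap e.ring (Localization.Away (η k)) (η j) = 0 := by
    rw [← map_zero (algebraMap e.ring _), ← hη r, map_sum]
    simp only [map_mul, φ_k, RingHom.comp_apply, Matrix.map_apply]
  refine ⟨.of (Localization.Away (η k)), l ≫ e.ι, inferInstance,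
    ⟨z, by rw [Scheme.Hom.comp_apply, hz, hy]⟩,
    _, (point_pointHom_sectionProj kernel_map (ha.map (algebraMap e.ring _))
      (IsLocalization.Away.algebraMap_isUnit (η k))).trans ?_⟩
  rw [Category.assoc, ι_comp, SpecMap_point]

lemma exists_lift (hI : IsInvertibleIdeal (i.ker.comap g)) :
    ∃ h : T ⟶ projSubscheme (segreSectionIdeal (sectionSpace c)), h ≫ sectionProj c = g := by
  choose B j hj hx h hh using exists_local_lift hM hX hI
  let 𝒰 : T.OpenCover :=
    { I₀ := T
      X x := Spec (.of (B x))
      f := j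
      mem₀ := by
        rw [Scheme.presieve₀_mem_precoverage_iff]
        exact ⟨fun x => ⟨x, hx x⟩, hj⟩ }
  have compatible (x y : T) : Limits.pullback.fst (j x) (j y) ≫ h x =
      Limits.pullback.snd (j x) (j y) ≫ h y := by
    refine eq_of_comp_sectionProj_eq hM hX ?_ ?_
    · rw [Category.assoc, Category.assoc, hh, hh, Limits.pullback.condition_assoc]
    · rw [Category.assoc, hh, ← Category.assoc, Scheme.IdealSheafData.comap_comp]
      exact hI.comap _
  refine ⟨𝒰.glueMorphisms h compatible, 𝒰.hom_ext _ _ fun x => ?_⟩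
  rw [← Category.assoc, 𝒰.ι_glueMorphisms]
  exact hh x

end Lift

section SegreForms

variable {R B : Type*} [CommRing R] [CommRing B] {α β : Type*}

/-- The substitution `z_{(i,j)} = xᵢ yⱼ`, which regards a form on the Segre variety as a polynomial
in the `yⱼ` over the ring of polynomials in the `xᵢ`. -/
def iteratedSegreHom : MvPolynomial (α × β) R →+* MvPolynomial β (MvPolynomial α R) :=
  eval₂Hom (C.comp C) fun p => C (X p.1) * X p.2

lemma eval₂_iteratedSegreHom (φ : MvPolynomial α R →+* B) (η : β → B) (f : MvPolynomial (α × β) R) :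
    (iteratedSegreHom f).eval₂ φ η = f.eval₂ (φ.comp C) fun p => φ (X p.1) * η p.2 := by
  have comp_eq : (eval₂Hom φ η).comp iteratedSegreHom =
      eval₂Hom (φ.comp C) fun p => φ (X p.1) * η p.2 := by
    ext <;> simp [iteratedSegreHom]
  exact RingHom.congr_fun comp_eq f

lemma isHomogeneous_iteratedSegreHom {f : MvPolynomial (α × β) R} {n : ℕ}
    (hf : f.IsHomogeneous n) : (iteratedSegreHom f).IsHomogeneous n := by
  have homogeneous := hf.eval₂ (C.comp C : R →+* MvPolynomial β (MvPolynomial α R))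
    (fun p : α × β => C (X p.1) * X p.2) (n := 1)
    (fun z => isHomogeneous_C _ _) (fun p => isHomogeneous_C_mul_X _ _)
  rwa [one_mul] at homogeneous

end SegreForms

section Dehomogenize

variable {σ A : Type*} [CommRing A] [SetLike σ A] [AddSubgroupClass σ A] {𝒜 : ℕ → σ}
  [GradedRing 𝒜] {f a : A} {n : ℕ}

lemma exists_pow_mul_eq_zero_of_dehomogenize_eq_zero (hf : f ∈ 𝒜 1) (ha : a ∈ 𝒜 n)
    (h : dehomogenize hf a = 0) : ∃ N, f ^ N * a = 0 := by
  have val_eq := congrArg HomogeneousLocalization.val h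
  rw [dehomogenize_of_mem hf ha, Away.val_mk, HomogeneousLocalization.val_zero,
    Localization.mk_eq_mk', IsLocalization.mk'_eq_zero_iff] at val_eq
  obtain ⟨⟨_, N, rfl⟩, pow_mul⟩ := val_eq
  exact ⟨N, pow_mul⟩

lemma map_eq_zero_of_dehomogenize_eq_zero {S : Type*} [CommRing S] [IsDomain S] {θ : A →+* S}
    (hf : f ∈ 𝒜 1) (hθ : θ f ≠ 0) (ha : a ∈ 𝒜 n) (h : dehomogenize hf a = 0) : θ a = 0 := by
  obtain ⟨N, pow_mul⟩ := exists_pow_mul_eq_zero_of_dehomogenize_eq_zero hf ha h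
  have map_pow_mul := congrArg θ pow_mul
  rw [map_mul, map_pow, map_zero] at map_pow_mul
  exact (mul_eq_zero.1 map_pow_mul).resolve_left (pow_ne_zero N hθ)

end Dehomogenize

section ExceptionalDivisor

variable (c : Fin 3 → Fin 4 × Fin 4 → ℂ)

/-- The homogeneous coordinates `xᵢ Δⱼ(x)` of the generic point of the section, where the `Δⱼ` are
the maximal minors of the matrix of linear forms. -/
def genericPointHom : SectionRing c →+* MvPolynomial (Fin 4) ℂ :=
  pointHom (RingHom.id _) (maxMinor (linMatrix c)) (sum_mul_maxMinor (linMatrix c))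

variable {c}

@[simp] lemma genericPointHom_coord (p : Fin 4 × Fin 4) :
    genericPointHom c (coord c p) = X p.1 * maxMinor (linMatrix c) p.2 :=
  pointHom_coord _ _ _ _

lemma genericPointHom_slice (k : Fin 4) {n : ℕ} {f : MvPolynomial (Fin 4) ℂ}
    (hf : f.IsHomogeneous n) :
    genericPointHom c (slice c k f) = maxMinor (linMatrix c) k ^ n * f :=
  map_eq_pow_mul_of_isHomogeneous (φ := RingHom.id _) (φ' := (genericPointHom c).comp (slice c k))
    (fun z => by simp [genericPointHom]) (fun i => by simp [mul_comm]) hf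

lemma slice_mem_sectionGrading (k : Fin 4) {n : ℕ} {f : MvPolynomial (Fin 4) ℂ}
    (hf : f.IsHomogeneous n) : slice c k f ∈ sectionGrading c n := by
  have slice_eq : slice c k = (Ideal.Quotient.mk _).comp (rename fun i => (i, k)).toRingHom := by
    ext <;> simp [coord]
  rw [slice_eq]
  exact mk_mem_quotientGrading _ hf.rename_isHomogeneous

lemma genericPointHom_eq_zero_of_mul_eq_zero (hne : ∀ j, maxMinor (linMatrix c) j ≠ 0)
    {a k : Fin 4} {n : ℕ} {x : SectionRing c} (hx : x ∈ sectionGrading c n)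
    (h : dehomogenize (coord_mem c (a, k)) x *
      dehomogenize (coord_mem c (a, k)) (slice c k (maxMinor (linMatrix c) k)) = 0) :
    genericPointHom c x = 0 := by
  have homogeneous := isHomogeneous_maxMinor (isHomogeneous_linMatrix c) k
  have coord_ne_zero : genericPointHom c (coord c (a, k)) ≠ 0 := by
    rw [genericPointHom_coord]
    exact mul_ne_zero (X_ne_zero _) (hne k)
  have mul_eq_zero := map_eq_zero_of_dehomogenize_eq_zero (coord_mem c (a, k)) coord_ne_zero
    (SetLike.mul_mem_graded hx (slice_mem_sectionGrading k homogeneous)) (by rwa [map_mul])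
  rw [map_mul, genericPointHom_slice k homogeneous] at mul_eq_zero
  exact (_root_.mul_eq_zero.1 mul_eq_zero).resolve_right
    (mul_ne_zero (pow_ne_zero _ (hne k)) (hne k))

lemma eval₂_iteratedSegreHom_slice {B : Type} [CommRing B] {a k : Fin 4} {ψ : SectionRing c →+* B}
    (hψ : ψ (coord c (a, k)) = 1) (f : MvPolynomial (Fin 4 × Fin 4) ℂ) :
    (iteratedSegreHom f).eval₂ (ψ.comp (slice c k)) (fun j => ψ (coord c (a, j))) =
      ψ (Ideal.Quotient.mk _ f) := by
  have hom_eq : eval₂Hom ((ψ.comp (slice c k)).comp C)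
      (fun p => ψ.comp (slice c k) (X p.1) * ψ (coord c (a, p.2))) =
        ψ.comp (Ideal.Quotient.mk _) := by
    refine MvPolynomial.ringHom_ext (fun z => by simp) fun p => ?_
    rw [eval₂Hom_X', RingHom.comp_apply, slice_X, ← map_coord_eq_mul hψ]
    rfl
  rw [eval₂_iteratedSegreHom]
  exact RingHom.congr_fun hom_eq f

variable {C : Scheme.{0}} {i : C ⟶ projSpace (Fin 4)} [IsIntegral C] [IsClosedImmersion i]
  [SmoothOfRelativeDimension 1 (i ≫ structureMap (polyGrading (Fin 4)))]

/-- Otherwise the annihilator of `b` lies in a maximal ideal, whose residue field gives a common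
zero of the `2 × 2` minors in `ℙ³`. -/
lemma eq_zero_of_minorTwo_pow_mul_eq_zero {M : Matrix (Fin 3) (Fin 4) (MvPolynomial (Fin 4) ℂ)}
    (hM : IsDeterminantal (idealOf i).toIdeal M) {B : Type} [CommRing B] {a : Fin 4}
    (hX : X a ∉ (idealOf i).toIdeal) {φ : MvPolynomial (Fin 4) ℂ →+* B} (hφ : φ (X a) = 1) {n : ℕ}
    {b : B} (hb : ∀ r s p q, p ≠ q → φ (minorTwo M r s p q) ^ n * b = 0) : b = 0 := by
  rw [← Ideal.torsionOf_eq_top_iff (R := B)]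
  by_contra torsion_ne_top
  obtain ⟨m, hm, torsion_le⟩ := Ideal.exists_le_maximal _ torsion_ne_top
  let _ := Ideal.Quotient.field m
  have X_eq_zero := eq_zero_of_minorTwo_eq_zero hM ((Ideal.Quotient.mk m).comp φ)
    (fun r s p q => ?_) hX
  · rw [RingHom.comp_apply, hφ, map_one] at X_eq_zero
    exact one_ne_zero X_eq_zero
  · obtain rfl | hpq := eq_or_ne p q
    · rw [minorTwo, sub_self, map_zero]
    · rw [RingHom.comp_apply, Ideal.Quotient.eq_zero_iff_mem]
      exact hm.isPrime.mem_of_pow_mem n (torsion_le (hb r s p q hpq))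

variable (hM : IsDeterminantal (idealOf i).toIdeal (linMatrix c))
  (hX : ∀ a, X a ∉ (idealOf i).toIdeal)

include hM hX

lemma map_eq_zero_of_genericPointHom_eq_zero {B : Type} [CommRing B] {a k : Fin 4}
    {ψ : SectionRing c →+* B} (hψ : ψ (coord c (a, k)) = 1) {n : ℕ} {x : SectionRing c}
    (hx : x ∈ sectionGrading c n) (h : genericPointHom c x = 0) : ψ x = 0 := by
  obtain ⟨f, hf, rfl⟩ := hx
  have eval_eq_zero : MvPolynomial.eval (maxMinor (linMatrix c)) (iteratedSegreHom f) = 0 :=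
    (eval₂_iteratedSegreHom (RingHom.id _) _ f).trans h
  refine eq_zero_of_minorTwo_pow_mul_eq_zero hM (hX a) (φ := ψ.comp (slice c k))
    (by rw [RingHom.comp_apply, slice_X, hψ]) (n := n) fun r s p q hpq => ?_
  refine (congrArg _ (eval₂_iteratedSegreHom_slice hψ f).symm).trans ?_
  exact minorTwo_pow_mul_eval₂_eq_zero hM.ne_zero hM.isRelPrime (isHomogeneous_iteratedSegreHom hf)
    eval_eq_zero (sum_map_slice_linMatrix_mul_coord hψ) r s hpq

lemma dehomogenize_maxMinor_mem_nonZeroDivisors (a k : Fin 4) :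
    dehomogenize (coord_mem c (a, k)) (slice c k (maxMinor (linMatrix c) k)) ∈
      nonZeroDivisors (Away (sectionGrading c) (coord c (a, k))) := by
  rw [mem_nonZeroDivisors_iff_right]
  intro b hb
  obtain ⟨n, x, hx, rfl⟩ := Away.mk_surjective (sectionGrading c) (coord_mem c (a, k)) b
  have hx' : x ∈ sectionGrading c n := by simpa using hx
  rw [← dehomogenize_of_mem (coord_mem c (a, k)) hx'] at hb ⊢
  exact map_eq_zero_of_genericPointHom_eq_zero hM hX (dehomogenize_self _) hx'
    (genericPointHom_eq_zero_of_mul_eq_zero hM.ne_zero hx' hb)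

lemma isGeneratedByNonZeroDivisor_comap_awayι (a k : Fin 4) :
    IsGeneratedByNonZeroDivisor (specIdeal ((i.ker.comap (sectionProj c)).comap
      (Proj.awayι (sectionGrading c) (coord c (a, k)) (coord_mem c (a, k)) one_pos))) := by
  refine ⟨_, dehomogenize_maxMinor_mem_nonZeroDivisors hM hX a k, ?_⟩
  rw [← Scheme.IdealSheafData.comap_comp, awayι_sectionProj, projChart,
    specIdeal_comap_point hM (hX a)]
  rw [← RingHom.comp_apply]
  simp only [map_maxMinor]
  exact span_range_maxMinor_eq_span_singleton
    (η := fun j => dehomogenize (coord_mem c (a, k)) (coord c (a, j)))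
    (sum_map_slice_linMatrix_mul_coord (dehomogenize_self _)) (isUnit_dehomogenize_self _)

lemma isInvertibleIdeal_comap_sectionProj : IsInvertibleIdeal (i.ker.comap (sectionProj c)) := by
  refine isInvertibleIdeal_of_charts fun x => ?_
  choose p hp using exists_mem_basicOpen_coord x
  exact
    { ring := .of (Away (sectionGrading c) (coord c p))
      ι := Proj.awayι (sectionGrading c) (coord c p) (coord_mem c p) one_pos
      mem := by rwa [Proj.opensRange_awayι]
      isGeneratedByNonZeroDivisor :=
        isGeneratedByNonZeroDivisor_comap_awayι hM hX p.1 p.2 }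

lemma isBlowup_sectionProj : IsBlowup (sectionProj c) i.ker where
  isInvertible_comap := isInvertibleIdeal_comap_sectionProj hM hX
  existsUnique_lift g hI := by
    obtain ⟨h, rfl⟩ := exists_lift hM hX hI
    exact ⟨h, rfl, fun h' hh => eq_of_comp_sectionProj_eq hM hX hh (by rwa [hh])⟩

end ExceptionalDivisor

lemma IsBlowup.exists_iso {X Y Y' : Scheme.{0}} {I : X.IdealSheafData} {π : Y ⟶ X} {π' : Y' ⟶ X}
    (h : IsBlowup π I) (h' : IsBlowup π' I) : ∃ e : Y ≅ Y', e.hom ≫ π' = π := by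
  obtain ⟨f, hf, -⟩ := h'.existsUnique_lift π h.isInvertible_comap
  obtain ⟨g, hg, -⟩ := h.existsUnique_lift π' h'.isInvertible_comap
  refine ⟨⟨f, g, ?_, ?_⟩, hf⟩
  · exact (h.existsUnique_lift π h.isInvertible_comap).unique
      (by rw [Category.assoc, hg, hf]) (Category.id_comp _)
  · exact (h'.existsUnique_lift π' h'.isInvertible_comap).unique
      (by rw [Category.assoc, hf, hg]) (Category.id_comp _)

lemma exists_eq_linMatrix {R α β ρ : Type*} [CommRing R] [Fintype α]
    {M : Matrix ρ β (MvPolynomial α R)} (hM : ∀ r j, (M r j).IsHomogeneous 1) :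
    ∃ c, M = linMatrix c := by
  choose b hb using fun r j => exists_eq_sum_C_mul_X (hM r j)
  exact ⟨fun r p => b r p.2 p.1, Matrix.ext fun r j => hb r j⟩

end

end SexticBlowup

theorem mainTheorem8 (C : Scheme.{0}) (i : C ⟶ projSpace (Fin 4))
    [IsClosedImmersion i] [IsIntegral C]
    [SmoothOfRelativeDimension 1 (i ≫ structureMap (polyGrading (Fin 4)))]
    (hdg : HasDegreeGenus (idealOf i) 6 3)
    (hcubics : IsIntersectionOfDegree 3 (Set.range i)) :
    (∃ (Y : Scheme.{0}) (π : Y ⟶ projSpace (Fin 4)), IsBlowup π i.ker) ∧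
    ∀ (Y : Scheme.{0}) (π : Y ⟶ projSpace (Fin 4)), IsBlowup π i.ker →
      ∃ V : Submodule ℂ (Fin 4 × Fin 4 → ℂ), Module.finrank ℂ V = 13 ∧
        ∃ e : Y ≅ projSubscheme (segreSectionIdeal V),
          e.hom ≫ structureMap _ = π ≫ structureMap _ := by
  have hI := isCubicSexticIdeal_idealOf hdg hcubics
  obtain ⟨M, hM⟩ := hI.exists_isDeterminantal
  obtain ⟨c, rfl⟩ := exists_eq_linMatrix hM.isHomogeneous
  have hX (a : Fin 4) : MvPolynomial.X a ∉ (idealOf i).toIdeal := fun h =>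
    MvPolynomial.X_ne_zero a (hI.eq_zero one_le_two (MvPolynomial.isHomogeneous_X ℂ a) h)
  have hb := isBlowup_sectionProj hM hX
  refine ⟨⟨_, _, hb⟩, fun Y π hπ => ?_⟩
  have finrank_eq : 3 + Module.finrank ℂ (sectionSpace c) = 3 + 13 := by
    simpa using finrank_sectionSpace
      (linearIndependent_of_maxMinor_linMatrix_ne_zero (hM.ne_zero 0))
  obtain ⟨e, he⟩ := hπ.exists_iso hb
  exact ⟨sectionSpace c, Nat.add_left_cancel finrank_eq, e,
    by rw [← he, Category.assoc, sectionProj_structureMap]⟩
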